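/- **The class $\mathcal S$.** Let $\mathcal S$ be the Selberg class: the set of Dirichlet series $F(s)=\sum_{n\ge1}a_n n^{-s}$, absolutely convergent for $\Re s>1$, such that 1. $(s-1)^mF(s)$ continues to an entire function of finite order for some integer $m\ge 0$; 2. $a_n\ll_\varepsilon n^{\varepsilon}$ for every $\varepsilon>0$; 3. there are $k\ge 0$, $\epsilon\in\mathbb C$ with $|\epsilon|=1$, $Q>0$, $w_i>0$ and $\mu_i\in\mathbb C$ with $\Re\mu_i\ge0$ $(1\le i\le k)$ such that $\Phi(s)=\epsilon Q^s\prod_{i=1}^k\Gamma(w_is+\mu_i)\,F(s)$ satisfies $\Phi(s)=\overline{\Phi(1-\bar s)}$ (as an identity of meromorphic functions); 4. $a_1=1$, and $\log F(s)=\sum_{n\ge1} b_nn^{-s}$ for $\Re s>1$, where $b_n=0$ unless $n$ is a positive power of a prime, and $b_n\ll n^\theta$ for some $\theta<1/2$. Call $F\in\mathcal S$ *primitive* if $F\ne1$ and $F=F_1F_2$ with $F_1,F_2\in\mathcal S$ implies $F_1=1$ or $F_2=1$. For $F,G\in\mathcal S$, say that $F$ *divides* $G$ in $\mathcal S$ if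 $G=FH$ for some $H\in\mathcal S$. For a Dirichlet character $\chi$ put $F^\chi(s)=\sum_{n\ge1} a_n\chi(n)n^{-s}$. **Selberg's conjectures** are the following three statements (sums over primes $p$, $x\to\infty$). * *Regularity of distribution.* For each $F\in\mathcal S$ there is an integer $n_F$ with $\sum_{p\le x}|a_p|^2/p=n_F\log\log x+O(1)$. * *Orthonormality.* If $F$ is primitive, then $n_F=1$; if $F\neq F'$ are both primitive, with coefficients $a_n$ and $a_n'$, then $\sum_{p\le x}a_p\overline{a_p'}/p=O(1)$. * *$GL(1)$ twists.* If $\chi$ is a primitive Dirichlet character, $F,F^\chi\in\mathcal S$, and $F=\prod_{i=1}^kF_i$ with all $F_i$ primitive, then the $F_i^\chi$ are primitive elements of $\mathcal S$ and $F^\chi=\prod_{i=1}^kF_i^\chi$. **Proposition 4.3.** Assume Selberg's conjectures. Let $F\in\mathcal S$, and suppose that $F$ has a pole of order $m$ at $s=1$ (where $m=0$ is allowed and means that $F$ is regular and non-zero at $s=1$). Then $\zeta(s)^m$ divides $F$ in $\mathcal S$; that is, $\zeta^m\in\mathcal S$ and $F=\zeta^m G$ for some $G\in\mathcal S$. -/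

import Mathlib

namespace Selberg

open Filter Asymptotics ComplexConjugate

/-- `F` is given on `Re s > 1` by the absolutely convergent Dirichlet series `∑ a n / n ^ s`
(the value `a 0` plays no role). -/
def HasDirichletSeries (F : ℂ → ℂ) (a : ℕ → ℂ) : Prop :=
  ∀ s : ℂ, 1 < s.re → LSeriesHasSum a s (F s)

/-- Growth of finite order: `E s = O(exp (|s| ^ ρ))` as `|s| → ∞`, for some real `ρ`. -/
def HasFiniteOrder (E : ℂ → ℂ) : Prop :=
  ∃ ρ : ℝ, E =O[Bornology.cobounded ℂ] fun s ↦ Real.exp (‖s‖ ^ ρ)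

/-- For some `m`, the function `(s - 1) ^ m * F s` is (off `s = 1`, where the value of `F` is
irrelevant) an entire function of finite order. -/
def IsAnalyticOfFiniteOrder (F : ℂ → ℂ) : Prop :=
  ∃ (m : ℕ) (E : ℂ → ℂ), Differentiable ℂ E ∧ HasFiniteOrder E ∧
    ∀ s : ℂ, s ≠ 1 → E s = (s - 1) ^ m * F s

/-- The Ramanujan hypothesis `a n = O_ε(n ^ ε)` for every `ε > 0`. -/
def RamanujanHypothesis (a : ℕ → ℂ) : Prop :=
  ∀ ε : ℝ, 0 < ε → a =O[atTop] fun n : ℕ ↦ (n : ℝ) ^ ε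

/-- The gamma factor `ε * Q ^ s * ∏ i, Γ(w i * s + μ i)`. -/
noncomputable def gammaFactor (ε : ℂ) (Q : ℝ) {k : ℕ} (w : Fin k → ℝ) (μ : Fin k → ℂ)
    (s : ℂ) : ℂ :=
  ε * (Q : ℂ) ^ s * ∏ i, Complex.Gamma ((w i : ℂ) * s + μ i)

/-- None of the factors `Γ(w i * s + μ i)` has a pole at `s`. -/
def IsRegularPoint {k : ℕ} (w : Fin k → ℝ) (μ : Fin k → ℂ) (s : ℂ) : Prop :=
  ∀ (i : Fin k) (n : ℕ), (w i : ℂ) * s + μ i ≠ -(n : ℂ)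

/-- The functional equation `Φ(s) = conj (Φ(1 - conj s))` for `Φ = γ F`, as an identity of
meromorphic functions: it is required at every `s` outside the discrete set where one of the
functions `F`, `Γ(w i * · + μ i)` on either side may have a pole. -/
def HasFunctionalEquation (F : ℂ → ℂ) : Prop :=
  ∃ (ε : ℂ) (Q : ℝ) (k : ℕ) (w : Fin k → ℝ) (μ : Fin k → ℂ),
    ‖ε‖ = 1 ∧ 0 < Q ∧ (∀ i, 0 < w i) ∧ (∀ i, 0 ≤ (μ i).re) ∧
    ∀ s : ℂ, s ≠ 0 → s ≠ 1 → IsRegularPoint w μ s → IsRegularPoint w μ (1 - conj s) →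
      gammaFactor ε Q w μ s * F s =
        conj (gammaFactor ε Q w μ (1 - conj s) * F (1 - conj s))

/-- The Euler product axiom: `log F(s) = ∑ b n / n ^ s` on `Re s > 1`, with `b` supported on
the positive powers of primes and `b n = O(n ^ θ)` for some `θ < 1 / 2`. -/
def HasEulerProduct (F : ℂ → ℂ) : Prop :=
  ∃ (b : ℕ → ℂ) (θ : ℝ), θ < 1 / 2 ∧ (∀ n, ¬ IsPrimePow n → b n = 0) ∧
    (b =O[atTop] fun n : ℕ ↦ (n : ℝ) ^ θ) ∧
    ∀ s : ℂ, 1 < s.re → LSeriesSummable b s ∧ Complex.exp (LSeries b s) = F s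

/-- Membership of (the meromorphic continuation of) a Dirichlet series in the Selberg class.
The value of `F` at `s = 1`, where `F` may have a pole, is irrelevant. -/
def SelbergClass (F : ℂ → ℂ) : Prop :=
  IsAnalyticOfFiniteOrder F ∧ HasFunctionalEquation F ∧ HasEulerProduct F ∧
    ∃ a : ℕ → ℂ, HasDirichletSeries F a ∧ a 1 = 1 ∧ RamanujanHypothesis a

/-- Equality of meromorphic functions on `ℂ` whose only possible pole is `s = 1`. -/
def Same (F G : ℂ → ℂ) : Prop :=
  ∀ s : ℂ, s ≠ 1 → F s = G s

/-- `F ≠ 1` is in the Selberg class and is not a product of two members both different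
from `1`. -/
def IsPrimitive (F : ℂ → ℂ) : Prop :=
  SelbergClass F ∧ ¬ Same F 1 ∧
    ∀ F₁ F₂ : ℂ → ℂ, SelbergClass F₁ → SelbergClass F₂ → Same F (F₁ * F₂) →
      Same F₁ 1 ∨ Same F₂ 1

/-- `F` divides `G` in the Selberg class. -/
def Divides (F G : ℂ → ℂ) : Prop :=
  SelbergClass F ∧ SelbergClass G ∧ ∃ H : ℂ → ℂ, SelbergClass H ∧ Same G (F * H)

/-- The sum of `f p` over the primes `p ≤ x`. -/
noncomputable def primeSum (f : ℕ → ℂ) (x : ℝ) : ℂ :=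
  ∑ p ∈ (Finset.Icc 1 ⌊x⌋₊).filter Nat.Prime, f p

/-- `∑_{p ≤ x} |a p| ^ 2 / p = n * log log x + O(1)` as `x → ∞`, i.e. `n_F = n` for the function
`F` with coefficients `a`. -/
def HasSelbergNumber (a : ℕ → ℂ) (n : ℤ) : Prop :=
  (fun x : ℝ ↦ primeSum (fun p ↦ (‖a p‖ : ℂ) ^ 2 / p) x - ((n * Real.log (Real.log x) : ℝ) : ℂ))
    =O[atTop] fun _ ↦ (1 : ℝ)

/-- `∑_{p ≤ x} a p * conj (a' p) / p = O(1)` as `x → ∞`. -/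
def AreOrthogonal (a a' : ℕ → ℂ) : Prop :=
  (fun x : ℝ ↦ primeSum (fun p ↦ a p * conj (a' p) / p) x) =O[atTop] fun _ ↦ (1 : ℝ)

/-- `G` is the twist of `F` by the Dirichlet character `χ`: if `F s = ∑ a n / n ^ s`, then
`G s = ∑ a n * χ n / n ^ s`. -/
def IsTwist {N : ℕ} (χ : DirichletCharacter ℂ N) (F G : ℂ → ℂ) : Prop :=
  ∃ a : ℕ → ℂ, HasDirichletSeries F a ∧ HasDirichletSeries G fun n ↦ a n * χ (n : ZMod N)

/-- Selberg's conjectures on regularity of distribution, orthonormality and `GL(1)` twists.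
(The Riemann hypothesis for the Selberg class is not among them.) -/
structure Conjectures : Prop where
  regularity : ∀ (F : ℂ → ℂ) (a : ℕ → ℂ), SelbergClass F → HasDirichletSeries F a →
    ∃ n : ℤ, HasSelbergNumber a n
  normality : ∀ (F : ℂ → ℂ) (a : ℕ → ℂ), IsPrimitive F → HasDirichletSeries F a →
    HasSelbergNumber a 1
  orthogonality : ∀ (F F' : ℂ → ℂ) (a a' : ℕ → ℂ), IsPrimitive F → IsPrimitive F' →
    ¬ Same F F' → HasDirichletSeries F a → HasDirichletSeries F' a' → AreOrthogonal a a'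
  twists : ∀ (N : ℕ) [NeZero N] (χ : DirichletCharacter ℂ N), χ.IsPrimitive →
    ∀ F Fχ : ℂ → ℂ, SelbergClass F → SelbergClass Fχ → IsTwist χ F Fχ →
      ∀ (k : ℕ) (f : Fin k → ℂ → ℂ), (∀ i, IsPrimitive (f i)) → Same F (∏ i, f i) →
        ∃ g : Fin k → ℂ → ℂ, (∀ i, IsTwist χ (f i) (g i)) ∧ (∀ i, IsPrimitive (g i)) ∧
          Same Fχ (∏ i, g i)

end Selberg

/-! Everything rests on unique factorization at `s = 1`: write `F` as a product of primitive
functions and show that the factors different from `ζ` have neither pole nor zero at `1`. The copies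
of `ζ` then account for the whole pole, so there are exactly `m` of them, and the product of the
other factors is the cofactor.

Factorization exists because the half degree `∑ w i` is additive, depends only on the function, and
exceeds `1 / 42` unless the function is `1`. It is unique since Stirling and the functional equation
fix the exact order of growth `|t| ^ ((1 + 2 A) δ)` on `Re s = -A` (`HasHalfDegree.unique`). For the
gap, a small `δ` makes `F` grow slowly in a wide strip (Phragmén–Lindelöf), and shifting a contour
then gives `a n = O(n ^ (-4))`. So the Dirichlet series still converges on `Re s = -1`, `F` is
bounded there, and `δ = 0`. With no gamma factors left, the Euler product with `θ < 1 / 2` makes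
`log F` converge absolutely past the critical line; reflection bounds `F' / F` on the whole plane,
and Liouville gives `F = 1` (`SelbergClass.same_one_of_small`).

The order at `1` is visible in the coefficients at primes: `Re ∑ a p / p ^ x = r log (1 / (x - 1)) +
O(1)`. Comparison with the sums `∑ a p / p`, which are correlations with `ζ`, gives `n * poleOrder F
= e` when `⟨ζ, ζ⟩ = n` and `⟨F, ζ⟩ = e` (`SelbergClass.mul_poleOrder_eq`). Once `ζ` is known to be
primitive, normality gives `n = 1`, and orthogonality gives `e = 0` for every primitive `P ≠ ζ`, so
`P` has order `0`.

Primitivity of `ζ` comes from the same relation. Each primitive factor `P` of `ζ` correlates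
positively with `ζ`, as `P` is among the factors, hence has a pole; but `ζ` has only a simple pole
to share out. -/

namespace Selberg

open Filter Asymptotics ComplexConjugate

/-! ### Stirling on vertical lines, from Euler's limit formula for `Γ`. -/

section GammaRatio

open Complex Topology

/-- Second order Taylor comparison for `t ↦ log (t ^ 2 + y ^ 2) / 2`. -/
lemma abs_log_sq_add_sq_sub_le {y : ℝ} (hy : 1 ≤ |y|) {x d : ℝ} (hd : 0 ≤ d) (j : ℕ) :
    |(Real.log ((x + d + j) ^ 2 + y ^ 2) / 2 - Real.log ((x + j) ^ 2 + y ^ 2) / 2)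
      - d * (Real.log ((x + (j + 1 : ℕ)) ^ 2 + y ^ 2) / 2
        - Real.log ((x + j) ^ 2 + y ^ 2) / 2)| ≤
      (4 * (|x| + 1) ^ 2 * (d + 1) * d) * (1 / ((j : ℝ) + 1) ^ 2) := by
  have hy2 : 1 ≤ y ^ 2 := by
    rw [← sq_abs]; nlinarith
  -- `S` bounds `1 / (t ^ 2 + y ^ 2)` for `t ≥ x + j`, and therefore the second derivative of `log
  -- (t ^ 2 + y ^ 2) / 2` there. It is summable over `j` and free of `y`.
  set S : ℝ := 2 * (|x| + 1) ^ 2 / ((j : ℝ) + 1) ^ 2 with hS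
  have hpos (t : ℝ) : 0 < t ^ 2 + y ^ 2 := by positivity
  have hS' {t : ℝ} (ht : x + j ≤ t) : 1 / (t ^ 2 + y ^ 2) ≤ S := by
    rw [hS, div_le_div_iff₀ (hpos t) (by positivity)]
    have h1 : (j : ℝ) + 1 ≤ |t| + (|x| + 1) := by
      have := le_abs_self t; have := neg_abs_le x; linarith
    have h2 : ((j : ℝ) + 1) ^ 2 ≤ 2 * |t| ^ 2 + 2 * (|x| + 1) ^ 2 := by
      have : ((j : ℝ) + 1) ^ 2 ≤ (|t| + (|x| + 1)) ^ 2 := by gcongr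
      nlinarith [sq_nonneg (|t| - (|x| + 1))]
    rw [sq_abs] at h2
    have h3 : 1 ≤ (|x| + 1) ^ 2 := by nlinarith [abs_nonneg x]
    nlinarith [mul_nonneg (sub_nonneg.2 h3) (sq_nonneg t), mul_nonneg (sub_nonneg.2 hy2) (sq_nonneg (|x| + 1))]
  have hder (t : ℝ) : HasDerivAt (fun t : ℝ ↦ Real.log (t ^ 2 + y ^ 2) / 2)
      (t / (t ^ 2 + y ^ 2)) t := by
    have h := (((hasDerivAt_pow 2 t).add_const (y ^ 2)).log (hpos t).ne').div_const 2
    refine h.congr_deriv ?_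
    field_simp
    norm_num [mul_comm]
  have hder2 (t : ℝ) : HasDerivAt (fun t : ℝ ↦ t / (t ^ 2 + y ^ 2))
      ((y ^ 2 - t ^ 2) / (t ^ 2 + y ^ 2) ^ 2) t := by
    have h := (hasDerivAt_id t).div ((hasDerivAt_pow 2 t).add_const (y ^ 2)) (hpos t).ne'
    refine h.congr_deriv ?_
    simp
    ring_nf
  have hder2_le {t : ℝ} (ht : x + j ≤ t) : ‖(y ^ 2 - t ^ 2) / (t ^ 2 + y ^ 2) ^ 2‖ ≤ S := by
    refine le_trans ?_ (hS' ht)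
    rw [Real.norm_eq_abs, abs_div, abs_of_pos (pow_pos (hpos t) 2),
      div_le_div_iff₀ (pow_pos (hpos t) 2) (hpos t), one_mul, pow_two (t ^ 2 + y ^ 2)]
    gcongr
    rw [abs_le]
    constructor <;> nlinarith [sq_nonneg t, sq_nonneg y]
  have hS0 : 0 ≤ S := by positivity
  have hlip {u : ℝ} (hu : 0 ≤ u) :
      |(x + j + u) / ((x + j + u) ^ 2 + y ^ 2) - (x + j) / ((x + j) ^ 2 + y ^ 2)| ≤ S * u := by
    have := (convex_Ici (x + j)).norm_image_sub_le_of_norm_hasDerivWithin_le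
      (f := fun t : ℝ ↦ t / (t ^ 2 + y ^ 2)) (fun t _ ↦ (hder2 t).hasDerivWithinAt)
      (fun t ht ↦ hder2_le ht) (x := x + j) (y := x + j + u) (Set.mem_Ici.2 le_rfl) (Set.mem_Ici.2 (by linarith))
    simpa [abs_of_nonneg hu] using this
  have key {u : ℝ} (hu : 0 ≤ u) (hud : u ≤ d + 1) :
      |Real.log ((x + j + u) ^ 2 + y ^ 2) / 2 - Real.log ((x + j) ^ 2 + y ^ 2) / 2
        - u * ((x + j) / ((x + j) ^ 2 + y ^ 2))| ≤ S * (d + 1) * u := by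
    have := (convex_Icc 0 (d + 1)).norm_image_sub_le_of_norm_hasDerivWithin_le
      (f := fun u : ℝ ↦ Real.log ((x + j + u) ^ 2 + y ^ 2) / 2
        - u * ((x + j) / ((x + j) ^ 2 + y ^ 2)))
      (f' := fun u ↦ (x + j + u) / ((x + j + u) ^ 2 + y ^ 2) - (x + j) / ((x + j) ^ 2 + y ^ 2))
      (C := S * (d + 1))
      (fun t _ ↦ by
        have h1 := (hder (x + j + t)).comp t ((hasDerivAt_id t).const_add (x + j))
        have h2 := (hasDerivAt_id t).mul_const ((x + j) / ((x + j) ^ 2 + y ^ 2))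
        exact ((h1.sub h2).congr_deriv (by simp)).hasDerivWithinAt)
      (fun t ht ↦ (hlip ht.1).trans (by have := ht.2; gcongr))
      (x := 0) (y := u) ⟨le_rfl, by linarith⟩ ⟨hu, hud⟩
    simp only [add_zero, zero_mul, sub_zero, Real.norm_eq_abs, abs_of_nonneg hu] at this
    convert this using 2
    ring
  -- Increments `d` and `1` from the same base point: subtracting `d` times the second estimate
  -- eliminates the first derivative.
  have k1 := key hd (by linarith)
  have k2 := key zero_le_one (by linarith)
  have e1 : x + d + j = x + j + d := by ring
  have e2 : x + ((j + 1 : ℕ) : ℝ) = x + j + 1 := by push_cast; ring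
  rw [e1, e2]
  have hE : (4 * (|x| + 1) ^ 2 * (d + 1) * d) * (1 / ((j : ℝ) + 1) ^ 2) =
      S * (d + 1) * d + d * (S * (d + 1) * 1) := by
    rw [hS]; field_simp; ring
  rw [hE]
  have k3 := mul_le_mul_of_nonneg_left k2 hd
  rw [← abs_of_nonneg hd, ← abs_mul, abs_of_nonneg hd] at k3
  refine le_trans ?_ (add_le_add k1 k3)
  refine le_trans (le_of_eq ?_) (abs_sub _ _)
  congr 1
  ring

lemma norm_re_add_im {x y : ℝ} : ‖(x : ℂ) + y * I‖ = Real.sqrt (x ^ 2 + y ^ 2) :=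
  Complex.norm_add_mul_I x y

lemma log_norm_GammaSeq {x y : ℝ} (hy : y ≠ 0) {n : ℕ} (hn : n ≠ 0) :
    Real.log ‖GammaSeq (x + y * I) n‖ = x * Real.log n + Real.log (n.factorial : ℝ)
      - ∑ j ∈ Finset.range (n + 1), Real.log ((x + j) ^ 2 + y ^ 2) / 2 := by
  have hpos (t : ℝ) : 0 < t ^ 2 + y ^ 2 := by positivity
  have hterm (j : ℕ) : ‖(x : ℂ) + y * I + j‖ = Real.sqrt ((x + j) ^ 2 + y ^ 2) := by
    rw [← norm_re_add_im]; congr 1; push_cast; ring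
  have hn' : (0 : ℝ) < n := by positivity
  rw [GammaSeq, norm_div, norm_mul, norm_prod, Complex.norm_natCast_cpow_of_pos (by positivity),
    Complex.norm_natCast, Real.log_div, Real.log_mul, Real.log_rpow hn', Real.log_prod]
  · simp [hterm, Real.log_sqrt (hpos _).le]
  · intro j _
    rw [hterm]
    exact (Real.sqrt_pos.2 (hpos _)).ne'
  · positivity
  · positivity
  · positivity
  · refine Finset.prod_ne_zero_iff.2 fun j _ ↦ ?_
    rw [hterm]
    exact (Real.sqrt_pos.2 (hpos _)).ne'

lemma Gamma_ne_zero_of_im_ne_zero {s : ℂ} (hs : s.im ≠ 0) : Gamma s ≠ 0 :=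
  Gamma_ne_zero fun m h ↦ hs (by simp [h])

lemma tendsto_log_norm_GammaSeq {x y : ℝ} (hy : y ≠ 0) :
    Tendsto (fun n ↦ Real.log ‖GammaSeq (x + y * I) n‖) atTop
      (𝓝 (Real.log ‖Gamma (x + y * I)‖)) :=
  ((Real.continuousAt_log (norm_ne_zero_iff.2
    (Gamma_ne_zero_of_im_ne_zero (by simpa)))).tendsto).comp (GammaSeq_tendsto_Gamma _).norm

/-- Allows `log n` in Euler's formula to be replaced by the end term of the telescoping sum. -/
lemma tendsto_log_shift (x y : ℝ) :
    Tendsto (fun n : ℕ ↦ Real.log n - Real.log ((x + (n + 1 : ℕ)) ^ 2 + y ^ 2) / 2) atTop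
      (𝓝 0) := by
  have h1 : Tendsto (fun n : ℕ ↦ (x + 1) * ((n : ℝ))⁻¹ + 1) atTop (𝓝 ((x + 1) * 0 + 1)) :=
    (tendsto_inv_atTop_nhds_zero_nat.const_mul _).add_const 1
  have h2 : Tendsto (fun n : ℕ ↦ y * ((n : ℝ))⁻¹) atTop (𝓝 (y * 0)) :=
    tendsto_inv_atTop_nhds_zero_nat.const_mul _
  have h3 := ((h1.pow 2).add (h2.pow 2))
  have h4 := ((Real.continuousAt_log (x := ((x + 1) * 0 + 1) ^ 2 + (y * 0) ^ 2)
    (by norm_num)).tendsto.comp h3).div_const (-2)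
  simp only [mul_zero, zero_add, one_pow, ne_eq, OfNat.ofNat_ne_zero, not_false_eq_true, zero_pow,
    add_zero, Real.log_one, zero_div] at h4
  refine h4.congr' ?_
  have h5 : ∀ᶠ n : ℕ in atTop, 0 < (x + (n + 1 : ℕ)) ^ 2 + y ^ 2 := by
    filter_upwards [eventually_gt_atTop ⌈-x⌉₊] with n hn
    have : -x < n := Nat.lt_of_ceil_lt hn
    have : 0 < x + (n + 1 : ℕ) := by push_cast; linarith
    positivity
  filter_upwards [eventually_gt_atTop 0, h5] with n hn hp
  have hn' : (0 : ℝ) < n := by exact_mod_cast hn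
  have : ((x + 1) * (n : ℝ)⁻¹ + 1) ^ 2 + (y * (n : ℝ)⁻¹) ^ 2 =
      ((x + (n + 1 : ℕ)) ^ 2 + y ^ 2) / n ^ 2 := by
    push_cast; field_simp; ring
  simp only [Function.comp]
  rw [this, Real.log_div hp.ne' (by positivity), Real.log_pow]
  push_cast; ring

/-- Stirling-type comparison of the values of `Γ` along two vertical lines. -/
lemma exists_abs_log_norm_Gamma_add_sub_le (x : ℝ) {d : ℝ} (hd : 0 ≤ d) :
    ∃ K : ℝ, ∀ y : ℝ, 1 ≤ |y| →
      |Real.log ‖Gamma ((x + d : ℝ) + y * I)‖ - Real.log ‖Gamma (x + y * I)‖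
        - d * Real.log ‖(x : ℂ) + y * I‖| ≤ K := by
  have hsum : Summable fun j : ℕ ↦
      (4 * (|x| + 1) ^ 2 * (d + 1) * d) * (1 / ((j : ℝ) + 1) ^ 2) := by
    refine Summable.mul_left _ ?_
    have := (summable_nat_add_iff 1).2 (Real.summable_one_div_nat_pow.2 (one_lt_two))
    simpa using this
  refine ⟨∑' j : ℕ, (4 * (|x| + 1) ^ 2 * (d + 1) * d) * (1 / ((j : ℝ) + 1) ^ 2), fun y hy ↦ ?_⟩
  have hy0 : y ≠ 0 := by rintro rfl; norm_num at hy
  have hlog : Real.log ‖(x : ℂ) + y * I‖ = Real.log (x ^ 2 + y ^ 2) / 2 := by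
    rw [norm_re_add_im, Real.log_sqrt (by positivity)]
  -- The last term tends to `0`. It is subtracted so that for each `n` the expression is exactly
  -- minus a sum of the Taylor remainders bounded above.
  have hlim : Tendsto (fun n : ℕ ↦ Real.log ‖GammaSeq ((x + d : ℝ) + y * I) n‖
      - Real.log ‖GammaSeq (x + y * I) n‖ - d * Real.log ‖(x : ℂ) + y * I‖
      - d * (Real.log n - Real.log ((x + (n + 1 : ℕ)) ^ 2 + y ^ 2) / 2)) atTop
      (𝓝 (Real.log ‖Gamma ((x + d : ℝ) + y * I)‖ - Real.log ‖Gamma (x + y * I)‖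
        - d * Real.log ‖(x : ℂ) + y * I‖ - d * 0)) :=
    (((tendsto_log_norm_GammaSeq hy0).sub (tendsto_log_norm_GammaSeq hy0)).sub_const _).sub
      ((tendsto_log_shift x y).const_mul d)
  rw [mul_zero, sub_zero] at hlim
  refine le_of_tendsto hlim.abs ?_
  filter_upwards [eventually_ne_atTop 0] with n hn
  rw [log_norm_GammaSeq hy0 hn, log_norm_GammaSeq hy0 hn, hlog]
  have htel : ∑ j ∈ Finset.range (n + 1), (Real.log ((x + (j + 1 : ℕ)) ^ 2 + y ^ 2) / 2
        - Real.log ((x + j) ^ 2 + y ^ 2) / 2) =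
      Real.log ((x + (n + 1 : ℕ)) ^ 2 + y ^ 2) / 2 - Real.log (x ^ 2 + y ^ 2) / 2 := by
    rw [Finset.sum_range_sub (fun j : ℕ ↦ Real.log ((x + j) ^ 2 + y ^ 2) / 2)]
    simp
  have hbound : |∑ j ∈ Finset.range (n + 1),
      ((Real.log ((x + d + j) ^ 2 + y ^ 2) / 2 - Real.log ((x + j) ^ 2 + y ^ 2) / 2)
      - d * (Real.log ((x + (j + 1 : ℕ)) ^ 2 + y ^ 2) / 2
        - Real.log ((x + j) ^ 2 + y ^ 2) / 2))| ≤
      ∑' j : ℕ, (4 * (|x| + 1) ^ 2 * (d + 1) * d) * (1 / ((j : ℝ) + 1) ^ 2) := by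
    refine (Finset.abs_sum_le_sum_abs _ _).trans ?_
    refine (Finset.sum_le_sum fun j _ ↦ abs_log_sq_add_sq_sub_le hy hd j).trans ?_
    exact hsum.sum_le_tsum _ fun j _ ↦ by positivity
  rw [Finset.sum_sub_distrib, ← Finset.mul_sum, htel, Finset.sum_sub_distrib] at hbound
  rw [← abs_neg]
  refine le_trans (le_of_eq ?_) hbound
  congr 1
  ring

/-- `|Γ(x + d + iy)| / |Γ(x + iy)|` has the exact order `|y| ^ d`. -/
lemma exists_norm_Gamma_add_bounds (x : ℝ) {d : ℝ} (hd : 0 ≤ d) :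
    ∃ K : ℝ, 0 < K ∧ ∀ y : ℝ, 1 ≤ |y| →
      ‖Gamma ((x + d : ℝ) + y * I)‖ ≤ K * |y| ^ d * ‖Gamma (x + y * I)‖ ∧
      |y| ^ d * ‖Gamma (x + y * I)‖ ≤ K * ‖Gamma ((x + d : ℝ) + y * I)‖ := by
  obtain ⟨K, hK⟩ := exists_abs_log_norm_Gamma_add_sub_le x hd
  refine ⟨Real.exp K * (|x| + 1) ^ d, by positivity, fun y hy ↦ ?_⟩
  have hy0 : y ≠ 0 := by rintro rfl; norm_num at hy
  have hG (t : ℝ) : 0 < ‖Gamma (t + y * I)‖ :=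
    norm_pos_iff.2 (Gamma_ne_zero_of_im_ne_zero (by simpa))
  have hz1 : |y| ≤ ‖(x : ℂ) + y * I‖ := by
    simpa using Complex.abs_im_le_norm ((x : ℂ) + y * I)
  have hz2 : ‖(x : ℂ) + y * I‖ ≤ (|x| + 1) * |y| := by
    refine (norm_add_le _ _).trans ?_
    simp only [norm_real, norm_mul, norm_I, mul_one, Real.norm_eq_abs]
    nlinarith [abs_nonneg x]
  have hz0 : 0 < ‖(x : ℂ) + y * I‖ := by linarith
  have h := abs_le.1 (hK y hy)
  have hpow : ‖(x : ℂ) + y * I‖ ^ d = Real.exp (d * Real.log ‖(x : ℂ) + y * I‖) := by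
    rw [Real.rpow_def_of_pos hz0, mul_comm]
  have hpow1 : |y| ^ d ≤ ‖(x : ℂ) + y * I‖ ^ d := by gcongr
  have hpow2 : ‖(x : ℂ) + y * I‖ ^ d ≤ (|x| + 1) ^ d * |y| ^ d := by
    rw [← Real.mul_rpow (by positivity) (by positivity)]; gcongr
  have hone : 1 ≤ (|x| + 1) ^ d := Real.one_le_rpow (by linarith [abs_nonneg x]) hd
  constructor
  · have h1 : ‖Gamma ((x + d : ℝ) + y * I)‖ ≤
        Real.exp K * ‖(x : ℂ) + y * I‖ ^ d * ‖Gamma (x + y * I)‖ := by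
      rw [hpow, ← Real.exp_log (hG (x + d)), ← Real.exp_log (hG x), ← Real.exp_add, ← Real.exp_add,
        Real.exp_le_exp]
      linarith [h.2]
    calc _ ≤ _ := h1
      _ ≤ Real.exp K * ((|x| + 1) ^ d * |y| ^ d) * ‖Gamma (x + y * I)‖ := by gcongr
      _ = _ := by ring
  · have h1 : ‖(x : ℂ) + y * I‖ ^ d * ‖Gamma (x + y * I)‖ ≤
        Real.exp K * ‖Gamma ((x + d : ℝ) + y * I)‖ := by
      rw [hpow, ← Real.exp_log (hG (x + d)), ← Real.exp_log (hG x), ← Real.exp_add, ← Real.exp_add,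
        Real.exp_le_exp]
      linarith [h.1]
    calc |y| ^ d * ‖Gamma (x + y * I)‖ ≤ ‖(x : ℂ) + y * I‖ ^ d * ‖Gamma (x + y * I)‖ := by gcongr
      _ ≤ _ := h1
      _ = Real.exp K * 1 * ‖Gamma ((x + d : ℝ) + y * I)‖ := by ring
      _ ≤ _ := by gcongr

end GammaRatio

/-! ### The divisor bound and the Ramanujan hypothesis for products. -/

section DivisorBound

/-- The divisor bound `d(n) = O_ε(n ^ ε)`. -/
lemma exists_card_divisors_le {ε : ℝ} (hε : 0 < ε) :
    ∃ C : ℝ, 0 < C ∧ ∀ n : ℕ, n ≠ 0 → (n.divisors.card : ℝ) ≤ C * (n : ℝ) ^ ε := by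
  -- Chosen so that `a + 1 ≤ B * (1 + a ε log 2) ≤ B * 2 ^ (a ε)`. When `p ^ ε ≥ 2` no constant is
  -- needed, since `a + 1 ≤ 2 ^ a`; only the primes below `M` cost a factor `B`.
  set B : ℝ := 1 + 1 / (ε * Real.log 2) with hB
  have hl2 : 0 < Real.log 2 := Real.log_pos one_lt_two
  have hB1 : 1 ≤ B := by
    have : 0 < 1 / (ε * Real.log 2) := by positivity
    linarith
  obtain ⟨M, hM⟩ : ∃ M : ℕ, ∀ p : ℕ, M ≤ p → 2 ≤ (p : ℝ) ^ ε := by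
    have := (tendsto_rpow_atTop hε).comp tendsto_natCast_atTop_atTop
    exact eventually_atTop.1 (this.eventually_ge_atTop 2)
  refine ⟨B ^ M, by positivity, fun n hn ↦ ?_⟩
  have key (p : ℕ) (hp : p.Prime) (a : ℕ) :
      ((a : ℝ) + 1) ≤ (if p < M then B else 1) * ((p : ℝ) ^ a) ^ ε := by
    have hcomm : ((p : ℝ) ^ a) ^ ε = ((p : ℝ) ^ ε) ^ a := by
      rw [← Real.rpow_natCast, ← Real.rpow_mul (by positivity), mul_comm,
        Real.rpow_mul (by positivity), Real.rpow_natCast]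
    split_ifs with h
    · have h2 : (2 : ℝ) ≤ p := by exact_mod_cast hp.two_le
      have h3 : 1 + a * (ε * Real.log 2) ≤ ((p : ℝ) ^ a) ^ ε := by
        have h4 : ((2 : ℝ) ^ ε) ^ a ≤ ((p : ℝ) ^ ε) ^ a := by gcongr
        rw [hcomm]
        refine le_trans ?_ h4
        rw [Real.rpow_def_of_pos two_pos, ← Real.exp_nat_mul]
        have := Real.add_one_le_exp (a * (Real.log 2 * ε))
        linarith
      calc (a : ℝ) + 1 ≤ B * (1 + a * (ε * Real.log 2)) := by
            rw [hB]
            have : (1 + 1 / (ε * Real.log 2)) * (1 + a * (ε * Real.log 2)) =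
              a + 1 + (a * (ε * Real.log 2) + 1 / (ε * Real.log 2)) := by field_simp; ring
            rw [this]
            have : 0 ≤ a * (ε * Real.log 2) + 1 / (ε * Real.log 2) := by positivity
            linarith
        _ ≤ _ := by gcongr
    · rw [one_mul, hcomm]
      have h2 : (2 : ℝ) ^ a ≤ ((p : ℝ) ^ ε) ^ a := by gcongr; exact hM p (not_lt.1 h)
      have h3 : ((a + 1 : ℕ) : ℝ) ≤ (2 : ℝ) ^ a := by exact_mod_cast Nat.lt_two_pow_self
      push_cast at h3
      linarith
  rw [Nat.card_divisors hn]
  push_cast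
  calc ∏ p ∈ n.primeFactors, ((n.factorization p : ℝ) + 1)
      ≤ ∏ p ∈ n.primeFactors, ((if p < M then B else 1) *
          ((p : ℝ) ^ (n.factorization p)) ^ ε) :=
        Finset.prod_le_prod (fun _ _ ↦ by positivity)
          fun p hp ↦ key p (Nat.prime_of_mem_primeFactors hp) _
    _ = (∏ p ∈ n.primeFactors, if p < M then B else 1) * (n : ℝ) ^ ε := by
        rw [Finset.prod_mul_distrib, Real.finsetProd_rpow _ _ (fun _ _ ↦ by positivity)]
        congr 2
        conv_rhs => rw [← Nat.prod_factorization_pow_eq_self hn]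
        rw [Finsupp.prod]
        push_cast
        rfl
    _ ≤ B ^ M * (n : ℝ) ^ ε := by
        gcongr
        rw [Finset.prod_ite, Finset.prod_const, Finset.prod_const_one, mul_one]
        refine pow_le_pow_right₀ hB1 ?_
        calc _ ≤ (Finset.range M).card := Finset.card_le_card fun p hp ↦ by
              simp only [Finset.mem_filter, Finset.mem_range] at hp ⊢; exact hp.2
          _ = M := Finset.card_range M

lemma exists_norm_le_of_isBigO_rpow {a : ℕ → ℂ} {ε : ℝ}
    (h : a =O[atTop] fun n : ℕ ↦ (n : ℝ) ^ ε) :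
    ∃ C : ℝ, 0 < C ∧ ∀ n : ℕ, n ≠ 0 → ‖a n‖ ≤ C * (n : ℝ) ^ ε := by
  obtain ⟨C, hC, h⟩ := bound_of_isBigO_nat_atTop h
  refine ⟨C, hC, fun n hn ↦ ?_⟩
  have hp : 0 < (n : ℝ) ^ ε := by positivity
  simpa [abs_of_pos hp] using h hp.ne'

lemma RamanujanHypothesis.convolution {a b : ℕ → ℂ} (ha : RamanujanHypothesis a)
    (hb : RamanujanHypothesis b) : RamanujanHypothesis (LSeries.convolution a b) := by
  intro ε hε
  obtain ⟨A, hA, ha⟩ := exists_norm_le_of_isBigO_rpow (ha (ε / 2) (by positivity))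
  obtain ⟨B, hB, hb⟩ := exists_norm_le_of_isBigO_rpow (hb (ε / 2) (by positivity))
  obtain ⟨D, hD, hd⟩ := exists_card_divisors_le (half_pos hε)
  refine IsBigO.of_bound (A * B * D) ?_
  filter_upwards [eventually_ne_atTop 0] with n hn
  rw [LSeries.convolution_def, Real.norm_eq_abs, abs_of_nonneg (by positivity)]
  have hterm : ∀ p ∈ n.divisorsAntidiagonal, ‖a p.1 * b p.2‖ ≤ A * B * (n : ℝ) ^ (ε / 2) := by
    intro p hp
    obtain ⟨hp, -⟩ := Nat.mem_divisorsAntidiagonal.1 hp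
    have h1 : p.1 ≠ 0 := by rintro h; simp [h] at hp; exact hn hp.symm
    have h2 : p.2 ≠ 0 := by rintro h; simp [h] at hp; exact hn hp.symm
    rw [norm_mul]
    calc _ ≤ (A * (p.1 : ℝ) ^ (ε / 2)) * (B * (p.2 : ℝ) ^ (ε / 2)) := by
          gcongr
          · exact ha _ h1
          · exact hb _ h2
      _ = A * B * ((p.1 : ℝ) ^ (ε / 2) * (p.2 : ℝ) ^ (ε / 2)) := by ring
      _ = _ := by
          rw [← Real.mul_rpow (by positivity) (by positivity), ← Nat.cast_mul, hp]
  calc _ ≤ ∑ p ∈ n.divisorsAntidiagonal, A * B * (n : ℝ) ^ (ε / 2) := norm_sum_le_of_le _ hterm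
    _ = (n.divisors.card : ℝ) * (A * B * (n : ℝ) ^ (ε / 2)) := by
        rw [Finset.sum_const, nsmul_eq_mul, ← Nat.map_div_right_divisors, Finset.card_map]
    _ ≤ (D * (n : ℝ) ^ (ε / 2)) * (A * B * (n : ℝ) ^ (ε / 2)) := by gcongr; exact hd n hn
    _ = A * B * D * ((n : ℝ) ^ (ε / 2) * (n : ℝ) ^ (ε / 2)) := by ring
    _ = _ := by rw [← Real.rpow_add (by positivity), add_halves]

end DivisorBound

/-! ### Closure of the Selberg class under products and change of value at `1`. -/

section Same

lemma Same.refl (F : ℂ → ℂ) : Same F F := fun _ _ ↦ rfl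

lemma Same.symm {F G : ℂ → ℂ} (h : Same F G) : Same G F := fun s hs ↦ (h s hs).symm

lemma Same.trans {F G H : ℂ → ℂ} (h : Same F G) (h' : Same G H) : Same F H :=
  fun s hs ↦ (h s hs).trans (h' s hs)

lemma Same.mul {F G F' G' : ℂ → ℂ} (h : Same F F') (h' : Same G G') :
    Same (F * G) (F' * G') := fun s hs ↦ by simp [h s hs, h' s hs]

lemma ne_one_of_one_lt_re {s : ℂ} (hs : 1 < s.re) : s ≠ 1 := by
  rintro rfl; simp at hs

lemma one_sub_conj_ne_one {s : ℂ} (hs : s ≠ 0) : 1 - conj s ≠ 1 := fun h ↦ hs (by simpa using h)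

lemma one_sub_conj_ne_zero {s : ℂ} (hs : s ≠ 1) : 1 - conj s ≠ 0 := fun h ↦ hs <| by
  have : conj s = 1 := (sub_eq_zero.1 h).symm
  simpa using congrArg conj this

/-- `F` satisfies a functional equation whose gamma factor has `∑ i, w i = δ`, half of what is
usually called the degree. -/
def HasHalfDegree (F : ℂ → ℂ) (δ : ℝ) : Prop :=
  ∃ (ε : ℂ) (Q : ℝ) (k : ℕ) (w : Fin k → ℝ) (μ : Fin k → ℂ),
    ‖ε‖ = 1 ∧ 0 < Q ∧ (∀ i, 0 < w i) ∧ (∀ i, 0 ≤ (μ i).re) ∧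
    (∀ s : ℂ, s ≠ 0 → s ≠ 1 → IsRegularPoint w μ s → IsRegularPoint w μ (1 - conj s) →
      gammaFactor ε Q w μ s * F s =
        conj (gammaFactor ε Q w μ (1 - conj s) * F (1 - conj s))) ∧ ∑ i, w i = δ

lemma hasFunctionalEquation_iff {F : ℂ → ℂ} :
    HasFunctionalEquation F ↔ ∃ δ, HasHalfDegree F δ := by
  constructor
  · rintro ⟨ε, Q, k, w, μ, h1, h2, h3, h4, h5⟩
    exact ⟨_, ε, Q, k, w, μ, h1, h2, h3, h4, h5, rfl⟩
  · rintro ⟨δ, ε, Q, k, w, μ, h1, h2, h3, h4, h5, -⟩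
    exact ⟨ε, Q, k, w, μ, h1, h2, h3, h4, h5⟩

lemma HasHalfDegree.same {F G : ℂ → ℂ} {δ : ℝ} (hF : HasHalfDegree F δ) (h : Same F G) :
    HasHalfDegree G δ := by
  obtain ⟨ε, Q, k, w, μ, h1, h2, h3, h4, h5, h6⟩ := hF
  refine ⟨ε, Q, k, w, μ, h1, h2, h3, h4, fun s hs0 hs1 hr hr' ↦ ?_, h6⟩
  rw [← h s hs1, ← h _ (one_sub_conj_ne_one hs0)]
  exact h5 s hs0 hs1 hr hr'

lemma HasHalfDegree.nonneg {F : ℂ → ℂ} {δ : ℝ} (hF : HasHalfDegree F δ) : 0 ≤ δ := by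
  obtain ⟨ε, Q, k, w, μ, h1, h2, h3, h4, h5, rfl⟩ := hF
  exact Finset.sum_nonneg fun i _ ↦ (h3 i).le

lemma gammaFactor_append {k l : ℕ} (ε ε' : ℂ) {Q Q' : ℝ} (hQ : 0 < Q) (hQ' : 0 < Q')
    (w : Fin k → ℝ) (w' : Fin l → ℝ) (μ : Fin k → ℂ) (μ' : Fin l → ℂ) (s : ℂ) :
    gammaFactor (ε * ε') (Q * Q') (Fin.append w w') (Fin.append μ μ') s =
      gammaFactor ε Q w μ s * gammaFactor ε' Q' w' μ' s := by
  simp only [gammaFactor, Fin.prod_univ_add, Fin.append_left, Fin.append_right]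
  rw [Complex.ofReal_mul, Complex.mul_cpow_ofReal_nonneg hQ.le hQ'.le]
  ring

lemma isRegularPoint_append {k l : ℕ} {w : Fin k → ℝ} {w' : Fin l → ℝ} {μ : Fin k → ℂ}
    {μ' : Fin l → ℂ} {s : ℂ} (h : IsRegularPoint (Fin.append w w') (Fin.append μ μ') s) :
    IsRegularPoint w μ s ∧ IsRegularPoint w' μ' s :=
  ⟨fun i n ↦ by simpa using h (Fin.castAdd l i) n, fun i n ↦ by simpa using h (Fin.natAdd k i) n⟩

/-- Concatenating the two lists of gamma factors multiplies the functional equations. A regular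
point of the long list is regular for both short ones. -/
lemma HasHalfDegree.mul {F G : ℂ → ℂ} {δ δ' : ℝ} (hF : HasHalfDegree F δ)
    (hG : HasHalfDegree G δ') : HasHalfDegree (F * G) (δ + δ') := by
  obtain ⟨ε, Q, k, w, μ, h1, h2, h3, h4, h5, h6⟩ := hF
  obtain ⟨ε', Q', l, w', μ', h1', h2', h3', h4', h5', h6'⟩ := hG
  refine ⟨ε * ε', Q * Q', k + l, Fin.append w w', Fin.append μ μ', by simp [h1, h1'],
    mul_pos h2 h2', ?_, ?_, fun s hs0 hs1 hr hr' ↦ ?_, ?_⟩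
  · refine Fin.addCases (fun i ↦ ?_) fun i ↦ ?_
    · simpa using h3 i
    · simpa using h3' i
  · refine Fin.addCases (fun i ↦ ?_) fun i ↦ ?_
    · simpa using h4 i
    · simpa using h4' i
  · obtain ⟨ha, hb⟩ := isRegularPoint_append hr
    obtain ⟨ha', hb'⟩ := isRegularPoint_append hr'
    have e1 := h5 s hs0 hs1 ha ha'
    have e2 := h5' s hs0 hs1 hb hb'
    rw [gammaFactor_append _ _ h2 h2', gammaFactor_append _ _ h2 h2', Pi.mul_apply, Pi.mul_apply,
      mul_mul_mul_comm, e1, e2, ← map_mul]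
    congr 1
    ring
  · simp [Fin.sum_univ_add, h6, h6']

lemma HasFiniteOrder.mul {E E' : ℂ → ℂ} (h : HasFiniteOrder E) (h' : HasFiniteOrder E') :
    HasFiniteOrder (E * E') := by
  obtain ⟨ρ, h⟩ := h
  obtain ⟨ρ', h'⟩ := h'
  -- For `|s| ≥ 2` the extra power of `|s|` absorbs the factor `2` in `|s| ^ ρ + |s| ^ ρ' ≤ 2 |s| ^
  -- max ρ ρ'`.
  refine ⟨max ρ ρ' + 1, (h.mul h').trans (IsBigO.of_bound 1 ?_)⟩
  filter_upwards [tendsto_norm_cobounded_atTop.eventually_ge_atTop (2 : ℝ)] with s hs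
  rw [← Real.exp_add, Real.norm_eq_abs, Real.norm_eq_abs, Real.abs_exp, Real.abs_exp, one_mul,
    Real.exp_le_exp]
  have h1 : ‖s‖ ^ ρ ≤ ‖s‖ ^ max ρ ρ' :=
    Real.rpow_le_rpow_of_exponent_le (by linarith) (le_max_left _ _)
  have h2 : ‖s‖ ^ ρ' ≤ ‖s‖ ^ max ρ ρ' :=
    Real.rpow_le_rpow_of_exponent_le (by linarith) (le_max_right _ _)
  have h0 : 0 < ‖s‖ := by linarith
  rw [Real.rpow_add h0, Real.rpow_one]
  have h3 : 0 < ‖s‖ ^ max ρ ρ' := by positivity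
  nlinarith

lemma IsAnalyticOfFiniteOrder.mul {F G : ℂ → ℂ} (hF : IsAnalyticOfFiniteOrder F)
    (hG : IsAnalyticOfFiniteOrder G) : IsAnalyticOfFiniteOrder (F * G) := by
  obtain ⟨m, E, h1, h2, h3⟩ := hF
  obtain ⟨m', E', h1', h2', h3'⟩ := hG
  refine ⟨m + m', E * E', h1.mul h1', h2.mul h2', fun s hs ↦ ?_⟩
  rw [Pi.mul_apply, Pi.mul_apply, h3 s hs, h3' s hs]
  ring

lemma isBigO_rpow_of_le {b : ℕ → ℂ} {θ θ' : ℝ} (h : b =O[atTop] fun n : ℕ ↦ (n : ℝ) ^ θ)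
    (hθ : θ ≤ θ') : b =O[atTop] fun n : ℕ ↦ (n : ℝ) ^ θ' := by
  refine h.trans (IsBigO.of_bound 1 ?_)
  filter_upwards [eventually_ge_atTop 1] with n hn
  rw [Real.norm_eq_abs, Real.norm_eq_abs, abs_of_nonneg (by positivity),
    abs_of_nonneg (by positivity), one_mul]
  exact Real.rpow_le_rpow_of_exponent_le (by exact_mod_cast hn) hθ

lemma HasEulerProduct.mul {F G : ℂ → ℂ} (hF : HasEulerProduct F) (hG : HasEulerProduct G) :
    HasEulerProduct (F * G) := by
  obtain ⟨b, θ, h1, h2, h3, h4⟩ := hF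
  obtain ⟨b', θ', h1', h2', h3', h4'⟩ := hG
  refine ⟨b + b', max θ θ', max_lt h1 h1', fun n hn ↦ by simp [h2 n hn, h2' n hn],
    (isBigO_rpow_of_le h3 (le_max_left _ _)).add (isBigO_rpow_of_le h3' (le_max_right _ _)),
    fun s hs ↦ ⟨(h4 s hs).1.add (h4' s hs).1, ?_⟩⟩
  rw [LSeries_add (h4 s hs).1 (h4' s hs).1, Complex.exp_add, (h4 s hs).2, (h4' s hs).2,
    Pi.mul_apply]

lemma HasDirichletSeries.same {F G : ℂ → ℂ} {a : ℕ → ℂ} (hF : HasDirichletSeries F a)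
    (h : Same F G) : HasDirichletSeries G a :=
  fun s hs ↦ h s (ne_one_of_one_lt_re hs) ▸ hF s hs

lemma HasDirichletSeries.mul {F G : ℂ → ℂ} {a b : ℕ → ℂ} (hF : HasDirichletSeries F a)
    (hG : HasDirichletSeries G b) : HasDirichletSeries (F * G) (LSeries.convolution a b) :=
  fun s hs ↦ (hF s hs).convolution (hG s hs)

lemma convolution_one (a b : ℕ → ℂ) : LSeries.convolution a b 1 = a 1 * b 1 := by
  simp [LSeries.convolution_def]

/-- With leading coefficients `1`, products of functions become sums of coefficients at primes,
which makes correlations additive over factorizations. -/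
lemma convolution_prime {p : ℕ} (hp : p.Prime) (a b : ℕ → ℂ) :
    LSeries.convolution a b p = a 1 * b p + a p * b 1 := by
  simp only [LSeries.convolution_def]
  rw [Nat.sum_divisorsAntidiagonal (f := fun x y ↦ a x * b y), Nat.Prime.divisors hp,
    Finset.sum_pair hp.ne_one.symm, Nat.div_one, Nat.div_self hp.pos]

lemma SelbergClass.same {F G : ℂ → ℂ} (hF : SelbergClass F) (h : Same F G) : SelbergClass G := by
  obtain ⟨⟨m, E, h1, h2, h3⟩, hfe, ⟨b, θ, g1, g2, g3, g4⟩, a, ha, ha'⟩ := hF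
  refine ⟨⟨m, E, h1, h2, fun s hs ↦ by rw [← h s hs, h3 s hs]⟩, ?_,
    ⟨b, θ, g1, g2, g3, fun s hs ↦ ?_⟩, a, ha.same h, ha'⟩
  · obtain ⟨δ, hδ⟩ := hasFunctionalEquation_iff.1 hfe
    exact hasFunctionalEquation_iff.2 ⟨δ, hδ.same h⟩
  · rw [← h s (ne_one_of_one_lt_re hs)]
    exact g4 s hs

lemma SelbergClass.mul {F G : ℂ → ℂ} (hF : SelbergClass F) (hG : SelbergClass G) :
    SelbergClass (F * G) := by
  obtain ⟨h1, h2, h3, a, h4, h5, h6⟩ := hF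
  obtain ⟨h1', h2', h3', a', h4', h5', h6'⟩ := hG
  obtain ⟨δ, hδ⟩ := hasFunctionalEquation_iff.1 h2
  obtain ⟨δ', hδ'⟩ := hasFunctionalEquation_iff.1 h2'
  exact ⟨h1.mul h1', hasFunctionalEquation_iff.2 ⟨_, hδ.mul hδ'⟩, h3.mul h3', _, h4.mul h4',
    by rw [convolution_one, h5, h5', one_mul], h6.convolution h6'⟩

lemma selbergClass_one : SelbergClass 1 := by
  refine ⟨⟨0, 1, differentiable_const 1, ⟨0, ?_⟩, fun s _ ↦ by simp⟩,
    hasFunctionalEquation_iff.2 ⟨0, 1, 1, 0, 0, 0, by simp, one_pos, fun i ↦ i.elim0,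
      fun i ↦ i.elim0, fun s _ _ _ _ ↦ by simp [gammaFactor], by simp⟩,
    ⟨0, 0, by norm_num, fun _ _ ↦ rfl, isBigO_zero _ _, fun s _ ↦ ⟨LSeriesSummable_zero, by simp⟩⟩,
    LSeries.delta, fun s _ ↦ ?_, by simp [LSeries.delta], fun ε hε ↦ ?_⟩
  · simp only [Real.rpow_zero]
    exact isBigO_const_const _ (Real.exp_ne_zero _) _
  · have : LSeries.term LSeries.delta s = fun n ↦ if n = 1 then (1 : ℂ) else 0 :=
      funext fun n ↦ LSeries.term_delta s n
    rw [LSeriesHasSum, this]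
    exact hasSum_ite_eq 1 1
  · refine IsBigO.of_bound 1 ?_
    filter_upwards [eventually_ne_atTop 0] with n hn
    have h1 : (1 : ℝ) ≤ (n : ℝ) ^ ε :=
      Real.one_le_rpow (by exact_mod_cast Nat.one_le_iff_ne_zero.2 hn) hε.le
    rw [Real.norm_eq_abs, abs_of_nonneg (by positivity), one_mul]
    unfold LSeries.delta
    split_ifs <;> simp [h1]
    positivity

lemma SelbergClass.pow {F : ℂ → ℂ} (hF : SelbergClass F) (n : ℕ) : SelbergClass (F ^ n) := by
  induction n with
  | zero => simpa using selbergClass_one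
  | succ n ih => rw [pow_succ]; exact ih.mul hF

end Same

/-! ### `ζ` belongs to the Selberg class. -/

section Zeta

open Complex Topology MeasureTheory

/-- `(s - 1)` times the `n`-th term of the series `∑ (n ^ (-s) - ∫ x in n..n+1, x ^ (-s))`. -/
noncomputable def zetaTerm (s : ℂ) (n : ℕ) : ℂ :=
  (s - 1) * ((n + 1 : ℕ) : ℂ) ^ (-s)
    - (((n + 1 : ℕ) : ℂ) ^ (1 - s) - ((n + 2 : ℕ) : ℂ) ^ (1 - s))

lemma hasDerivAt_shift_cpow {n : ℝ} (hn : 0 < n) {x : ℝ} (hx : 0 ≤ x) (r : ℂ) :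
    HasDerivAt (fun t : ℝ ↦ ((n + t : ℝ) : ℂ) ^ r) (r * ((n + x : ℝ) : ℂ) ^ (r - 1)) x := by
  have h1 : HasDerivAt (fun z : ℂ ↦ ((n : ℂ) + z) ^ r) (r * ((n : ℂ) + x) ^ (r - 1) * 1) x := by
    refine ((hasDerivAt_id (x : ℂ)).const_add (n : ℂ)).cpow_const ?_
    left
    simp
    positivity
  have := h1.comp_ofReal
  simpa using this

lemma norm_cpow_neg_sub_le (s : ℂ) (hs : 0 ≤ s.re) {n : ℝ} (hn : 0 < n) {x : ℝ}
    (hx : x ∈ Set.Icc (0 : ℝ) 1) :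
    ‖((n + x : ℝ) : ℂ) ^ (-s) - (n : ℂ) ^ (-s)‖ ≤ ‖s‖ * n ^ (-s.re - 1) := by
  have := (convex_Icc (0 : ℝ) 1).norm_image_sub_le_of_norm_hasDerivWithin_le
    (f := fun t : ℝ ↦ ((n + t : ℝ) : ℂ) ^ (-s)) (C := ‖s‖ * n ^ (-s.re - 1))
    (fun t ht ↦ (hasDerivAt_shift_cpow hn ht.1 (-s)).hasDerivWithinAt)
    (fun t ht ↦ by
      rw [norm_mul, norm_neg, Complex.norm_cpow_eq_rpow_re_of_pos (by linarith [ht.1])]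
      gcongr
      rw [sub_re, neg_re, one_re]
      exact Real.rpow_le_rpow_of_nonpos hn (by linarith [ht.1]) (by linarith))
    (x := 0) (y := x) (by simp) hx
  simp only [add_zero, sub_zero, Real.norm_eq_abs, abs_of_nonneg hx.1] at this
  refine this.trans ?_
  have h0 : 0 ≤ ‖s‖ * n ^ (-s.re - 1) := by positivity
  nlinarith [hx.2]

/-- The term is the increment over `[0, 1]` of a function of `t` whose derivative is `(s - 1)` times
a difference of two values of `x ↦ x ^ (-s)`. This gains a power of `n` and yields convergence for
`Re s > 0`. -/
lemma norm_zetaTerm_le (s : ℂ) (hs : 0 ≤ s.re) (n : ℕ) :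
    ‖zetaTerm s n‖ ≤ ‖s - 1‖ * ‖s‖ * ((n + 1 : ℕ) : ℝ) ^ (-s.re - 1) := by
  have hn : (0 : ℝ) < ((n + 1 : ℕ) : ℝ) := by positivity
  have := (convex_Icc (0 : ℝ) 1).norm_image_sub_le_of_norm_hasDerivWithin_le
    (f := fun t : ℝ ↦ (s - 1) * ((n + 1 : ℕ) : ℂ) ^ (-s) * t
      + ((((n + 1 : ℕ) : ℝ) + t : ℝ) : ℂ) ^ (1 - s))
    (C := ‖s - 1‖ * (‖s‖ * ((n + 1 : ℕ) : ℝ) ^ (-s.re - 1)))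
    (f' := fun t ↦ (s - 1) * (((n + 1 : ℕ) : ℝ) : ℂ) ^ (-s) * 1
      + (1 - s) * ((((n + 1 : ℕ) : ℝ) + t : ℝ) : ℂ) ^ (1 - s - 1))
    (fun t ht ↦ ((((hasDerivAt_id (t : ℂ)).comp_ofReal.const_mul _).add
      (hasDerivAt_shift_cpow hn ht.1 (1 - s)))).hasDerivWithinAt)
    (fun t ht ↦ by
      have e : (s - 1) * (((n + 1 : ℕ) : ℝ) : ℂ) ^ (-s) * 1
          + (1 - s) * ((((n + 1 : ℕ) : ℝ) + t : ℝ) : ℂ) ^ (1 - s - 1) =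
          -((s - 1) * (((((n + 1 : ℕ) : ℝ) + t : ℝ) : ℂ) ^ (-s)
            - (((n + 1 : ℕ) : ℝ) : ℂ) ^ (-s))) := by
        rw [show 1 - s - 1 = -s by ring]; ring
      rw [e, norm_neg, norm_mul]
      gcongr
      exact norm_cpow_neg_sub_le s hs hn ht)
    (x := 0) (y := 1) (by simp) (by simp)
  have e2 : zetaTerm s n = ((s - 1) * ((n + 1 : ℕ) : ℂ) ^ (-s) * (1 : ℝ)
      + ((((n + 1 : ℕ) : ℝ) + (1 : ℝ) : ℝ) : ℂ) ^ (1 - s)) -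
      ((s - 1) * ((n + 1 : ℕ) : ℂ) ^ (-s) * (0 : ℝ)
      + ((((n + 1 : ℕ) : ℝ) + (0 : ℝ) : ℝ) : ℂ) ^ (1 - s)) := by
    rw [zetaTerm]
    push_cast
    rw [show (n : ℂ) + 2 = n + 1 + 1 by ring, add_zero]
    ring
  rw [e2]
  simpa [mul_assoc] using this

lemma summable_shift_rpow {x : ℝ} (hx : x < -1) :
    Summable fun n : ℕ ↦ ((n + 1 : ℕ) : ℝ) ^ x :=
  (summable_nat_add_iff (f := fun n : ℕ ↦ (n : ℝ) ^ x) 1).2 (Real.summable_nat_rpow.2 hx)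

lemma differentiable_zetaTerm (n : ℕ) : Differentiable ℂ fun s ↦ zetaTerm s n := by
  have h1 : ((n + 1 : ℕ) : ℂ) ≠ 0 := Nat.cast_ne_zero.2 (by omega)
  have h2 : ((n + 2 : ℕ) : ℂ) ≠ 0 := Nat.cast_ne_zero.2 (by omega)
  intro s
  unfold zetaTerm
  refine DifferentiableAt.sub (DifferentiableAt.mul (by fun_prop) ?_) (DifferentiableAt.sub ?_ ?_)
  all_goals
    refine DifferentiableAt.const_cpow (by fun_prop) (Or.inl ?_)
    assumption

lemma differentiableOn_tsum_zetaTerm :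
    DifferentiableOn ℂ (fun s ↦ ∑' n, zetaTerm s n) {s | 0 < s.re} := by
  intro s₀ hs₀
  have hs₀ : 0 < s₀.re := hs₀
  set U : Set ℂ := {s | s₀.re / 2 < s.re} ∩ Metric.ball 0 (‖s₀‖ + 1) with hU
  have hUo : IsOpen U := (isOpen_lt continuous_const continuous_re).inter Metric.isOpen_ball
  have hmem : s₀ ∈ U := ⟨by simp only [Set.mem_ofPred_eq]; linarith, by simp⟩
  have hd : DifferentiableOn ℂ (fun s ↦ ∑' n, zetaTerm s n) U := by
    refine differentiableOn_tsum_of_summable_norm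
      (u := fun n : ℕ ↦ ((‖s₀‖ + 2) * (‖s₀‖ + 1)) * ((n + 1 : ℕ) : ℝ) ^ (-(s₀.re / 2) - 1))
      ((summable_shift_rpow (by linarith)).mul_left _)
      (fun n ↦ (differentiable_zetaTerm n).differentiableOn) hUo fun n s hs ↦ ?_
    have h1 : s₀.re / 2 < s.re := hs.1
    have h2 : ‖s‖ < ‖s₀‖ + 1 := by simpa using hs.2
    refine (norm_zetaTerm_le s (by linarith) n).trans ?_
    have h3 : ‖s - 1‖ ≤ ‖s₀‖ + 2 := by
      refine (norm_sub_le _ _).trans ?_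
      rw [norm_one]; linarith
    gcongr
    exact_mod_cast Nat.le_add_left 1 n
  exact (hd.differentiableAt (hUo.mem_nhds hmem)).differentiableWithinAt

/-- The second part of `zetaTerm` telescopes to `1 - (N + 1) ^ (1 - s)`, which tends to `1`. -/
lemma hasSum_zetaTerm {s : ℂ} (hs : 1 < s.re) :
    HasSum (zetaTerm s) ((s - 1) * riemannZeta s - 1) := by
  have h1 : HasSum (fun n : ℕ ↦ (s - 1) * ((n + 1 : ℕ) : ℂ) ^ (-s)) ((s - 1) * riemannZeta s) := by
    refine HasSum.mul_left _ ?_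
    rw [zeta_eq_tsum_one_div_nat_add_one_cpow hs]
    have : (fun n : ℕ ↦ ((n + 1 : ℕ) : ℂ) ^ (-s)) = fun n : ℕ ↦ 1 / ((n : ℂ) + 1) ^ s := by
      funext n
      rw [Complex.cpow_neg, one_div]; push_cast; rfl
    rw [this]
    refine Summable.hasSum ?_
    have := (summable_nat_add_iff (f := fun n : ℕ ↦ 1 / (n : ℂ) ^ s) 1).2
      (Complex.summable_one_div_nat_cpow.2 hs)
    simpa using this
  have h2 : Tendsto (fun n : ℕ ↦ ((n + 1 : ℕ) : ℂ) ^ (1 - s)) atTop (𝓝 0) := by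
    rw [tendsto_zero_iff_norm_tendsto_zero]
    have : Tendsto (fun n : ℕ ↦ ((n + 1 : ℕ) : ℝ) ^ (-(s.re - 1))) atTop (𝓝 0) :=
      (tendsto_rpow_neg_atTop (by linarith)).comp
        (tendsto_natCast_atTop_atTop.comp (tendsto_add_atTop_nat 1))
    refine this.congr fun n ↦ ?_
    rw [Complex.norm_natCast_cpow_of_pos (by omega), sub_re, one_re, neg_sub]
  have h3 : HasSum (zetaTerm s) (∑' n, zetaTerm s n) := by
    refine (Summable.of_norm_bounded ((summable_shift_rpow (x := -s.re - 1) (by linarith)).mul_left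
      (‖s - 1‖ * ‖s‖)) fun n ↦ norm_zetaTerm_le s (by linarith) n).hasSum
  convert h3 using 1
  refine tendsto_nhds_unique ?_ h3.tendsto_sum_nat
  have h4 (N : ℕ) : ∑ n ∈ Finset.range N, zetaTerm s n =
      ∑ n ∈ Finset.range N, (s - 1) * ((n + 1 : ℕ) : ℂ) ^ (-s)
        - (1 - ((N + 1 : ℕ) : ℂ) ^ (1 - s)) := by
    simp only [zetaTerm]
    rw [Finset.sum_sub_distrib,
      Finset.sum_range_sub' (fun n : ℕ ↦ ((n + 1 : ℕ) : ℂ) ^ (1 - s)) N]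
    simp
  simp only [h4]
  simpa using h1.tendsto_sum_nat.sub (h2.const_sub 1)

lemma riemannZeta₁_eq {s : ℂ} (hs : s ≠ 1) : riemannZeta₁ s = (s - 1) * riemannZeta s := by
  rw [riemannZeta_eq_inv_sub_mul hs, mul_inv_cancel_left₀ (sub_ne_zero.2 hs)]

lemma riemannZeta₁_eq_tsum {s : ℂ} (hs : 0 < s.re) :
    riemannZeta₁ s = 1 + ∑' n, zetaTerm s n := by
  have hopen : IsOpen {s : ℂ | 0 < s.re} := isOpen_lt continuous_const continuous_re
  have h1 : AnalyticOnNhd ℂ riemannZeta₁ {s : ℂ | 0 < s.re} :=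
    differentiable_riemannZeta₁.differentiableOn.analyticOnNhd hopen
  have h2 : AnalyticOnNhd ℂ (fun s ↦ 1 + ∑' n, zetaTerm s n) {s : ℂ | 0 < s.re} :=
    (differentiableOn_tsum_zetaTerm.const_add 1).analyticOnNhd hopen
  refine h1.eqOn_of_preconnected_of_eventuallyEq h2
    (convex_halfSpace_re_gt 0).isPreconnected (z₀ := 2) (by simp) ?_ hs
  have : ∀ᶠ z : ℂ in 𝓝 2, 1 < z.re :=
    (isOpen_lt continuous_const continuous_re).eventually_mem (by norm_num)
  filter_upwards [this] with z hz
  rw [(hasSum_zetaTerm hz).tsum_eq, riemannZeta₁_eq (ne_one_of_one_lt_re hz)]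
  ring

/-- Polynomial growth on the right of the critical line; the functional equation transports it to
the left. -/
lemma exists_norm_riemannZeta₁_le :
    ∃ K : ℝ, 0 < K ∧ ∀ s : ℂ, 1 / 2 ≤ s.re → ‖riemannZeta₁ s‖ ≤ 1 + ‖s - 1‖ * ‖s‖ * K := by
  have hsum := summable_shift_rpow (x := -(1 / 2) - 1) (by norm_num)
  refine ⟨∑' n : ℕ, ((n + 1 : ℕ) : ℝ) ^ (-(1 / 2) - 1 : ℝ),
    hsum.tsum_pos (fun n ↦ by positivity) 0 (by positivity), fun s hs ↦ ?_⟩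
  rw [riemannZeta₁_eq_tsum (by linarith), ← tsum_mul_left]
  refine (norm_add_le _ _).trans ?_
  rw [norm_one]
  gcongr
  refine tsum_of_norm_bounded (hsum.mul_left _).hasSum fun n ↦ ?_
  refine (norm_zetaTerm_le s (by linarith) n).trans ?_
  gcongr
  exact_mod_cast Nat.le_add_left 1 n

lemma exists_norm_Gamma_le :
    ∃ C : ℝ, 0 < C ∧ ∀ s : ℂ, 1 / 2 ≤ s.re → ‖Gamma s‖ ≤ C * Real.exp (2 * ‖s‖ ^ 2) := by
  have hint : IntegrableOn (fun x : ℝ ↦ x ^ (-(1 / 2) : ℝ) * Real.exp (-(1 / 2) * x ^ (1 : ℝ)))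
      (Set.Ioi 0) :=
    integrableOn_rpow_mul_exp_neg_mul_rpow (by norm_num) (by norm_num) (by norm_num)
  refine ⟨(∫ x in Set.Ioi (0 : ℝ), x ^ (-(1 / 2) : ℝ) * Real.exp (-(1 / 2) * x ^ (1 : ℝ))) + 1,
    ?_, fun s hs ↦ ?_⟩
  · have : 0 ≤ ∫ x in Set.Ioi (0 : ℝ), x ^ (-(1 / 2) : ℝ) * Real.exp (-(1 / 2) * x ^ (1 : ℝ)) :=
      setIntegral_nonneg measurableSet_Ioi fun x hx ↦ by
        have : (0 : ℝ) < x := hx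
        positivity
    linarith
  · rw [Complex.Gamma_eq_integral (by linarith), GammaIntegral]
    calc _ ≤ ∫ x in Set.Ioi (0 : ℝ), (x ^ (-(1 / 2) : ℝ) * Real.exp (-(1 / 2) * x ^ (1 : ℝ)))
          * Real.exp (2 * ‖s‖ ^ 2) := by
          refine norm_integral_le_of_norm_le (hint.mul_const _) ?_
          filter_upwards [ae_restrict_mem measurableSet_Ioi] with x hx
          have hx : (0 : ℝ) < x := hx
          rw [norm_mul, Complex.norm_cpow_eq_rpow_re_of_pos hx, Complex.norm_real, Real.norm_eq_abs,
            Real.abs_exp, Real.rpow_one, sub_re, one_re, Real.rpow_def_of_pos hx,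
            Real.rpow_def_of_pos hx, ← Real.exp_add, ← Real.exp_add, ← Real.exp_add,
            Real.exp_le_exp]
          set a := s.re - 1 / 2 with ha
          have ha0 : 0 ≤ a := by linarith
          have ha1 : a ≤ ‖s‖ := by linarith [Complex.re_le_norm s]
          -- Half of the decay `e ^ (-x)` is spent on `x ^ a`, at the cost `exp (2 a ^ 2)`. The
          -- bound is `log u ≤ u - 1` at `u = x / (2 a)` and `u = 2 a`.
          have key : a * Real.log x ≤ x / 2 + 2 * a ^ 2 := by
            rcases ha0.eq_or_lt with h | h
            · rw [← h]; simp; positivity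
            · have h1 := Real.log_le_sub_one_of_pos (x := x / (2 * a)) (by positivity)
              have h2 := Real.log_le_sub_one_of_pos (x := 2 * a) (by positivity)
              rw [Real.log_div hx.ne' (by positivity)] at h1
              have h3 : Real.log x ≤ x / (2 * a) + 2 * a := by linarith
              calc a * Real.log x ≤ a * (x / (2 * a) + 2 * a) := by gcongr
                _ = _ := by field_simp
          have h4 : a ^ 2 ≤ ‖s‖ ^ 2 := by gcongr
          have h5 : s.re = a + 1 / 2 := by rw [ha]; ring
          rw [h5]
          nlinarith
      _ = _ := integral_mul_const _ _
      _ ≤ _ := by gcongr; linarith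

lemma norm_cos_le (z : ℂ) : ‖cos z‖ ≤ Real.exp ‖z‖ := by
  have h1 : ‖exp (z * I)‖ ≤ Real.exp ‖z‖ := by simpa using norm_exp_le_exp_norm (z * I)
  have h2 : ‖exp (-z * I)‖ ≤ Real.exp ‖z‖ := by simpa using norm_exp_le_exp_norm (-z * I)
  rw [Complex.cos, norm_div, Complex.norm_ofNat]
  have := norm_add_le (exp (z * I)) (exp (-z * I))
  linarith

lemma hasFiniteOrder_riemannZeta₁ : HasFiniteOrder riemannZeta₁ := by
  obtain ⟨K, hK, hz⟩ := exists_norm_riemannZeta₁_le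
  obtain ⟨C, hC, hG⟩ := exists_norm_Gamma_le
  -- The left half plane produces `exp (8 r ^ 2 + 4 r + 2 r)`, which is below `exp (r ^ 3)` once `r
  -- ≥ 20`.
  refine ⟨3, IsBigO.of_bound ((1 + 2 * K) * (1 + 4 * C)) ?_⟩
  filter_upwards [tendsto_norm_cobounded_atTop.eventually_ge_atTop (20 : ℝ)] with s hs
  rw [Real.norm_eq_abs, Real.abs_exp]
  set r := ‖s‖ with hr
  have hr3 : r ^ (3 : ℝ) = r ^ 3 := by exact_mod_cast Real.rpow_natCast r 3
  have hw : ‖1 - s‖ ≤ 2 * r := by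
    refine (norm_sub_le _ _).trans ?_
    rw [norm_one]; linarith
  have hw' : ‖s - 1‖ ≤ 2 * r := by rwa [norm_sub_rev]
  have hrexp : r ≤ Real.exp r := by linarith [Real.add_one_le_exp r]
  have hpoly : 1 + 2 * r * r * K ≤ (1 + 2 * K) * Real.exp (2 * r) := by
    have h1 : r * r ≤ Real.exp (2 * r) := by
      rw [two_mul, Real.exp_add]; gcongr
    have h2 : 1 ≤ Real.exp (2 * r) := Real.one_le_exp (by linarith)
    nlinarith
  rcases le_total (1 / 2) s.re with h | h
  · calc _ ≤ 1 + ‖s - 1‖ * r * K := hz s h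
      _ ≤ 1 + 2 * r * r * K := by gcongr
      _ ≤ (1 + 2 * K) * Real.exp (2 * r) := hpoly
      _ ≤ ((1 + 2 * K) * (1 + 4 * C)) * Real.exp (r ^ (3 : ℝ)) := by
          gcongr
          · nlinarith
          · rw [hr3]; nlinarith [mul_self_nonneg r]
  · have hwre : 1 / 2 ≤ (1 - s).re := by simp; linarith
    have hs0 : s ≠ 0 := by rintro rfl; simp at hr; linarith
    have hs1 : s ≠ 1 := by rintro rfl; simp at hr; linarith
    have hw1 : 1 - s ≠ 1 := by simpa using hs0
    have hfe := riemannZeta_one_sub (s := 1 - s) (fun n hn ↦ by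
      rw [hn] at hwre
      simp at hwre
      have : (0 : ℝ) ≤ n := by positivity
      linarith) hw1
    rw [sub_sub_cancel] at hfe
    have hzw : riemannZeta (1 - s) = riemannZeta₁ (1 - s) / (-s) := by
      rw [riemannZeta₁_eq hw1]
      have : (1 : ℂ) - s - 1 = -s := by ring
      rw [this, mul_div_cancel_left₀ _ (neg_ne_zero.2 hs0)]
    have h2pi : ‖(2 * (Real.pi : ℂ)) ^ (-(1 - s))‖ ≤ 1 := by
      have e : (2 * (Real.pi : ℂ)) = ((2 * Real.pi : ℝ) : ℂ) := by push_cast; rfl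
      rw [e, Complex.norm_cpow_eq_rpow_re_of_pos (by positivity)]
      refine Real.rpow_le_one_of_one_le_of_nonpos (by linarith [Real.pi_gt_three]) ?_
      rw [neg_re]; linarith
    have hcos : ‖cos (Real.pi * (1 - s) / 2)‖ ≤ Real.exp (4 * r) := by
      refine (norm_cos_le _).trans (Real.exp_le_exp.2 ?_)
      rw [norm_div, norm_mul, Complex.norm_real, Complex.norm_ofNat, Real.norm_eq_abs,
        abs_of_pos Real.pi_pos]
      nlinarith [Real.pi_lt_four, Real.pi_pos, norm_nonneg (1 - s)]
    have hGam : ‖Gamma (1 - s)‖ ≤ C * Real.exp (8 * r ^ 2) := by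
      refine (hG _ hwre).trans (mul_le_mul_of_nonneg_left (Real.exp_le_exp.2 ?_) hC.le)
      nlinarith [norm_nonneg (1 - s)]
    have hzeta : ‖riemannZeta₁ (1 - s)‖ ≤ (1 + 2 * K) * Real.exp (2 * r) := by
      refine (hz _ hwre).trans (le_trans ?_ hpoly)
      have : 1 - s - 1 = -s := by ring
      rw [this, norm_neg, ← hr]
      have : r * ‖1 - s‖ * K ≤ r * (2 * r) * K := by gcongr
      linarith
    rw [riemannZeta₁_eq hs1, hfe, hzw, norm_mul, norm_mul, norm_mul, norm_mul, norm_mul, norm_div,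
      norm_neg, Complex.norm_ofNat, ← hr]
    calc ‖s - 1‖ * (2 * ‖(2 * (Real.pi : ℂ)) ^ (-(1 - s))‖ * ‖Gamma (1 - s)‖ *
            ‖cos (Real.pi * (1 - s) / 2)‖ * (‖riemannZeta₁ (1 - s)‖ / r))
        ≤ (2 * r) * (2 * 1 * (C * Real.exp (8 * r ^ 2)) * Real.exp (4 * r) *
            (((1 + 2 * K) * Real.exp (2 * r)) / r)) := by gcongr
      _ = (1 + 2 * K) * (4 * C) * (Real.exp (8 * r ^ 2) * Real.exp (4 * r) * Real.exp (2 * r)) := by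
          have : r ≠ 0 := by linarith
          field_simp
          ring
      _ ≤ ((1 + 2 * K) * (1 + 4 * C)) * Real.exp (r ^ (3 : ℝ)) := by
          rw [← Real.exp_add, ← Real.exp_add]
          gcongr
          · linarith
          · rw [hr3]; nlinarith [mul_self_nonneg r]

lemma Gammaℝ_conj (s : ℂ) : Gammaℝ (conj s) = conj (Gammaℝ s) := by
  have e : -conj s / 2 = conj (-s / 2) := by
    rw [map_div₀, map_neg, map_ofNat]
  rw [Gammaℝ, Gammaℝ, map_mul, ← Gamma_conj, e, Complex.cpow_conj _ _
    (by rw [Complex.arg_ofReal_of_nonneg Real.pi_pos.le]; exact Real.pi_pos.ne), conj_ofReal,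
    map_div₀, map_ofNat]

/-- The gamma factor is `π ^ (-s / 2) Γ(s / 2)`. The classical equation relates `s` to `1 - s`;
symmetry under conjugation turns it into the required form. -/
lemma hasHalfDegree_riemannZeta : HasHalfDegree riemannZeta (1 / 2) := by
  have hγ (s : ℂ) : gammaFactor 1 (Real.pi ^ (-(1 / 2) : ℝ)) (fun _ : Fin 1 ↦ 1 / 2) 0 s
      = Gammaℝ s := by
    simp only [gammaFactor, Finset.univ_unique, Finset.prod_singleton, Pi.zero_apply, add_zero,
      one_mul, Gammaℝ]
    congr 1
    · have him : (Complex.log (Real.pi : ℂ) * ((-(1 / 2) : ℝ) : ℂ)).im = 0 := by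
        rw [← Complex.ofReal_log Real.pi_pos.le, ← Complex.ofReal_mul, ofReal_im]
      rw [Complex.ofReal_cpow Real.pi_pos.le, ← Complex.cpow_mul _ (by linarith [Real.pi_pos])
        (by linarith [Real.pi_pos])]
      congr 1; push_cast; ring
    · congr 1; push_cast; ring
  have hreg {s : ℂ} (hs : s ≠ 0)
      (h : IsRegularPoint (fun _ : Fin 1 ↦ (1 / 2 : ℝ)) 0 s) :
      Gammaℝ s * riemannZeta s = completedRiemannZeta s := by
    rw [riemannZeta_def_of_ne_zero hs, mul_div_cancel₀]
    rw [Ne, Gammaℝ_eq_zero_iff]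
    rintro ⟨n, rfl⟩
    exact h 0 n (by simp)
  refine ⟨1, Real.pi ^ (-(1 / 2) : ℝ), 1, fun _ ↦ 1 / 2, 0, by simp, by positivity,
    fun _ ↦ by norm_num, fun _ ↦ by simp, fun s hs0 hs1 hr hr' ↦ ?_, by simp⟩
  rw [hγ, hγ, hreg hs0 hr, hreg (one_sub_conj_ne_zero hs1) hr', ← completedRiemannZeta_one_sub]
  have e : 1 - s = conj (1 - conj s) := by simp
  have h0 : 1 - conj s ≠ 0 := one_sub_conj_ne_zero hs1
  have hr'' : IsRegularPoint (fun _ : Fin 1 ↦ (1 / 2 : ℝ)) 0 (conj (1 - conj s)) := by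
    intro i n h
    refine hr' i n ?_
    have := congrArg conj h
    simp only [map_add, map_mul, conj_ofReal, map_neg, map_natCast, conj_conj, Pi.zero_apply,
      map_zero] at this
    exact this
  rw [e, ← hreg ((map_ne_zero _).2 h0) hr'', ← hreg h0 hr', riemannZeta_conj, map_mul, Gammaℝ_conj]

open ArithmeticFunction in
lemma selbergClass_riemannZeta : SelbergClass riemannZeta := by
  refine ⟨⟨1, riemannZeta₁, differentiable_riemannZeta₁, hasFiniteOrder_riemannZeta₁,
      fun s hs ↦ by rw [pow_one, riemannZeta₁_eq hs]⟩,
    hasFunctionalEquation_iff.2 ⟨_, hasHalfDegree_riemannZeta⟩, ?_, 1, fun s hs ↦ ?_, rfl, ?_⟩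
  · have hle (n : ℕ) : ‖(Λ n : ℂ) / (Real.log n : ℂ)‖ ≤ 1 := by
      rw [← Complex.ofReal_div, Complex.norm_real, Real.norm_eq_abs, abs_div,
        abs_of_nonneg vonMangoldt_nonneg, abs_of_nonneg (Real.log_natCast_nonneg n)]
      exact div_le_one_of_le₀ vonMangoldt_le_log (Real.log_natCast_nonneg n)
    -- `log ζ` has coefficients `Λ(n) / log n`, bounded by `1`; at `n = 0, 1` the quotient `0 / 0`
    -- is `0`, as needed.
    refine ⟨fun n ↦ (Λ n : ℂ) / (Real.log n : ℂ), 0, by norm_num, fun n hn ↦ ?_, ?_,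
      fun s hs ↦ ⟨LSeriesSummable_of_bounded_of_one_lt_re (m := 1) (fun n _ ↦ hle n) hs,
        riemannZeta_eq_exp_LSeries hs⟩⟩
    · simp [vonMangoldt_eq_zero_iff.2 hn]
    · simp only [Real.rpow_zero]
      exact IsBigO.of_bound 1 (Eventually.of_forall fun n ↦ by simpa using hle n)
  · exact LSeriesHasSum_one hs
  · intro ε hε
    refine IsBigO.of_bound 1 ?_
    filter_upwards [eventually_ne_atTop 0] with n hn
    have h1 : (1 : ℝ) ≤ (n : ℝ) ^ ε :=
      Real.one_le_rpow (by exact_mod_cast Nat.one_le_iff_ne_zero.2 hn) hε.le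
    rw [Real.norm_eq_abs, abs_of_nonneg (by positivity), one_mul]
    simpa

lemma hasDirichletSeries_riemannZeta : HasDirichletSeries riemannZeta 1 :=
  fun _ hs ↦ LSeriesHasSum_one hs

end Zeta

/-! ### Exact growth on vertical lines; invariance of the degree. -/

section Growth

open Complex Topology Bornology

lemma HasDirichletSeries.eq_LSeries {F : ℂ → ℂ} {a : ℕ → ℂ} (h : HasDirichletSeries F a)
    {s : ℂ} (hs : 1 < s.re) : F s = LSeries a s := (h s hs).LSeries_eq.symm

lemma norm_LSeries_le_of_re {a : ℕ → ℂ} {σ : ℝ} (h : LSeriesSummable a σ) {s : ℂ}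
    (hs : σ ≤ s.re) : ‖LSeries a s‖ ≤ ∑' n, ‖LSeries.term a σ n‖ :=
  tsum_of_norm_bounded h.norm.hasSum fun n ↦ LSeries.norm_term_le_of_re_le_re a (by simpa) n

lemma HasDirichletSeries.exists_norm_le {F : ℂ → ℂ} {a : ℕ → ℂ} (h : HasDirichletSeries F a)
    {σ : ℝ} (hσ : 1 < σ) : ∃ C : ℝ, 0 < C ∧ ∀ s : ℂ, σ ≤ s.re → ‖F s‖ ≤ C := by
  refine ⟨(∑' n, ‖LSeries.term a σ n‖) + 1, ?_, fun s hs ↦ ?_⟩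
  · have : 0 ≤ ∑' n, ‖LSeries.term a σ n‖ := tsum_nonneg fun _ ↦ norm_nonneg _
    linarith
  · rw [h.eq_LSeries (by linarith)]
    linarith [norm_LSeries_le_of_re (h σ (by simpa)).LSeriesSummable hs]

/-- Absolute convergence of `log F` bounds `|log F|`, hence `|F|` from below. This makes the growth
exponent on the reflected line exact. -/
lemma HasEulerProduct.exists_le_norm {F : ℂ → ℂ} (h : HasEulerProduct F)
    {σ : ℝ} (hσ : 1 < σ) : ∃ c : ℝ, 0 < c ∧ ∀ s : ℂ, σ ≤ s.re → c ≤ ‖F s‖ := by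
  obtain ⟨b, θ, -, -, -, h⟩ := h
  refine ⟨Real.exp (-∑' n, ‖LSeries.term b σ n‖), Real.exp_pos _, fun s hs ↦ ?_⟩
  rw [← (h s (by linarith)).2, norm_exp, Real.exp_le_exp]
  have h1 := norm_LSeries_le_of_re (h σ (by simpa)).1 hs
  have h2 := (abs_le.1 (abs_re_le_norm (LSeries b s))).1
  linarith

lemma HasEulerProduct.ne_zero {F : ℂ → ℂ} (h : HasEulerProduct F) {s : ℂ} (hs : 1 < s.re) :
    F s ≠ 0 := by
  obtain ⟨b, θ, -, -, -, h⟩ := h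
  rw [← (h s hs).2]
  exact exp_ne_zero _

lemma tendsto_abs_cobounded : Tendsto (fun t : ℝ ↦ |t|) (cobounded ℝ) atTop :=
  tendsto_norm_cobounded_atTop

/-- The lines `Re s = -A` and `Re s = 1 + A` are `1 + 2 A` apart, so the arguments of `Γ` differ by
`(1 + 2 A) w`; for large `|t|` the height `w t + Im μ` is comparable with `|t|`. -/
lemma exists_norm_Gamma_affine_bounds {w : ℝ} (hw : 0 < w) (μ : ℂ) {A : ℝ} (hA : 0 ≤ A) :
    ∃ K : ℝ, 0 < K ∧ ∀ᶠ t : ℝ in cobounded ℝ,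
      ‖Gamma (w * ((1 + A : ℝ) + t * I) + μ)‖ ≤
        K * |t| ^ ((1 + 2 * A) * w) * ‖Gamma (w * ((-A : ℝ) + t * I) + μ)‖ ∧
      |t| ^ ((1 + 2 * A) * w) * ‖Gamma (w * ((-A : ℝ) + t * I) + μ)‖ ≤
        K * ‖Gamma (w * ((1 + A : ℝ) + t * I) + μ)‖ := by
  set d := (1 + 2 * A) * w with hd
  have hd0 : 0 ≤ d := by positivity
  obtain ⟨K, hK, h⟩ := exists_norm_Gamma_add_bounds (w * (-A) + μ.re) hd0
  refine ⟨K * (w * 2) ^ d + K / (w / 2) ^ d, by positivity, ?_⟩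
  filter_upwards [tendsto_abs_cobounded.eventually_ge_atTop (2 * |μ.im| / w + 2 / w)] with t ht
  set y := w * t + μ.im with hy
  have hwt : 2 * |μ.im| + 2 ≤ w * |t| := by
    rw [← add_div, div_le_iff₀ hw] at ht
    linarith
  have habs : |w * t| = w * |t| := by rw [abs_mul, abs_of_pos hw]
  have hy1 : w / 2 * |t| ≤ |y| := by
    have := abs_sub_abs_le_abs_sub (w * t) (-μ.im)
    rw [abs_neg, habs, sub_neg_eq_add, ← hy] at this
    linarith [abs_nonneg μ.im]
  have hy2 : |y| ≤ w * 2 * |t| := by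
    have := abs_add_le (w * t) μ.im
    rw [habs, ← hy] at this
    linarith [abs_nonneg μ.im]
  have hy3 : 1 ≤ |y| := by
    have := abs_nonneg μ.im
    linarith
  have e1 : (w : ℂ) * ((1 + A : ℝ) + t * I) + μ = ((w * (-A) + μ.re + d : ℝ) : ℂ) + y * I := by
    apply Complex.ext <;> simp [hy, hd]; ring
  have e2 : (w : ℂ) * ((-A : ℝ) + t * I) + μ = ((w * (-A) + μ.re : ℝ) : ℂ) + y * I := by
    apply Complex.ext <;> simp [hy]
  rw [e1, e2]
  obtain ⟨h1, h2⟩ := h y hy3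
  set G := ‖Gamma (((w * (-A) + μ.re : ℝ) : ℂ) + y * I)‖
  set G' := ‖Gamma (((w * (-A) + μ.re + d : ℝ) : ℂ) + y * I)‖
  have hG : 0 ≤ G := norm_nonneg _
  have hG' : 0 ≤ G' := norm_nonneg _
  have ht0 : 0 ≤ |t| := abs_nonneg t
  constructor
  · calc G' ≤ K * |y| ^ d * G := h1
      _ ≤ K * (w * 2 * |t|) ^ d * G := by gcongr
      _ = K * (w * 2) ^ d * |t| ^ d * G := by rw [Real.mul_rpow (by positivity) ht0]; ring
      _ ≤ _ := by
        gcongr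
        have : 0 ≤ K / (w / 2) ^ d := by positivity
        linarith
  · have h3 : (w / 2) ^ d * (|t| ^ d * G) ≤ K * G' := by
      rw [← mul_assoc, ← Real.mul_rpow (by positivity) ht0]
      refine le_trans ?_ h2
      gcongr
    have hwd : 0 < (w / 2) ^ d := by positivity
    calc |t| ^ d * G ≤ K * G' / (w / 2) ^ d := by rw [le_div_iff₀ hwd]; linarith
      _ = K / (w / 2) ^ d * G' := by ring
      _ ≤ _ := by
        gcongr
        have : 0 ≤ K * (w * 2) ^ d := by positivity
        linarith

/-- All poles of the gamma factors lie on finitely many horizontal lines. -/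
lemma eventually_isRegularPoint {k : ℕ} {w : Fin k → ℝ} (hw : ∀ i, 0 < w i) (μ : Fin k → ℂ)
    (A : ℝ) : ∀ᶠ t : ℝ in cobounded ℝ, IsRegularPoint w μ ((A : ℂ) + t * I) := by
  refine eventually_all.2 fun i ↦ ?_
  filter_upwards [tendsto_abs_cobounded.eventually_gt_atTop (|(μ i).im| / w i)] with t ht n h
  have him := congrArg Complex.im h
  simp at him
  rw [div_lt_iff₀ (hw i)] at ht
  have : |w i * t| = |(μ i).im| := by
    rw [eq_neg_of_add_eq_zero_left him, abs_neg]
  rw [abs_mul, abs_of_pos (hw i)] at this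
  linarith

lemma HasHalfDegree.exists_vertical_bounds {F : ℂ → ℂ} {δ : ℝ} (hF : HasHalfDegree F δ) {A : ℝ}
    (hA : 0 ≤ A) :
    ∃ K : ℝ, 0 < K ∧ ∀ᶠ t : ℝ in cobounded ℝ,
      ‖F ((-A : ℝ) + t * I)‖ ≤ K * |t| ^ ((1 + 2 * A) * δ) * ‖F ((1 + A : ℝ) + t * I)‖ ∧
      |t| ^ ((1 + 2 * A) * δ) * ‖F ((1 + A : ℝ) + t * I)‖ ≤ K * ‖F ((-A : ℝ) + t * I)‖ := by
  obtain ⟨ε, Q, k, w, μ, hε, hQ, hw, -, hfe, rfl⟩ := hF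
  choose K hK hG using fun i ↦ exists_norm_Gamma_affine_bounds (hw i) (μ i) hA
  have hγ (x t : ℝ) : ‖gammaFactor ε Q w μ ((x : ℂ) + t * I)‖ =
      Q ^ x * ∏ i, ‖Gamma (w i * ((x : ℂ) + t * I) + μ i)‖ := by
    rw [gammaFactor, norm_mul, norm_mul, hε, one_mul, norm_prod,
      Complex.norm_cpow_eq_rpow_re_of_pos hQ]
    simp
  have hP : 0 < ∏ i, K i := Finset.prod_pos fun i _ ↦ hK i
  -- One summand serves the upper bound, the other the lower; the powers of `Q` are the ratio of `Q
  -- ^ s` on the two lines and its inverse.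
  refine ⟨Q ^ (1 + 2 * A) * ∏ i, K i + Q ^ (-(1 + 2 * A)) * ∏ i, K i, by positivity, ?_⟩
  filter_upwards [eventually_all.2 hG, eventually_isRegularPoint hw μ (-A),
    eventually_isRegularPoint hw μ (1 + A), tendsto_abs_cobounded.eventually_gt_atTop 0]
    with t ht hr hr' ht0
  have ht0' : t ≠ 0 := abs_pos.1 ht0
  have es : 1 - conj (((-A : ℝ) : ℂ) + t * I) = ((1 + A : ℝ) : ℂ) + t * I := by
    apply Complex.ext <;> simp
  have hne (z : ℂ) (hz : z.im = 0) : ((-A : ℝ) : ℂ) + t * I ≠ z := by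
    rintro rfl; simp at hz; exact ht0' hz
  have hfe := congrArg norm (hfe (((-A : ℝ) : ℂ) + t * I) (hne 0 (by simp)) (hne 1 (by simp)) hr
    (es ▸ hr'))
  rw [es, RCLike.norm_conj, norm_mul, norm_mul, hγ, hγ] at hfe
  set f := ‖F ((-A : ℝ) + t * I)‖
  set f' := ‖F ((1 + A : ℝ) + t * I)‖
  set G := ∏ i, ‖Gamma (w i * (((-A : ℝ) : ℂ) + t * I) + μ i)‖
  set G' := ∏ i, ‖Gamma (w i * (((1 + A : ℝ) : ℂ) + t * I) + μ i)‖
  have hf : 0 ≤ f := norm_nonneg _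
  have hf' : 0 ≤ f' := norm_nonneg _
  have hGpos : 0 < G := Finset.prod_pos fun i _ ↦ norm_pos_iff.2 (Gamma_ne_zero fun n ↦ hr i n)
  have hGpos' : 0 < G' := Finset.prod_pos fun i _ ↦ norm_pos_iff.2 (Gamma_ne_zero fun n ↦ hr' i n)
  set D := |t| ^ ((1 + 2 * A) * ∑ i, w i) with hD
  have hDpos : 0 < D := by positivity
  have hDprod : ∏ i, |t| ^ ((1 + 2 * A) * w i) = D := by
    rw [hD, Finset.mul_sum, Real.rpow_sum_of_pos ht0]
  have h1 : G' ≤ (∏ i, K i) * D * G := by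
    rw [← hDprod, ← Finset.prod_mul_distrib, ← Finset.prod_mul_distrib]
    exact Finset.prod_le_prod (fun _ _ ↦ norm_nonneg _) fun i _ ↦ (ht i).1
  have h2 : D * G ≤ (∏ i, K i) * G' := by
    rw [← hDprod, ← Finset.prod_mul_distrib, ← Finset.prod_mul_distrib]
    exact Finset.prod_le_prod (fun _ _ ↦ by positivity) fun i _ ↦ (ht i).2
  have hq1 : (Q ^ (1 + A) : ℝ) = Q ^ (1 + 2 * A) * Q ^ (-A) := by
    rw [← Real.rpow_add hQ]; ring_nf
  have hq2 : (Q ^ (-A) : ℝ) = Q ^ (-(1 + 2 * A)) * Q ^ (1 + A) := by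
    rw [← Real.rpow_add hQ]; ring_nf
  have hQA : 0 < (Q ^ (-A) : ℝ) := by positivity
  have hQA' : 0 < (Q ^ (1 + A) : ℝ) := by positivity
  constructor
  · have h3 : Q ^ (-A) * G * f ≤ Q ^ (-A) * G * (Q ^ (1 + 2 * A) * (∏ i, K i) * D * f') := by
      rw [hfe, hq1]
      calc _ ≤ Q ^ (1 + 2 * A) * Q ^ (-A) * ((∏ i, K i) * D * G) * f' := by gcongr
        _ = _ := by ring
    have h4 := le_of_mul_le_mul_left h3 (by positivity)
    refine h4.trans ?_
    gcongr
    have : 0 < Q ^ (-(1 + 2 * A)) * ∏ i, K i := by positivity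
    linarith
  · have h3 : Q ^ (1 + A) * G' * (D * f') ≤
        Q ^ (1 + A) * G' * (Q ^ (-(1 + 2 * A)) * (∏ i, K i) * f) := by
      calc _ = D * (Q ^ (1 + A) * G' * f') := by ring
        _ = Q ^ (-A) * (D * G) * f := by rw [← hfe]; ring
        _ ≤ Q ^ (-A) * ((∏ i, K i) * G') * f := by gcongr
        _ = _ := by rw [hq2]; ring
    have h4 := le_of_mul_le_mul_left h3 (by positivity)
    refine h4.trans ?_
    gcongr
    have : 0 < Q ^ (1 + 2 * A) * ∏ i, K i := by positivity
    linarith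

/-- On the line `Re s = -A` a member of the Selberg class has exact order `|t| ^ ((1 + 2 A) δ)`. -/
lemma SelbergClass.exists_vertical_bounds {F : ℂ → ℂ} (hF : SelbergClass F) {δ : ℝ}
    (hδ : HasHalfDegree F δ) {A : ℝ} (hA : 0 < A) :
    ∃ K : ℝ, 0 < K ∧ ∀ᶠ t : ℝ in cobounded ℝ,
      ‖F ((-A : ℝ) + t * I)‖ ≤ K * |t| ^ ((1 + 2 * A) * δ) ∧
      |t| ^ ((1 + 2 * A) * δ) ≤ K * ‖F ((-A : ℝ) + t * I)‖ := by
  obtain ⟨-, -, he, a, ha, -⟩ := hF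
  obtain ⟨K, hK, h⟩ := hδ.exists_vertical_bounds hA.le
  obtain ⟨C, hC, h1⟩ := ha.exists_norm_le (σ := 1 + A) (by linarith)
  obtain ⟨c, hc, h2⟩ := he.exists_le_norm (σ := 1 + A) (by linarith)
  refine ⟨K * C + K / c, by positivity, ?_⟩
  filter_upwards [h] with t ⟨ht, ht'⟩
  have h1 := h1 (((1 + A : ℝ) : ℂ) + t * I) (by simp)
  have h2 := h2 (((1 + A : ℝ) : ℂ) + t * I) (by simp)
  have hD : 0 ≤ |t| ^ ((1 + 2 * A) * δ) := by positivity
  constructor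
  · calc _ ≤ _ := ht
      _ ≤ K * |t| ^ ((1 + 2 * A) * δ) * C := by gcongr
      _ = K * C * |t| ^ ((1 + 2 * A) * δ) := by ring
      _ ≤ _ := by
        gcongr
        have : 0 < K / c := by positivity
        linarith
  · have h3 : |t| ^ ((1 + 2 * A) * δ) * c ≤ K * ‖F ((-A : ℝ) + t * I)‖ :=
      le_trans (by gcongr) ht'
    rw [← le_div_iff₀ hc] at h3
    refine h3.trans ?_
    rw [add_mul, div_mul_eq_mul_div]
    have : 0 ≤ K * C * ‖F ((-A : ℝ) + t * I)‖ := by positivity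
    linarith

lemma nonpos_of_eventually_rpow_le {x C : ℝ} (h : ∀ᶠ t : ℝ in cobounded ℝ, |t| ^ x ≤ C) :
    x ≤ 0 := by
  by_contra! hx
  have h1 : Tendsto (fun t : ℝ ↦ |t| ^ x) (cobounded ℝ) atTop :=
    (tendsto_rpow_atTop hx).comp tendsto_abs_cobounded
  obtain ⟨t, ht1, ht2⟩ := (h.and (h1.eventually_gt_atTop C)).exists
  linarith

/-- The half degree is an invariant of the function. -/
lemma HasHalfDegree.unique {F : ℂ → ℂ} (hF : SelbergClass F) {δ δ' : ℝ}
    (h : HasHalfDegree F δ) (h' : HasHalfDegree F δ') : δ = δ' := by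
  suffices ∀ δ δ', HasHalfDegree F δ → HasHalfDegree F δ' → δ ≤ δ' from
    le_antisymm (this _ _ h h') (this _ _ h' h)
  intro δ δ' h h'
  obtain ⟨K, hK, h⟩ := hF.exists_vertical_bounds h one_pos
  obtain ⟨K', hK', h'⟩ := hF.exists_vertical_bounds h' one_pos
  -- On `Re s = -1` the function is of exact order both `|t| ^ (3 δ)` and `|t| ^ (3 δ')`.
  have : (1 + 2 * 1) * δ - (1 + 2 * 1) * δ' ≤ 0 := by
    refine nonpos_of_eventually_rpow_le (C := K * K') ?_
    filter_upwards [h, h', tendsto_abs_cobounded.eventually_gt_atTop 0] with t ⟨_, h1⟩ ⟨h2, _⟩ ht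
    rw [Real.rpow_sub ht, div_le_iff₀ (by positivity)]
    calc _ ≤ _ := h1
      _ ≤ K * (K' * |t| ^ ((1 + 2 * 1) * δ')) := by gcongr
      _ = _ := by ring
  linarith

end Growth

/-! ### Phragmén–Lindelöf for functions of small degree. -/

section Strip

open Complex Topology Bornology MeasureTheory

/-- In a vertical strip `|z| ≤ 2 |Im z|` far out, and any power of `|Im z|` is dominated by `exp (c
|Im z|)`: this is the growth condition of Phragmén–Lindelöf. -/
lemma HasFiniteOrder.isBigO_exp_exp {E : ℂ → ℂ} (hE : HasFiniteOrder E) (a b : ℝ) {c : ℝ}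
    (hc : 0 < c) :
    E =O[comap (_root_.abs ∘ im) atTop ⊓ 𝓟 (re ⁻¹' Set.Ioo a b)]
      fun z ↦ Real.exp (1 * Real.exp (c * |z.im|)) := by
  obtain ⟨ρ, hE⟩ := hE
  set l := comap (_root_.abs ∘ im) atTop ⊓ 𝓟 (re ⁻¹' Set.Ioo a b) with hl
  have him : Tendsto (fun z : ℂ ↦ |z.im|) l atTop := tendsto_comap.mono_left inf_le_left
  have hcob : Tendsto (fun z : ℂ ↦ z) l (cobounded ℂ) := by
    rw [← tendsto_norm_atTop_iff_cobounded]
    exact tendsto_atTop_mono (fun z ↦ abs_im_le_norm z) him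
  have hlo := ((isLittleO_rpow_exp_pos_mul_atTop (max ρ 0) hc).comp_tendsto him).bound
    (show (0 : ℝ) < 1 / 2 ^ max ρ 0 by positivity)
  refine (hE.comp_tendsto hcob).trans (IsBigO.of_bound 1 ?_)
  filter_upwards [hlo, him.eventually_ge_atTop (|a| + |b| + 1),
    mem_inf_of_right (mem_principal_self _)] with z h1 h2 h3
  obtain ⟨h3, h4⟩ := h3
  have hre : |z.re| ≤ |a| + |b| := by
    rw [abs_le]
    constructor <;> linarith [neg_abs_le a, le_abs_self b, abs_nonneg a, abs_nonneg b]
  have hz2 : ‖z‖ ≤ 2 * |z.im| := by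
    have := norm_le_abs_re_add_abs_im z
    linarith
  have hz1 : 1 ≤ ‖z‖ := by
    have := abs_im_le_norm z
    linarith [abs_nonneg a, abs_nonneg b]
  simp only [Function.comp, Real.norm_eq_abs, Real.abs_exp, one_mul, Real.exp_le_exp] at h1 ⊢
  rw [abs_of_nonneg (by positivity)] at h1
  calc ‖z‖ ^ ρ ≤ ‖z‖ ^ max ρ 0 := Real.rpow_le_rpow_of_exponent_le hz1 (le_max_left _ _)
    _ ≤ (2 * |z.im|) ^ max ρ 0 := by gcongr
    _ = 2 ^ max ρ 0 * |z.im| ^ max ρ 0 := Real.mul_rpow (by norm_num) (abs_nonneg _)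
    _ ≤ 2 ^ max ρ 0 * (1 / 2 ^ max ρ 0 * Real.exp (c * |z.im|)) := by gcongr
    _ = _ := by field_simp

/-- A member of the Selberg class of small degree is `O(|t| ^ (1/2))` in the strip
`-10 ≤ Re s ≤ 2`. -/
lemma SelbergClass.exists_strip_bound {F : ℂ → ℂ} (hF : SelbergClass F) {δ : ℝ}
    (hδ : HasHalfDegree F δ) (hsmall : δ ≤ 1 / 42) :
    ∃ K : ℝ, 0 < K ∧ ∀ s : ℂ, -10 ≤ s.re → s.re ≤ 2 → 13 ≤ |s.im| →
      ‖F s‖ ^ 2 ≤ K * |s.im| := by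
  obtain ⟨K, hK, hleft⟩ := hF.exists_vertical_bounds hδ (A := 10) (by norm_num)
  obtain ⟨⟨m, E, hE, hord, hEF⟩, -, -, a, ha, -⟩ := hF
  obtain ⟨C, hC, hright⟩ := ha.exists_norm_le (σ := 2) (by norm_num)
  -- `E = (s - 1) ^ m F` has order `|t| ^ (m + 1 / 2)` on the left edge; squaring avoids a
  -- half-integral power, and the pole at `-11` lies outside the strip. So `G` is bounded on both
  -- edges.
  set G : ℂ → ℂ := fun s ↦ E s ^ 2 / (s + 11) ^ (2 * m + 1) with hG
  have hne {s : ℂ} (hs : -10 ≤ s.re) : 1 ≤ ‖s + 11‖ := by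
    refine le_trans ?_ (re_le_norm _)
    simp; linarith
  have hne' {s : ℂ} (hs : -10 ≤ s.re) : s + 11 ≠ 0 := norm_pos_iff.1 (by linarith [hne hs])
  have hGd : ∀ s : ℂ, -10 ≤ s.re → DifferentiableAt ℂ G s := fun s hs ↦ by
    have : (s + 11) ^ (2 * m + 1) ≠ 0 := pow_ne_zero _ (hne' hs)
    exact ((hE s).pow 2).div (by fun_prop) this
  have hGnorm {s : ℂ} (hs : -10 ≤ s.re) : ‖G s‖ ≤ ‖E s‖ ^ 2 := by
    rw [hG]
    simp only [norm_div, norm_pow]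
    exact div_le_self (by positivity) (one_le_pow₀ (hne hs))
  have hcl : closure (re ⁻¹' Set.Ioo (-10 : ℝ) 2) ⊆ {s : ℂ | -10 ≤ s.re} := by
    refine closure_minimal (fun s hs ↦ ?_) (isClosed_le continuous_const continuous_re)
    have := hs.1
    simp only [Set.mem_ofPred_eq]
    linarith
  have hGcl : DiffContOnCl ℂ G (re ⁻¹' Set.Ioo (-10 : ℝ) 2) :=
    DifferentiableOn.diffContOnCl fun s hs ↦ (hGd s (hcl hs)).differentiableWithinAt
  have hGgrowth : ∃ c < Real.pi / (2 - (-10)), ∃ B,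
      G =O[comap (_root_.abs ∘ im) atTop ⊓ 𝓟 (re ⁻¹' Set.Ioo (-10 : ℝ) 2)]
        fun z ↦ Real.exp (B * Real.exp (c * |z.im|)) := by
    -- The strip has width `12`, and `1 / 10 < π / 12`; the `2` comes from squaring `E`.
    refine ⟨1 / 10, ?_, 2, ?_⟩
    · rw [lt_div_iff₀ (by norm_num)]; linarith [Real.pi_gt_three]
    · have h2 := (hord.isBigO_exp_exp (-10) 2 (c := 1 / 10) (by norm_num)).pow 2
      refine IsBigO.trans (IsBigO.of_bound 1 ?_) (h2.trans (IsBigO.of_bound 1 ?_))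
      · filter_upwards [mem_inf_of_right (mem_principal_self _)] with s hs
        rw [one_mul, norm_pow]
        exact hGnorm hs.1.le
      · refine Eventually.of_forall fun s ↦ ?_
        rw [← Real.exp_nat_mul]
        simp
  obtain ⟨B, hB⟩ : ∃ B : ℝ, ∀ s : ℂ, s.re = -10 → ‖G s‖ ≤ B := by
    obtain ⟨T, hT⟩ : ∃ T : ℝ, ∀ t : ℝ, T ≤ |t| →
        ‖F ((-10 : ℝ) + t * I)‖ ≤ K * |t| ^ ((1 + 2 * 10) * δ) := by
      have : ∀ᶠ t : ℝ in comap (fun t : ℝ ↦ |t|) atTop,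
          ‖F ((-10 : ℝ) + t * I)‖ ≤ K * |t| ^ ((1 + 2 * 10) * δ) := by
        have h := hleft.mono fun t h ↦ h.1
        rwa [← comap_norm_atTop] at h
      rw [eventually_comap] at this
      obtain ⟨T, hT⟩ := eventually_atTop.1 this
      exact ⟨T, fun t ht ↦ hT _ ht t rfl⟩
    have hcont : ContinuousOn (fun t : ℝ ↦ G ((-10 : ℝ) + t * I)) (Set.Icc (-(max T 1)) (max T 1)) := by
      intro t _
      refine ContinuousAt.continuousWithinAt ?_
      have h1 : ContinuousAt (fun t : ℝ ↦ ((-10 : ℝ) : ℂ) + t * I) t := by fun_prop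
      exact ContinuousAt.comp (f := fun t : ℝ ↦ ((-10 : ℝ) : ℂ) + t * I)
        (hGd _ (by simp)).continuousAt h1
    obtain ⟨B, hB⟩ := isCompact_Icc.exists_bound_of_continuousOn hcont
    refine ⟨max B (12 ^ (2 * m) * K ^ 2), fun s hs ↦ ?_⟩
    have hs' : s = ((-10 : ℝ) : ℂ) + s.im * I := by
      apply Complex.ext <;> simp [hs]
    rcases le_total |s.im| (max T 1) with h | h
    · refine le_max_of_le_left ?_
      rw [hs']
      exact hB _ (abs_le.1 h)
    · refine le_max_of_le_right ?_
      have h1 : 1 ≤ |s.im| := (le_max_right _ _).trans h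
      have hs1 : s ≠ 1 := by rintro rfl; simp at hs; linarith
      have hb : ‖F s‖ ^ 2 ≤ K ^ 2 * |s.im| := by
        have h2 : ‖F s‖ ≤ K * |s.im| ^ ((1 + 2 * 10) * δ) := by
          have := hT s.im ((le_max_left _ _).trans h)
          rwa [← hs'] at this
        -- Here the threshold `1 / 42` arises: `21 δ ≤ 1 / 2`.
        have h3 : |s.im| ^ ((1 + 2 * 10) * δ) ≤ |s.im| ^ (1 / 2 : ℝ) :=
          Real.rpow_le_rpow_of_exponent_le h1 (by linarith)
        calc ‖F s‖ ^ 2 ≤ (K * |s.im| ^ (1 / 2 : ℝ)) ^ 2 := by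
              gcongr; exact h2.trans (by gcongr)
          _ = _ := by rw [mul_pow, ← Real.sqrt_eq_rpow, Real.sq_sqrt (abs_nonneg _)]
      have hb2 : |s.im| ≤ ‖s + 11‖ := by simpa using abs_im_le_norm (s + 11)
      have hb3 : ‖s - 1‖ ≤ 12 * ‖s + 11‖ := by
        have h1 := norm_le_abs_re_add_abs_im (s - 1)
        have h2 := hne hs.ge
        simp [hs] at h1
        norm_num at h1
        linarith
      have hpos : 0 < ‖s + 11‖ := by linarith
      rw [hG]
      simp only [norm_div, norm_pow]
      rw [div_le_iff₀ (by positivity), hEF s hs1, norm_mul, norm_pow, mul_pow]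
      calc (‖s - 1‖ ^ m) ^ 2 * ‖F s‖ ^ 2 ≤ ((12 * ‖s + 11‖) ^ m) ^ 2 * (K ^ 2 * ‖s + 11‖) := by
            gcongr
            exact hb.trans (by gcongr)
        _ = _ := by rw [mul_pow]; ring
  have hR : ∀ s : ℂ, s.re = 2 → ‖G s‖ ≤ C ^ 2 := by
    intro s hs
    have hs1 : s ≠ 1 := by rintro rfl; simp at hs
    have h1 := hne (s := s) (by linarith)
    have h2 : ‖s - 1‖ ≤ ‖s + 11‖ := by
      rw [Complex.norm_eq_sqrt_sq_add_sq, Complex.norm_eq_sqrt_sq_add_sq]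
      refine Real.sqrt_le_sqrt ?_
      simp [hs]; norm_num
    have hpos : 0 < ‖s + 11‖ := by linarith
    rw [hG]
    simp only [norm_div, norm_pow]
    rw [div_le_iff₀ (by positivity), hEF s hs1, norm_mul, norm_pow, mul_pow]
    calc (‖s - 1‖ ^ m) ^ 2 * ‖F s‖ ^ 2 ≤ (‖s + 11‖ ^ m) ^ 2 * C ^ 2 := by
          gcongr; exact hright s hs.ge
      _ = C ^ 2 * ‖s + 11‖ ^ (2 * m) := by ring
      _ ≤ C ^ 2 * ‖s + 11‖ ^ (2 * m + 1) := by gcongr; omega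
  refine ⟨(|B| + C ^ 2) * 2 ^ (2 * m + 1), by positivity, fun s h1 h2 h3 ↦ ?_⟩
  have hGs : ‖G s‖ ≤ |B| + C ^ 2 :=
    PhragmenLindelof.vertical_strip hGcl hGgrowth
      (fun z hz ↦ (hB z hz).trans (by linarith [le_abs_self B, sq_nonneg C]))
      (fun z hz ↦ (hR z hz).trans (by linarith [abs_nonneg B])) h1 h2
  have hs1 : s ≠ 1 := by rintro rfl; simp at h3; linarith
  have hpos : 0 < ‖s + 11‖ := by linarith [hne h1]
  have h4 : |s.im| ≤ ‖s - 1‖ := by simpa using abs_im_le_norm (s - 1)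
  -- Uses `Re s + 11 ≤ 13 ≤ |Im s|`.
  have h5 : ‖s + 11‖ ≤ 2 * |s.im| := by
    have := norm_le_abs_re_add_abs_im (s + 11)
    simp at this
    rw [abs_of_nonneg (by linarith)] at this
    linarith
  have h6 : 0 < |s.im| := by linarith
  rw [hG] at hGs
  simp only [norm_div, norm_pow] at hGs
  rw [div_le_iff₀ (by positivity), hEF s hs1, norm_mul, norm_pow, mul_pow] at hGs
  have h7 : |s.im| ^ (2 * m) * ‖F s‖ ^ 2 ≤
      |s.im| ^ (2 * m) * ((|B| + C ^ 2) * 2 ^ (2 * m + 1) * |s.im|) := by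
    calc _ = (|s.im| ^ m) ^ 2 * ‖F s‖ ^ 2 := by ring
      _ ≤ (‖s - 1‖ ^ m) ^ 2 * ‖F s‖ ^ 2 := by gcongr
      _ ≤ (|B| + C ^ 2) * ‖s + 11‖ ^ (2 * m + 1) := hGs
      _ ≤ (|B| + C ^ 2) * (2 * |s.im|) ^ (2 * m + 1) := by gcongr
      _ = _ := by ring
  exact le_of_mul_le_mul_left h7 (by positivity)

end Strip

/-! ### Decay of the coefficients by shifting a contour. -/

section Coefficients

open Complex Topology Bornology MeasureTheory

/-- Separates the frequencies `log m` from `log n`, so that the off-diagonal oscillatory integrals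
are bounded independently of their length. -/
lemma inv_two_mul_le_abs_log_sub_log {m n : ℕ} (hm : m ≠ 0) (hn : n ≠ 0) (hmn : m ≠ n) :
    1 / (2 * (n : ℝ)) ≤ |Real.log n - Real.log m| := by
  have hm' : (0 : ℝ) < m := by positivity
  have hn' : (0 : ℝ) < n := by positivity
  have hn1 : (1 : ℝ) ≤ n := by exact_mod_cast Nat.one_le_iff_ne_zero.2 hn
  rcases lt_or_gt_of_ne hmn with h | h
  · have h1 := Real.one_sub_inv_le_log_of_pos (x := (n : ℝ) / m) (by positivity)
    rw [Real.log_div hn'.ne' hm'.ne', inv_div] at h1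
    refine le_trans ?_ (h1.trans (le_abs_self _))
    have h2 : (m : ℝ) + 1 ≤ n := by exact_mod_cast h
    rw [one_sub_div hn'.ne', div_le_div_iff₀ (by positivity) hn']
    nlinarith
  · have h1 := Real.one_sub_inv_le_log_of_pos (x := (m : ℝ) / n) (by positivity)
    rw [Real.log_div hm'.ne' hn'.ne', inv_div] at h1
    rw [abs_sub_comm]
    refine le_trans ?_ (h1.trans (le_abs_self _))
    have h2 : (n : ℝ) + 1 ≤ m := by exact_mod_cast h
    rw [one_sub_div hm'.ne', div_le_div_iff₀ (by positivity) hm']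
    nlinarith

lemma norm_integral_exp_mul_I_le {l : ℝ} (hl : l ≠ 0) (x y : ℝ) :
    ‖∫ t in x..y, exp ((l * I) * t)‖ ≤ 2 / |l| := by
  have hc : (l : ℂ) * I ≠ 0 := mul_ne_zero (by exact_mod_cast hl) I_ne_zero
  have hn (t : ℝ) : ‖exp ((l * I) * t)‖ = 1 := by
    rw [show (l : ℂ) * I * t = ((l * t : ℝ) : ℂ) * I by push_cast; ring, norm_exp_ofReal_mul_I]
  rw [integral_exp_mul_complex hc, norm_div, norm_mul, norm_I, mul_one, norm_real,
    Real.norm_eq_abs]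
  gcongr
  refine (norm_sub_le _ _).trans ?_
  rw [hn, hn]
  norm_num

lemma term_mul_cpow_eq {a : ℕ → ℂ} {m n : ℕ} (hm : m ≠ 0) (hn : n ≠ 0) (t : ℝ) :
    LSeries.term a (2 + t * I) m * (n : ℂ) ^ (2 + t * I) =
      LSeries.term a 2 m * (n : ℂ) ^ (2 : ℂ) *
        exp (((Real.log n - Real.log m : ℝ) * I) * t) := by
  have hm' : (m : ℂ) ≠ 0 := Nat.cast_ne_zero.2 hm
  have hn' : (n : ℂ) ≠ 0 := Nat.cast_ne_zero.2 hn
  rw [LSeries.term_of_ne_zero hm, LSeries.term_of_ne_zero hm, cpow_add _ _ hm', cpow_add _ _ hn',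
    cpow_def_of_ne_zero hm' (t * I), cpow_def_of_ne_zero hn' (t * I),
    show ((Real.log n - Real.log m : ℝ) * I) * (t : ℂ) =
      Complex.log n * (t * I) - Complex.log m * (t * I) by
        rw [← natCast_log, ← natCast_log]; push_cast; ring, exp_sub]
  field_simp

/-- Truncated Fourier inversion for a Dirichlet series on the line `Re s = 2`. -/
lemma norm_coeff_sub_integral_le {a : ℕ → ℂ} (ha : LSeriesSummable a 2) {n : ℕ} (hn : n ≠ 0)
    (T : ℝ) :
    ‖(∫ t in T..(2 * T), LSeries a (2 + t * I) * (n : ℂ) ^ (2 + t * I)) - T * a n‖ ≤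
      4 * (n : ℝ) ^ 3 * ∑' m, ‖LSeries.term a 2 m‖ := by
  set g : ℕ → ℝ → ℂ := fun m t ↦ LSeries.term a (2 + t * I) m * (n : ℂ) ^ (2 + t * I) with hg
  have hn' : (n : ℂ) ≠ 0 := Nat.cast_ne_zero.2 hn
  have hnR : (0 : ℝ) < n := by positivity
  have hnorm (m : ℕ) (t : ℝ) : ‖g m t‖ = ‖LSeries.term a 2 m‖ * (n : ℝ) ^ 2 := by
    simp only [hg, norm_mul, LSeries.norm_term_eq, Complex.norm_natCast_cpow_of_pos
      (Nat.pos_of_ne_zero hn)]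
    simp
  have hcont (m : ℕ) : Continuous (g m) := by
    rcases eq_or_ne m 0 with rfl | hm
    · simp only [hg, LSeries.term_zero, zero_mul]; exact continuous_const
    · have : g m = fun t : ℝ ↦ LSeries.term a 2 m * (n : ℂ) ^ (2 : ℂ) *
          exp (((Real.log n - Real.log m : ℝ) * I) * t) :=
        funext fun t ↦ term_mul_cpow_eq hm hn t
      rw [this]
      fun_prop
  have hsum : HasSum (fun m ↦ ∫ t in T..(2 * T), g m t)
      (∫ t in T..(2 * T), LSeries a (2 + t * I) * (n : ℂ) ^ (2 + t * I)) := by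
    refine intervalIntegral.hasSum_integral_of_dominated_convergence
      (fun m _ ↦ ‖LSeries.term a 2 m‖ * (n : ℝ) ^ 2)
      (fun m ↦ (hcont m).aestronglyMeasurable) (fun m ↦ ae_of_all _ fun t _ ↦ (hnorm m t).le)
      (ae_of_all _ fun t _ ↦ ha.norm.mul_right _) (by simp) (ae_of_all _ fun t _ ↦ ?_)
    refine HasSum.mul_right _ ?_
    exact (ha.of_re_le_re (by simp)).LSeriesHasSum
  -- The term `m = n` does not oscillate and integrates to `T * a n`; every other term contributes
  -- at most `4 n ^ 3` times its size at `s = 2`.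
  have hdiag : HasSum (fun m ↦ if m = n then T * a n else 0) (T * a n) := hasSum_ite_eq n _
  rw [← (hsum.sub hdiag).tsum_eq, ← tsum_mul_left]
  refine tsum_of_norm_bounded (ha.norm.mul_left _).hasSum fun m ↦ ?_
  split_ifs with h
  · subst h
    have : ∀ t : ℝ, g m t = a m := fun t ↦ by
      rw [hg]
      simp only
      rw [LSeries.term_of_ne_zero hn, div_mul_cancel₀]
      rw [Ne, cpow_eq_zero_iff]
      exact fun h ↦ hn' h.1
    simp only [this, intervalIntegral.integral_const]
    rw [show (2 * T - T) = T by ring, real_smul, sub_self, norm_zero]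
    positivity
  · rw [sub_zero]
    rcases eq_or_ne m 0 with rfl | hm
    · simp [hg]
    have hlog := inv_two_mul_le_abs_log_sub_log hm hn h
    have hlpos : 0 < |Real.log n - Real.log m| := lt_of_lt_of_le (by positivity) hlog
    have e : ∀ t : ℝ, g m t = LSeries.term a 2 m * (n : ℂ) ^ (2 : ℂ) *
          exp (((Real.log n - Real.log m : ℝ) * I) * t) := fun t ↦ term_mul_cpow_eq hm hn t
    simp only [e]
    rw [intervalIntegral.integral_const_mul, norm_mul, norm_mul]
    have hn2 : ‖(n : ℂ) ^ (2 : ℂ)‖ = (n : ℝ) ^ 2 := by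
      rw [Complex.norm_natCast_cpow_of_pos (Nat.pos_of_ne_zero hn)]
      simp
    rw [hn2]
    have h1 : ‖∫ t in T..(2 * T), exp (((Real.log n - Real.log m : ℝ) * I) * t)‖ ≤ 4 * n := by
      refine (norm_integral_exp_mul_I_le (abs_pos.1 hlpos) _ _).trans ?_
      rw [div_le_iff₀ hlpos]
      calc (2 : ℝ) = 4 * n * (1 / (2 * n)) := by field_simp; norm_num
        _ ≤ _ := by gcongr
    calc _ ≤ ‖LSeries.term a 2 m‖ * (n : ℝ) ^ 2 * (4 * n) := by gcongr
      _ = _ := by ring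

lemma SelbergClass.differentiableAt {F : ℂ → ℂ} (hF : SelbergClass F) {s : ℂ} (hs : s ≠ 1) :
    DifferentiableAt ℂ F s := by
  obtain ⟨⟨m, E, hE, -, hEF⟩, -⟩ := hF
  have h1 : DifferentiableAt ℂ (fun z ↦ E z / (z - 1) ^ m) s :=
    (hE s).div (by fun_prop) (pow_ne_zero _ (sub_ne_zero.2 hs))
  refine h1.congr_of_eventuallyEq ?_
  filter_upwards [isOpen_ne.mem_nhds hs] with z hz
  rw [hEF z hz, mul_div_cancel_left₀ _ (pow_ne_zero _ (sub_ne_zero.2 hz))]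

/-- Coefficients of a member of the Selberg class of small degree decay fast. -/
lemma SelbergClass.exists_norm_coeff_le {F : ℂ → ℂ} (hF : SelbergClass F) {δ : ℝ}
    (hδ : HasHalfDegree F δ) (hsmall : δ ≤ 1 / 42) {a : ℕ → ℂ} (ha : HasDirichletSeries F a) :
    a =O[atTop] fun n : ℕ ↦ (n : ℝ) ^ (-4 : ℝ) := by
  obtain ⟨K, hK, hstrip⟩ := hF.exists_strip_bound hδ hsmall
  have ha2 : LSeriesSummable a 2 := (ha 2 (by simp)).LSeriesSummable
  set S := ∑' m, ‖LSeries.term a 2 m‖ with hS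
  have hS0 : 0 ≤ S := tsum_nonneg fun _ ↦ norm_nonneg _
  set R := Real.sqrt (2 * K) with hR
  -- The three parts are the off-diagonal error, the two horizontal sides (`12 R` each), and the
  -- left side.
  refine IsBigO.of_bound (4 * S + 24 * R + R) ?_
  filter_upwards [eventually_ge_atTop 13] with n hn13
  have hn : n ≠ 0 := by omega
  have hnR : (13 : ℝ) ≤ n := by exact_mod_cast hn13
  have hn0 : (0 : ℝ) < n := by linarith
  have hn1 : (1 : ℝ) ≤ n := by linarith
  -- With this height `F` is `O(n ^ 6)` on the rectangle `[-10, 2] × [T, 2 T]`. The horizontal sides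
  -- give `n ^ (6 + 2)` and the left side `n ^ (12 + 6 - 10)`, so `T * a n = O(n ^ 8)`.
  set T : ℝ := (n : ℝ) ^ 12 with hT
  have hT13 : 13 ≤ T := hnR.trans (le_self_pow₀ hn1 (by norm_num))
  have hT0 : 0 < T := by linarith
  have hbound {s : ℂ} (h1 : -10 ≤ s.re) (h2 : s.re ≤ 2) (h3 : T ≤ s.im) (h4 : s.im ≤ 2 * T) :
      ‖F s‖ ≤ R * (n : ℝ) ^ 6 := by
    have him : |s.im| = s.im := abs_of_nonneg (by linarith)
    have h5 := hstrip s h1 h2 (by rw [him]; linarith)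
    rw [him] at h5
    refine le_of_sq_le_sq ?_ (by positivity)
    calc ‖F s‖ ^ 2 ≤ K * s.im := h5
      _ ≤ K * (2 * T) := by gcongr
      _ = (R * (n : ℝ) ^ 6) ^ 2 := by
        rw [mul_pow, hR, Real.sq_sqrt (by positivity), hT]; ring
  set f : ℂ → ℂ := fun s ↦ F s * (n : ℂ) ^ s with hf
  have hfd : DifferentiableOn ℂ f
      (Set.uIcc (⟨-10, T⟩ : ℂ).re (⟨2, 2 * T⟩ : ℂ).re ×ℂ
        Set.uIcc (⟨-10, T⟩ : ℂ).im (⟨2, 2 * T⟩ : ℂ).im) := by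
    intro s hs
    have him : T ≤ s.im := by
      have := hs.2
      simp only [Set.mem_preimage] at this
      rw [Set.uIcc_of_le (by linarith)] at this
      exact this.1
    have hs1 : s ≠ 1 := by rintro rfl; simp at him; linarith
    refine ((hF.differentiableAt hs1).mul
      (differentiableAt_id.const_cpow (Or.inl (Nat.cast_ne_zero.2 hn)))).differentiableWithinAt
  have hrect := integral_boundary_rect_eq_zero_of_differentiableOn f ⟨-10, T⟩ ⟨2, 2 * T⟩ hfd
  simp only at hrect
  have hcpow (s : ℂ) : ‖(n : ℂ) ^ s‖ = (n : ℝ) ^ s.re :=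
    Complex.norm_natCast_cpow_of_pos (Nat.pos_of_ne_zero hn) s
  have hhor (u : ℝ) (hu1 : T ≤ u) (hu2 : u ≤ 2 * T) :
      ‖∫ x in (-10 : ℝ)..2, f (x + u * I)‖ ≤ 12 * (R * (n : ℝ) ^ 8) := by
    have := intervalIntegral.norm_integral_le_of_norm_le_const (a := (-10 : ℝ)) (b := 2)
      (f := fun x : ℝ ↦ f (x + u * I)) (C := R * (n : ℝ) ^ 8) (fun x hx ↦ by
        rw [Set.uIoc_of_le (by norm_num)] at hx
        rw [hf]
        simp only
        rw [norm_mul, hcpow]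
        have h1 : ‖F (x + u * I)‖ ≤ R * (n : ℝ) ^ 6 :=
          hbound (by simp; linarith [hx.1]) (by simp; exact hx.2) (by simpa) (by simpa)
        have h2 : (n : ℝ) ^ ((x : ℂ) + u * I).re ≤ (n : ℝ) ^ 2 := by
          rw [← Real.rpow_natCast]
          refine Real.rpow_le_rpow_of_exponent_le hn1 ?_
          simpa using hx.2
        calc _ ≤ R * (n : ℝ) ^ 6 * (n : ℝ) ^ 2 := by gcongr
          _ = _ := by ring)
    refine this.trans (le_of_eq ?_)
    norm_num
    ring
  have hleft : ‖∫ y in T..(2 * T), f ((-10 : ℝ) + y * I)‖ ≤ R * (n : ℝ) ^ 8 := by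
    have := intervalIntegral.norm_integral_le_of_norm_le_const (a := T) (b := 2 * T)
      (f := fun y : ℝ ↦ f ((-10 : ℝ) + y * I)) (C := R * ((n : ℝ) ^ 4)⁻¹) (fun y hy ↦ by
        rw [Set.uIoc_of_le (by linarith)] at hy
        rw [hf]
        simp only
        rw [norm_mul, hcpow]
        have h1 : ‖F ((-10 : ℝ) + y * I)‖ ≤ R * (n : ℝ) ^ 6 :=
          hbound (by simp) (by simp; norm_num) (by simpa using hy.1.le) (by simpa using hy.2)
        have h2 : (n : ℝ) ^ (((-10 : ℝ) : ℂ) + y * I).re = ((n : ℝ) ^ 10)⁻¹ := by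
          have : (((-10 : ℝ) : ℂ) + y * I).re = -((10 : ℕ) : ℝ) := by simp
          rw [this, Real.rpow_neg hn0.le, Real.rpow_natCast]
        rw [h2]
        calc _ ≤ R * (n : ℝ) ^ 6 * ((n : ℝ) ^ 10)⁻¹ := by gcongr
          _ = _ := by field_simp)
    refine this.trans (le_of_eq ?_)
    rw [show 2 * T - T = T by ring, abs_of_pos hT0, hT]
    field_simp
  have hright : (∫ y in T..(2 * T), f ((2 : ℝ) + y * I)) =
      ∫ t in T..(2 * T), LSeries a (2 + t * I) * (n : ℂ) ^ (2 + t * I) := by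
    refine intervalIntegral.integral_congr fun t _ ↦ ?_
    simp only [hf]
    rw [ha.eq_LSeries (by simp)]
    push_cast
    rfl
  have hmain : ‖∫ y in T..(2 * T), f ((2 : ℝ) + y * I)‖ ≤ 25 * (R * (n : ℝ) ^ 8) := by
    have h1 := hhor T le_rfl (by linarith)
    have h2 := hhor (2 * T) (by linarith) le_rfl
    set J := ∫ y in T..(2 * T), f ((2 : ℝ) + y * I)
    set J' := ∫ y in T..(2 * T), f ((-10 : ℝ) + y * I)
    set H := ∫ x in (-10 : ℝ)..2, f (x + T * I)
    set H' := ∫ x in (-10 : ℝ)..2, f (x + (2 * T : ℝ) * I)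
    have h3 : I • J = H' - H + I • J' := by linear_combination hrect
    have h4 := congrArg norm h3
    rw [norm_smul, norm_I, one_mul] at h4
    rw [h4]
    refine (norm_add_le _ _).trans ?_
    rw [norm_smul, norm_I, one_mul]
    have := norm_sub_le H' H
    linarith
  have hcoef := norm_coeff_sub_integral_le ha2 hn T
  rw [← hright, ← hS] at hcoef
  have h1 : T * ‖a n‖ ≤ 4 * (n : ℝ) ^ 3 * S + 25 * (R * (n : ℝ) ^ 8) := by
    have h2 : ‖(T : ℂ) * a n‖ = T * ‖a n‖ := by
      rw [norm_mul, norm_real, Real.norm_eq_abs, abs_of_pos hT0]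
    rw [← h2]
    have := norm_sub_norm_le ((T : ℂ) * a n) (∫ y in T..(2 * T), f ((2 : ℝ) + y * I))
    rw [norm_sub_rev] at this
    linarith
  have h3 : ‖((n : ℝ) ^ (-4 : ℝ))‖ = ((n : ℝ) ^ 4)⁻¹ := by
    rw [Real.norm_eq_abs, abs_of_nonneg (by positivity), Real.rpow_neg hn0.le]
    simp
  rw [h3, ← div_eq_mul_inv, le_div_iff₀ (by positivity)]
  have h4 : (n : ℝ) ^ 8 * (‖a n‖ * (n : ℝ) ^ 4) ≤ (n : ℝ) ^ 8 * (4 * S + 24 * R + R) := by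
    have h5 : (n : ℝ) ^ 3 ≤ (n : ℝ) ^ 8 := pow_le_pow_right₀ hn1 (by norm_num)
    calc _ = T * ‖a n‖ := by rw [hT]; ring
      _ ≤ _ := h1
      _ ≤ 4 * (n : ℝ) ^ 8 * S + 25 * (R * (n : ℝ) ^ 8) := by gcongr
      _ = _ := by ring
  exact le_of_mul_le_mul_left h4 (by positivity)

end Coefficients

/-! ### From decay of the coefficients of `F` to convergence of `log F`. -/

section EulerCoefficients

open Complex Topology

lemma abscissaOfAbsConv_le_one {a : ℕ → ℂ} (h : ∀ s : ℂ, 1 < s.re → LSeriesSummable a s) :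
    LSeries.abscissaOfAbsConv a ≤ 1 := by
  have := LSeries.abscissaOfAbsConv_le_of_forall_lt_LSeriesSummable (f := a) (x := 1)
    fun y hy ↦ h y (by simpa)
  simpa using this

/-- Logarithmic differentiation of `F = exp (∑ b n / n ^ s)`, on the level of coefficients. -/
lemma logMul_eq_convolution {F : ℂ → ℂ} {a b : ℕ → ℂ} (ha : HasDirichletSeries F a)
    (hb : ∀ s : ℂ, 1 < s.re → LSeriesSummable b s ∧ Complex.exp (LSeries b s) = F s) {n : ℕ}
    (hn : n ≠ 0) :
    LSeries.logMul a n = LSeries.convolution (LSeries.logMul b) a n := by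
  have ha1 : LSeries.abscissaOfAbsConv a ≤ 1 :=
    abscissaOfAbsConv_le_one fun s hs ↦ (ha s hs).LSeriesSummable
  have hb1 : LSeries.abscissaOfAbsConv b ≤ 1 := abscissaOfAbsConv_le_one fun s hs ↦ (hb s hs).1
  have h1 : (1 : EReal) < ⊤ := EReal.coe_lt_top 1
  refine LSeries.eq_of_LSeries_eventually_eq ?_ ?_ ?_ hn
  · rw [LSeries.abscissaOfAbsConv_logMul]; exact ha1.trans_lt h1
  · refine (LSeries.abscissaOfAbsConv_convolution_le _ _).trans_lt (max_lt ?_ (ha1.trans_lt h1))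
    rw [LSeries.abscissaOfAbsConv_logMul]; exact hb1.trans_lt h1
  · filter_upwards [eventually_gt_atTop 1] with x hx
    have hx' : (1 : EReal) < (x : ℂ).re := by simpa using EReal.coe_lt_coe_iff.2 hx
    have da := LSeries_hasDerivAt (ha1.trans_lt hx')
    have db := (LSeries_hasDerivAt (hb1.trans_lt hx')).cexp
    have heq : (fun s ↦ Complex.exp (LSeries b s)) =ᶠ[𝓝 (x : ℂ)] LSeries a := by
      have : ∀ᶠ s : ℂ in 𝓝 (x : ℂ), 1 < s.re :=
        (isOpen_lt continuous_const continuous_re).eventually_mem (by simpa)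
      filter_upwards [this] with s hs
      rw [(hb s hs).2, ha.eq_LSeries hs]
    have key := da.unique (db.congr_of_eventuallyEq heq.symm)
    have hxc : 1 < (x : ℂ).re := by simpa
    rw [(hb x hxc).2, ha.eq_LSeries hxc] at key
    rw [LSeries_convolution' ?_ (ha x hxc).LSeriesSummable]
    · linear_combination -key
    · exact LSeriesSummable_logMul_of_lt_re (hb1.trans_lt hx')

lemma euler_coeff_prime {F : ℂ → ℂ} {a b : ℕ → ℂ} (ha : HasDirichletSeries F a) (ha1 : a 1 = 1)
    (hb : ∀ s : ℂ, 1 < s.re → LSeriesSummable b s ∧ Complex.exp (LSeries b s) = F s) {p : ℕ}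
    (hp : p.Prime) : b p = a p := by
  have h := logMul_eq_convolution ha hb hp.ne_zero
  rw [convolution_prime hp, ha1] at h
  have hlog : Complex.log p ≠ 0 := by
    rw [← natCast_log]; exact_mod_cast (Real.log_pos (by exact_mod_cast hp.one_lt)).ne'
  simp only [LSeries.logMul, Nat.cast_one, Complex.log_one, zero_mul, mul_one, zero_add] at h
  exact (mul_left_cancel₀ hlog h).symm

/-- Newton's identity: the coefficient of `p ^ k` in `-F' = (-F' / F) F`, divided by `log p`. -/
lemma euler_coeff_prime_pow {F : ℂ → ℂ} {a b : ℕ → ℂ} (ha : HasDirichletSeries F a)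
    (hb : ∀ s : ℂ, 1 < s.re → LSeriesSummable b s ∧ Complex.exp (LSeries b s) = F s) {p : ℕ}
    (hp : p.Prime) (k : ℕ) :
    (k : ℂ) * a (p ^ k) = ∑ j ∈ Finset.range (k + 1), ((j : ℂ) * b (p ^ j)) * a (p ^ (k - j)) := by
  have h := logMul_eq_convolution ha hb (pow_ne_zero k hp.ne_zero)
  simp only [LSeries.convolution_def] at h
  rw [Nat.sum_divisorsAntidiagonal (f := fun x y ↦ LSeries.logMul b x * a y),
    Nat.sum_divisors_prime_pow hp] at h
  have hlog : Complex.log p ≠ 0 := by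
    rw [← natCast_log]; exact_mod_cast (Real.log_pos (by exact_mod_cast hp.one_lt)).ne'
  have hl (j : ℕ) : Complex.log ((p ^ j : ℕ) : ℂ) = j * Complex.log p := by
    rw [← natCast_log, ← natCast_log]; push_cast; rw [Real.log_pow]; push_cast; rfl
  refine mul_left_cancel₀ hlog ?_
  rw [Finset.mul_sum]
  simp only [LSeries.logMul, hl] at h
  calc _ = (k : ℂ) * Complex.log p * a (p ^ k) := by ring
    _ = _ := h
    _ = _ := Finset.sum_congr rfl fun j hj ↦ by
      rw [Nat.pow_div (by simp at hj; omega) hp.pos]; ring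

/-- Newton's identity solves recursively for `k * b (p ^ k)`, each step inheriting one factor `p ^
(-4)`. The constant grows with `K`, so this can only serve finitely many exponents. -/
lemma exists_norm_euler_coeff_le {F : ℂ → ℂ} {a b : ℕ → ℂ} (ha : HasDirichletSeries F a)
    (ha1 : a 1 = 1)
    (hb : ∀ s : ℂ, 1 < s.re → LSeriesSummable b s ∧ Complex.exp (LSeries b s) = F s)
    (hdecay : a =O[atTop] fun n : ℕ ↦ (n : ℝ) ^ (-4 : ℝ)) (K : ℕ) :
    ∃ C : ℝ, 0 ≤ C ∧ ∀ p : ℕ, p.Prime → ∀ k ≤ K, ‖(k : ℂ) * b (p ^ k)‖ ≤ C * (p : ℝ) ^ (-4 : ℝ) := by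
  obtain ⟨A, hA, hdecay⟩ := exists_norm_le_of_isBigO_rpow hdecay
  have hA1 (n : ℕ) (hn : n ≠ 0) : ‖a n‖ ≤ A := by
    refine (hdecay n hn).trans (mul_le_of_le_one_right hA.le ?_)
    exact Real.rpow_le_one_of_one_le_of_nonpos (by exact_mod_cast Nat.one_le_iff_ne_zero.2 hn)
      (by norm_num)
  have hA2 (p : ℕ) (hp : p.Prime) (k : ℕ) (hk : k ≠ 0) : ‖a (p ^ k)‖ ≤ A * (p : ℝ) ^ (-4 : ℝ) := by
    refine (hdecay _ (pow_ne_zero _ hp.ne_zero)).trans ?_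
    refine mul_le_mul_of_nonneg_left (Real.rpow_le_rpow_of_nonpos (by exact_mod_cast hp.pos) ?_
      (by norm_num)) hA.le
    exact_mod_cast Nat.le_self_pow hk p
  induction K with
  | zero =>
    refine ⟨0, le_rfl, fun p _ k hk ↦ ?_⟩
    obtain rfl : k = 0 := by omega
    simp
  | succ K ih =>
    obtain ⟨C, hC, ih⟩ := ih
    refine ⟨C + ((K + 1) * A + (K + 1) * (C * A)), by positivity, fun p hp k hk ↦ ?_⟩
    have hp0 : 0 ≤ (p : ℝ) ^ (-4 : ℝ) := by positivity
    rcases hk.lt_or_eq with hk | rfl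
    · refine (ih p hp k (by omega)).trans ?_
      gcongr
      have : 0 ≤ (K + 1) * A + (K + 1) * (C * A) := by positivity
      linarith
    · have h := euler_coeff_prime_pow ha hb hp (K + 1)
      rw [Finset.sum_range_succ, Nat.sub_self, pow_zero, ha1, mul_one] at h
      rw [show ((K + 1 : ℕ) : ℂ) * b (p ^ (K + 1)) = ((K + 1 : ℕ) : ℂ) * a (p ^ (K + 1))
        - ∑ j ∈ Finset.range (K + 1), ((j : ℂ) * b (p ^ j)) * a (p ^ (K + 1 - j)) by
          linear_combination -h]
      refine (norm_sub_le _ _).trans ?_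
      have h1 : ‖((K + 1 : ℕ) : ℂ) * a (p ^ (K + 1))‖ ≤ (K + 1) * (A * (p : ℝ) ^ (-4 : ℝ)) := by
        rw [norm_mul, Complex.norm_natCast]
        push_cast
        gcongr
        exact hA2 p hp _ (by omega)
      have h2 : ‖∑ j ∈ Finset.range (K + 1), ((j : ℂ) * b (p ^ j)) * a (p ^ (K + 1 - j))‖ ≤
          (K + 1) * ((C * (p : ℝ) ^ (-4 : ℝ)) * A) := by
        refine (norm_sum_le_of_le _ (f := fun j : ℕ ↦ ((j : ℂ) * b (p ^ j)) * a (p ^ (K + 1 - j)))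
          (n := fun _ ↦ (C * (p : ℝ) ^ (-4 : ℝ)) * A) fun j hj ↦ ?_).trans (le_of_eq (by simp))
        rw [norm_mul]
        gcongr
        · exact ih p hp j (by simp at hj; omega)
        · exact hA1 _ (pow_ne_zero _ hp.ne_zero)
      refine (add_le_add h1 h2).trans ?_
      have : 0 ≤ C * (p : ℝ) ^ (-4 : ℝ) := by positivity
      nlinarith

/-- Prime powers are parametrized by `(p, k) ↦ p ^ (k + 1)`, and the majorant is a product of a
convergent sum over primes and a geometric series. -/
lemma summable_of_prime_pow_bound {f : ℕ → ℂ} (hf : ∀ n, ¬ IsPrimePow n → f n = 0) {x r M : ℝ}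
    (hx : 1 < x) (hr0 : 0 ≤ r) (hr1 : r < 1)
    (h : ∀ p : ℕ, p.Prime → ∀ k : ℕ, ‖f (p ^ (k + 1))‖ ≤ M * ((p : ℝ) ^ (-x) * r ^ k)) :
    Summable f := by
  have h1 : Summable fun q : Nat.Primes × ℕ ↦ M * (((q.1 : ℕ) : ℝ) ^ (-x) * r ^ q.2) := by
    refine Summable.mul_left _ ?_
    exact Summable.mul_of_nonneg (f := fun p : Nat.Primes ↦ ((p : ℕ) : ℝ) ^ (-x))
      (g := fun k : ℕ ↦ r ^ k) (Nat.Primes.summable_rpow.2 (by linarith))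
      (summable_geometric_of_lt_one hr0 hr1) (fun p ↦ by positivity) (fun k ↦ by positivity)
  have h2 : Summable ((fun n : {n : ℕ // IsPrimePow n} ↦ f n) ∘ Nat.Primes.prodNatEquiv) :=
    Summable.of_norm_bounded h1 fun ⟨p, k⟩ ↦ by
      simpa only [Function.comp, Nat.Primes.coe_prodNatEquiv_apply] using h p p.2 k
  rw [Equiv.summable_iff] at h2
  refine (Subtype.val_injective.summable_iff ?_).1 h2
  intro n hn
  exact hf n fun h ↦ hn ⟨⟨n, h⟩, rfl⟩

lemma term_eq_zero_of_not_isPrimePow {b : ℕ → ℂ} (hb : ∀ n, ¬ IsPrimePow n → b n = 0) (s : ℂ)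
    (n : ℕ) (hn : ¬ IsPrimePow n) : LSeries.term b s n = 0 := by
  rcases eq_or_ne n 0 with rfl | h
  · simp
  · rw [LSeries.term_of_ne_zero h, hb n hn, zero_div]

/-- If the coefficients of `F` decay fast then the Dirichlet series of `log F` converges absolutely
slightly to the left of `Re s = 1 / 2`. -/
lemma exists_LSeriesSummable_lt_half {F : ℂ → ℂ} {a b : ℕ → ℂ} (ha : HasDirichletSeries F a)
    (ha1 : a 1 = 1) {θ : ℝ} (hθ : θ < 1 / 2) (hpp : ∀ n, ¬ IsPrimePow n → b n = 0)
    (hO : b =O[atTop] fun n : ℕ ↦ (n : ℝ) ^ θ)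
    (hb : ∀ s : ℂ, 1 < s.re → LSeriesSummable b s ∧ Complex.exp (LSeries b s) = F s)
    (hdecay : a =O[atTop] fun n : ℕ ↦ (n : ℝ) ^ (-4 : ℝ)) :
    ∃ σ : ℝ, 0 < σ ∧ σ < 1 / 2 ∧ LSeriesSummable b σ := by
  set θ' := max θ 0 with hθ'
  have hθ'0 : 0 ≤ θ' := le_max_right _ _
  have hθ'1 : θ' < 1 / 2 := max_lt hθ (by norm_num)
  set η := (1 / 2 - θ') / 2 with hη
  have hη0 : 0 < η := by linarith
  obtain ⟨B, hB, hbB⟩ := exists_norm_le_of_isBigO_rpow (isBigO_rpow_of_le hO (le_max_left θ 0))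
  -- Exponents up to `K` are handled by the decay `p ^ (-4)`. Beyond `K` the bound `n ^ θ'` leaves
  -- `p ^ (-η k)`; half of it is at most `p ^ (-2)` because `η k > 4`, and the other half is
  -- geometric.
  set K := ⌈4 / η⌉₊ with hK
  obtain ⟨C, hC, hbC⟩ := exists_norm_euler_coeff_le ha ha1 hb hdecay K
  set r : ℝ := 2 ^ (-(η / 2)) with hr
  have hr0 : 0 < r := by positivity
  have hr1 : r < 1 := Real.rpow_lt_one_of_one_lt_of_neg one_lt_two (by linarith)
  refine ⟨θ' + η, by linarith, by linarith, ?_⟩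
  refine summable_of_prime_pow_bound (term_eq_zero_of_not_isPrimePow hpp _) (x := 2) one_lt_two
    hr0.le hr1 (M := C / r ^ K + B) fun p hp k ↦ ?_
  have hp1 : (1 : ℝ) ≤ p := by exact_mod_cast hp.one_lt.le
  have hp0 : (0 : ℝ) < p := by linarith
  have hp2 : (2 : ℝ) ≤ p := by exact_mod_cast hp.two_le
  have hpk : p ^ (k + 1) ≠ 0 := pow_ne_zero _ hp.ne_zero
  have hpk1 : (1 : ℝ) ≤ ((p ^ (k + 1) : ℕ) : ℝ) := by exact_mod_cast Nat.one_le_iff_ne_zero.2 hpk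
  have hpk0 : (0 : ℝ) < ((p ^ (k + 1) : ℕ) : ℝ) := by linarith
  rw [LSeries.norm_term_eq, if_neg hpk, ofReal_re]
  rcases le_or_gt (k + 1) K with h | h
  · have h1 : ‖b (p ^ (k + 1))‖ ≤ C * (p : ℝ) ^ (-4 : ℝ) := by
      refine le_trans ?_ (hbC p hp (k + 1) h)
      rw [norm_mul, Complex.norm_natCast]
      have : (1 : ℝ) ≤ ((k + 1 : ℕ) : ℝ) := by exact_mod_cast Nat.le_add_left 1 k
      exact le_mul_of_one_le_left (norm_nonneg _) this
    have h2 : (p : ℝ) ^ (-4 : ℝ) ≤ (p : ℝ) ^ (-2 : ℝ) :=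
      Real.rpow_le_rpow_of_exponent_le hp1 (by norm_num)
    have h3 : r ^ K ≤ r ^ k := pow_le_pow_of_le_one hr0.le hr1.le (by omega)
    have h4 : (1 : ℝ) ≤ r ^ k / r ^ K := by rwa [one_le_div (by positivity)]
    calc _ ≤ ‖b (p ^ (k + 1))‖ :=
          div_le_self (norm_nonneg _) (Real.one_le_rpow hpk1 (by linarith))
      _ ≤ C * (p : ℝ) ^ (-4 : ℝ) := h1
      _ ≤ C * (p : ℝ) ^ (-2 : ℝ) * 1 := by rw [mul_one]; gcongr
      _ ≤ C * (p : ℝ) ^ (-2 : ℝ) * (r ^ k / r ^ K) := by gcongr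
      _ = C / r ^ K * ((p : ℝ) ^ (-2 : ℝ) * r ^ k) := by ring
      _ ≤ _ := by gcongr; linarith
  · have h1 := hbB (p ^ (k + 1)) hpk
    have h2 : ((p ^ (k + 1) : ℕ) : ℝ) ^ θ' / ((p ^ (k + 1) : ℕ) : ℝ) ^ (θ' + η) =
        ((p : ℝ) ^ (-(η / 2))) ^ (k + 1) * ((p : ℝ) ^ (-(η / 2))) ^ (k + 1) := by
      rw [← Real.rpow_sub hpk0]
      push_cast
      rw [← Real.rpow_natCast, ← Real.rpow_natCast, ← Real.rpow_mul hp0.le,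
        ← Real.rpow_mul hp0.le, ← Real.rpow_add hp0]
      congr 1
      ring
    have h3 : (p : ℝ) ^ (-(η / 2)) ≤ r :=
      Real.rpow_le_rpow_of_nonpos two_pos hp2 (by linarith)
    have h4 : ((p : ℝ) ^ (-(η / 2))) ^ (k + 1) ≤ (p : ℝ) ^ (-2 : ℝ) := by
      rw [← Real.rpow_natCast, ← Real.rpow_mul hp0.le]
      refine Real.rpow_le_rpow_of_exponent_le hp1 ?_
      have h5 : 4 / η < ((k + 1 : ℕ) : ℝ) := (Nat.le_ceil _).trans_lt (by exact_mod_cast h)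
      rw [div_lt_iff₀ hη0] at h5
      nlinarith
    have h5 : ((p : ℝ) ^ (-(η / 2))) ^ (k + 1) ≤ r ^ k := by
      calc _ ≤ r ^ (k + 1) := by gcongr
        _ ≤ r ^ k := pow_le_pow_of_le_one hr0.le hr1.le (by omega)
    calc _ ≤ B * ((p ^ (k + 1) : ℕ) : ℝ) ^ θ' / ((p ^ (k + 1) : ℕ) : ℝ) ^ (θ' + η) := by gcongr
      _ = B * (((p : ℝ) ^ (-(η / 2))) ^ (k + 1) * ((p : ℝ) ^ (-(η / 2))) ^ (k + 1)) := by
          rw [mul_div_assoc, h2]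
      _ ≤ B * ((p : ℝ) ^ (-2 : ℝ) * r ^ k) := by gcongr
      _ ≤ _ := by
          gcongr
          have : 0 ≤ C / r ^ K := by positivity
          linarith

end EulerCoefficients

/-! ### Small degree forces degree zero. -/

section SmallDegree

open Complex Topology Bornology

lemma LSeries_differentiableAt_of_lt {a : ℕ → ℂ} {σ : ℝ} (h : LSeriesSummable a σ) {s : ℂ}
    (hs : σ < s.re) : DifferentiableAt ℂ (LSeries a) s := by
  have h1 : LSeries.abscissaOfAbsConv a ≤ σ := by simpa using h.abscissaOfAbsConv_le
  exact (LSeries_hasDerivAt (h1.trans_lt (EReal.coe_lt_coe_iff.2 hs))).differentiableAt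

/-- A function agreeing with a Selberg class function on `Re s > 1` and holomorphic on a larger
half plane agrees with it there. -/
lemma SelbergClass.eq_of_differentiableOn {F g : ℂ → ℂ} (hF : SelbergClass F) {σ : ℝ}
    (hg : DifferentiableOn ℂ g {s | σ < s.re}) (h : ∀ s : ℂ, 1 < s.re → F s = g s)
    {s : ℂ} (hs : σ < s.re) (hs1 : s ≠ 1) : F s = g s := by
  obtain ⟨⟨m, E, hE, -, hEF⟩, -⟩ := hF
  have hopen : IsOpen {s : ℂ | σ < s.re} := isOpen_lt continuous_const continuous_re
  have h1 : AnalyticOnNhd ℂ E {s | σ < s.re} := hE.differentiableOn.analyticOnNhd hopen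
  have h2 : AnalyticOnNhd ℂ (fun s ↦ (s - 1) ^ m * g s) {s | σ < s.re} :=
    (DifferentiableOn.mul (by fun_prop) hg).analyticOnNhd hopen
  have h3 : Set.EqOn E (fun s ↦ (s - 1) ^ m * g s) {s | σ < s.re} := by
    refine h1.eqOn_of_preconnected_of_eventuallyEq h2 (convex_halfSpace_re_gt σ).isPreconnected
      (z₀ := ((max σ 1 + 1 : ℝ) : ℂ)) ?_ ?_
    · have := le_max_left σ 1
      simp only [Set.mem_ofPred_eq, ofReal_re]
      linarith
    · have : ∀ᶠ z : ℂ in 𝓝 ((max σ 1 + 1 : ℝ) : ℂ), 1 < z.re := by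
        refine (isOpen_lt continuous_const continuous_re).eventually_mem ?_
        have := le_max_right σ 1
        simp only [Set.mem_ofPred_eq, ofReal_re]
        linarith
      filter_upwards [this] with z hz
      rw [hEF z (ne_one_of_one_lt_re hz), h z hz]
  have h4 := h3 hs
  simp only at h4
  rw [hEF s hs1] at h4
  exact mul_left_cancel₀ (pow_ne_zero _ (sub_ne_zero.2 hs1)) h4

lemma LSeriesSummable_of_decay {a : ℕ → ℂ} (hdecay : a =O[atTop] fun n : ℕ ↦ (n : ℝ) ^ (-4 : ℝ))
    {s : ℂ} (hs : -3 < s.re) : LSeriesSummable a s := by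
  refine LSeriesSummable_of_isBigO_rpow hs ?_
  convert hdecay using 3
  norm_num

lemma SelbergClass.eq_LSeries_of_decay {F : ℂ → ℂ} (hF : SelbergClass F) {a : ℕ → ℂ}
    (ha : HasDirichletSeries F a) (hdecay : a =O[atTop] fun n : ℕ ↦ (n : ℝ) ^ (-4 : ℝ))
    {s : ℂ} (hs : -3 < s.re) (hs1 : s ≠ 1) : F s = LSeries a s := by
  refine hF.eq_of_differentiableOn (σ := -3) (fun z hz ↦ ?_) (fun z hz ↦ ha.eq_LSeries hz) hs hs1
  have hz : -3 < z.re := hz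
  exact (LSeries_differentiableAt_of_lt (σ := (z.re - 3) / 2)
    (LSeriesSummable_of_decay hdecay (by simp; linarith)) (by linarith)).differentiableWithinAt

/-- With coefficients `O(n ^ (-4))` the series still represents `F` on `Re s = -1` and is bounded
there, whereas `F` has exact order `|t| ^ (3 δ)` on that line. -/
lemma SelbergClass.halfDegree_eq_zero_of_small {F : ℂ → ℂ} (hF : SelbergClass F) {δ : ℝ}
    (hδ : HasHalfDegree F δ) (hsmall : δ ≤ 1 / 42) : δ = 0 := by
  refine le_antisymm ?_ hδ.nonneg
  obtain ⟨a, ha, -⟩ := hF.2.2.2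
  have hdecay := hF.exists_norm_coeff_le hδ hsmall ha
  obtain ⟨K, hK, h⟩ := hF.exists_vertical_bounds hδ one_pos
  have hsum : LSeriesSummable a ((-1 : ℝ) : ℂ) := LSeriesSummable_of_decay hdecay (by simp)
  have : (1 + 2 * 1) * δ ≤ 0 := by
    refine nonpos_of_eventually_rpow_le (C := K * ∑' n, ‖LSeries.term a (-1 : ℝ) n‖) ?_
    filter_upwards [h, tendsto_abs_cobounded.eventually_gt_atTop 0] with t ⟨_, h⟩ ht
    refine h.trans ?_
    gcongr
    rw [hF.eq_LSeries_of_decay ha hdecay (by simp)]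
    · exact norm_LSeries_le_of_re hsum (by simp)
    · intro h
      have := congrArg im h
      simp at this
      simp [this] at ht
  linarith

end SmallDegree

/-! ### Degree zero forces `F = 1`. -/

section DegreeZero

open Complex Topology Bornology

lemma tendsto_LSeries_atTop {a : ℕ → ℂ} {σ : ℝ} (h : LSeriesSummable a σ) :
    Tendsto (fun x : ℝ ↦ LSeries a x) atTop (𝓝 (a 1)) :=
  LSeries.tendsto_atTop (h.abscissaOfAbsConv_le.trans_lt (EReal.coe_lt_top _))

/-- A zero-free function `exp (∑ b n / n ^ s)` whose logarithm converges up to `Re s = 1 / 2` and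
which has a functional equation without gamma factors is constant. -/
lemma eq_one_of_functional_equation {H : ℂ → ℂ} (hH : Differentiable ℂ H) {b : ℕ → ℂ}
    (hb1 : b 1 = 0) {σ : ℝ} (hσ : σ < 1 / 2) (hb : LSeriesSummable b σ)
    (hHb : ∀ s : ℂ, σ < s.re → H s = exp (LSeries b s)) {ε : ℂ} (hε : ε ≠ 0) {Q : ℝ} (hQ : 0 < Q)
    (hfe : ∀ s : ℂ, ε * (Q : ℂ) ^ s * H s =
      conj (ε * (Q : ℂ) ^ (1 - conj s) * H (1 - conj s))) (s : ℂ) : H s = 1 := by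
  have hQ0 : (Q : ℂ) ≠ 0 := by exact_mod_cast hQ.ne'
  have hre (s : ℂ) : (1 - conj s).re = 1 - s.re := by simp
  have hpre (s : ℂ) : ε * (Q : ℂ) ^ s ≠ 0 :=
    mul_ne_zero hε (by rw [Ne, cpow_eq_zero_iff]; exact fun h ↦ hQ0 h.1)
  have hne_right {s : ℂ} (hs : σ < s.re) : H s ≠ 0 := by rw [hHb s hs]; exact exp_ne_zero _
  -- As `σ < 1 / 2`, the half plane `Re s > σ` and its reflection cover the plane.
  have hne (s : ℂ) : H s ≠ 0 := by
    rcases lt_or_ge σ s.re with h | h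
    · exact hne_right h
    · intro h0
      have h1 := hfe s
      rw [h0, mul_zero, eq_comm, map_eq_zero] at h1
      exact mul_ne_zero (hpre _) (hne_right (by rw [hre]; linarith)) h1
  have habs : LSeries.abscissaOfAbsConv b ≤ σ := by simpa using hb.abscissaOfAbsConv_le
  have hDright {s : ℂ} (hs : σ < s.re) : deriv H s / H s = -LSeries (LSeries.logMul b) s := by
    have h1 := (LSeries_hasDerivAt (habs.trans_lt (EReal.coe_lt_coe_iff.2 hs))).cexp
    have h2 : H =ᶠ[𝓝 s] fun z ↦ exp (LSeries b z) := by
      filter_upwards [(isOpen_lt continuous_const continuous_re).mem_nhds hs] with z hz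
      exact hHb z hz
    rw [(h1.congr_of_eventuallyEq h2).deriv, hHb s hs, mul_div_cancel_left₀ _ (exp_ne_zero _)]
  have hlogsum : LSeriesSummable (LSeries.logMul b) ((1 / 2 : ℝ) : ℂ) :=
    LSeriesSummable_logMul_of_lt_re (habs.trans_lt (EReal.coe_lt_coe_iff.2 (by simpa using hσ)))
  set M := ∑' n, ‖LSeries.term (LSeries.logMul b) ((1 / 2 : ℝ) : ℂ) n‖ with hM
  have hM0 : 0 ≤ M := tsum_nonneg fun _ ↦ norm_nonneg _
  have hDbound {s : ℂ} (hs : 1 / 2 ≤ s.re) : ‖deriv H s / H s‖ ≤ M := by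
    rw [hDright (by linarith), norm_neg]
    exact norm_LSeries_le_of_re hlogsum hs
  set U : ℂ → ℂ := fun s ↦ ε * (Q : ℂ) ^ s * H s with hU
  have hUd (s : ℂ) : HasDerivAt U
      (U s * (Complex.log Q + deriv H s / H s)) s := by
    have h1 := ((hasDerivAt_id s).const_cpow (Or.inl hQ0)).const_mul ε
    refine (h1.mul (hH s).hasDerivAt).congr_deriv ?_
    simp only [hU, id, mul_one]
    field_simp [hne s]
  -- Logarithmic derivative of the functional equation.
  have hDrefl (s : ℂ) : Complex.log Q + deriv H s / H s =
      -conj (Complex.log Q + deriv H (1 - conj s) / H (1 - conj s)) := by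
    have h1 : HasDerivAt (fun z ↦ U (1 - z))
        (-(U (1 - conj s) * (Complex.log Q + deriv H (1 - conj s) / H (1 - conj s)))) (conj s) := by
      have := (hUd (1 - conj s)).comp (conj s) ((hasDerivAt_id (conj s)).const_sub 1)
      refine this.congr_deriv (by ring)
    have h2 := h1.conj_conj
    rw [conj_conj] at h2
    have h4 := (hUd s).unique (h2.congr_of_eventuallyEq (Eventually.of_forall fun z ↦ hfe z))
    have h5 : U s = conj (U (1 - conj s)) := hfe s
    rw [map_neg, map_mul, ← h5, neg_mul_eq_mul_neg] at h4
    exact mul_left_cancel₀ (mul_ne_zero (hpre s) (hne s)) h4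
  have hDd : Differentiable ℂ fun s ↦ deriv H s / H s := by
    have h1 : Differentiable ℂ (deriv H) := by
      rw [← differentiableOn_univ]
      exact hH.differentiableOn.deriv isOpen_univ
    exact h1.div hH hne
  have hbdd : Bornology.IsBounded (Set.range fun s ↦ deriv H s / H s) := by
    rw [isBounded_iff_forall_norm_le]
    refine ⟨2 * ‖Complex.log Q‖ + M, ?_⟩
    rintro _ ⟨s, rfl⟩
    rcases le_total (1 / 2) s.re with h | h
    · refine (hDbound h).trans ?_
      linarith [norm_nonneg (Complex.log Q)]
    · have h1 := hDbound (s := 1 - conj s) (by rw [hre]; linarith)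
      have h2 : deriv H s / H s = -conj (Complex.log Q + deriv H (1 - conj s) / H (1 - conj s))
          - Complex.log Q := by rw [← hDrefl s]; ring
      simp only
      rw [h2]
      refine (norm_sub_le _ _).trans ?_
      rw [norm_neg, RCLike.norm_conj]
      have := norm_add_le (Complex.log Q) (deriv H (1 - conj s) / H (1 - conj s))
      linarith
  -- By Liouville `H' / H` is constant; its limit along the positive real axis is the first
  -- coefficient `-(log 1) * b 1 = 0`.
  have hDzero (s : ℂ) : deriv H s / H s = 0 := by
    have h1 : Tendsto (fun x : ℝ ↦ deriv H x / H x) atTop (𝓝 (-(LSeries.logMul b 1))) := by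
      refine (tendsto_LSeries_atTop hlogsum).neg.congr' ?_
      filter_upwards [eventually_gt_atTop σ] with x hx
      exact (hDright (by simpa)).symm
    have h2 : Tendsto (fun x : ℝ ↦ deriv H x / H x) atTop (𝓝 (deriv H s / H s)) :=
      tendsto_const_nhds.congr fun x ↦ hDd.apply_eq_apply_of_bounded hbdd s x
    rw [tendsto_nhds_unique h2 h1]
    simp [LSeries.logMul]
  have hconst : ∀ x y, H x = H y := is_const_of_deriv_eq_zero hH fun s ↦
    (div_eq_zero_iff.1 (hDzero s)).resolve_right (hne s)
  have h1 : Tendsto (fun x : ℝ ↦ H x) atTop (𝓝 (exp (b 1))) := by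
    refine ((continuous_exp.tendsto _).comp (tendsto_LSeries_atTop hb)).congr' ?_
    filter_upwards [eventually_gt_atTop σ] with x hx
    exact (hHb x (by simpa)).symm
  have h2 : Tendsto (fun x : ℝ ↦ H x) atTop (𝓝 (H s)) :=
    tendsto_const_nhds.congr fun x ↦ hconst s x
  rw [tendsto_nhds_unique h2 h1, hb1, exp_zero]

/-- The only member of the Selberg class of very small degree is `1`. -/
theorem SelbergClass.same_one_of_small {F : ℂ → ℂ} (hF : SelbergClass F) {δ : ℝ}
    (hδ : HasHalfDegree F δ) (hsmall : δ ≤ 1 / 42) : Same F 1 := by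
  have hδ0 := hF.halfDegree_eq_zero_of_small hδ hsmall
  obtain ⟨a, ha, ha1, -⟩ := hF.2.2.2
  obtain ⟨b, θ, hθ, hpp, hO, hb⟩ := hF.2.2.1
  have hdecay := hF.exists_norm_coeff_le hδ hsmall ha
  obtain ⟨σ, hσ0, hσ, hsum⟩ := exists_LSeriesSummable_lt_half ha ha1 hθ hpp hO hb hdecay
  obtain ⟨ε, Q, k, w, μ, hε, hQ, hw, -, hfe, hw0⟩ := hδ
  obtain rfl : k = 0 := by
    by_contra hk
    have : 0 < ∑ i, w i :=
      Finset.sum_pos (fun i _ ↦ hw i) ⟨⟨0, Nat.pos_of_ne_zero hk⟩, Finset.mem_univ _⟩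
    rw [hw0, hδ0] at this
    exact lt_irrefl _ this
  -- Since `log F` converges near `1`, there is no pole; only the irrelevant value at `1` has to be
  -- corrected to make `F` entire.
  set H : ℂ → ℂ := Function.update F 1 (exp (LSeries b 1)) with hH
  have hHF {s : ℂ} (hs : s ≠ 1) : H s = F s := Function.update_of_ne hs _ _
  have hexpd {s : ℂ} (hs : σ < s.re) : DifferentiableAt ℂ (fun z ↦ exp (LSeries b z)) s :=
    (LSeries_differentiableAt_of_lt hsum hs).cexp
  have hHb (s : ℂ) (hs : σ < s.re) : H s = exp (LSeries b s) := by
    rcases eq_or_ne s 1 with rfl | hs1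
    · simp [hH]
    · rw [hHF hs1]
      exact hF.eq_of_differentiableOn (g := fun z ↦ exp (LSeries b z))
        (fun z hz ↦ (hexpd hz).differentiableWithinAt)
        (fun z hz ↦ (hb z hz).2.symm) hs hs1
  have hHd : Differentiable ℂ H := by
    intro s
    rcases eq_or_ne s 1 with rfl | hs1
    · have h1 : σ < (1 : ℂ).re := by rw [one_re]; linarith
      refine (hexpd h1).congr_of_eventuallyEq ?_
      filter_upwards [(isOpen_lt continuous_const continuous_re).mem_nhds h1] with z hz
      exact hHb z hz
    · refine (hF.differentiableAt hs1).congr_of_eventuallyEq ?_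
      filter_upwards [isOpen_ne.mem_nhds hs1] with z hz
      exact hHF hz
  have hQ0 : (Q : ℂ) ≠ 0 := by exact_mod_cast hQ.ne'
  have hfe' : (fun s ↦ ε * (Q : ℂ) ^ s * H s) =
      fun s ↦ conj (ε * (Q : ℂ) ^ (1 - conj s) * H (1 - conj s)) := by
    have hUc : Continuous fun s ↦ ε * (Q : ℂ) ^ s * H s :=
      (continuous_const.mul (continuous_id.const_cpow (Or.inl hQ0))).mul hHd.continuous
    -- The functional equation is given off `0` and `1`; it extends there by continuity.
    have hdense : Dense ({0, 1}ᶜ : Set ℂ) :=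
      (Set.toFinite {(0 : ℂ), 1}).countable.dense_compl ℂ
    refine hUc.ext_on hdense ?_ fun s hs ↦ ?_
    · exact continuous_conj.comp (hUc.comp (continuous_const.sub continuous_conj))
    · simp only [Set.mem_compl_iff, Set.mem_insert_iff, Set.mem_singleton_iff, not_or] at hs
      have := hfe s hs.1 hs.2 (fun i ↦ i.elim0) (fun i ↦ i.elim0)
      simp only [gammaFactor, Finset.univ_eq_empty, Finset.prod_empty, mul_one] at this
      simp only [hHF hs.2, hHF (one_sub_conj_ne_one hs.1)]
      exact this
  intro s hs
  rw [← hHF hs, Pi.one_apply]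
  exact eq_one_of_functional_equation hHd (hpp 1 not_isPrimePow_one) hσ hsum hHb
    (norm_pos_iff.1 (by rw [hε]; exact one_pos)) hQ (fun s ↦ congrFun hfe' s) s

end DegreeZero

/-! ### Existence of factorizations into primitive functions. -/

section Factorization

lemma IsPrimitive.same {F G : ℂ → ℂ} (hF : IsPrimitive F) (h : Same F G) : IsPrimitive G :=
  ⟨hF.1.same h, fun hG ↦ hF.2.1 (h.trans hG), fun F₁ F₂ h₁ h₂ hG ↦ hF.2.2 F₁ F₂ h₁ h₂ (h.trans hG)⟩

lemma selbergClass_list_prod {l : List (ℂ → ℂ)} (hl : ∀ P ∈ l, SelbergClass P) :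
    SelbergClass l.prod := by
  induction l with
  | nil => simpa using selbergClass_one
  | cons P l ih =>
    rw [List.prod_cons]
    exact (hl P (by simp)).mul (ih fun Q hQ ↦ hl Q (by simp [hQ]))

/-- Every member of the Selberg class is a product of primitive ones. -/
theorem SelbergClass.exists_factorization {F : ℂ → ℂ} (hF : SelbergClass F) :
    ∃ l : List (ℂ → ℂ), (∀ P ∈ l, IsPrimitive P) ∧ Same F l.prod := by
  obtain ⟨δ, hδ⟩ := hasFunctionalEquation_iff.1 hF.2.1
  obtain ⟨N, hN⟩ := exists_nat_ge (42 * δ)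
  induction N using Nat.strong_induction_on generalizing F δ with
  | _ N ih =>
    by_cases h1 : Same F 1
    · exact ⟨[], by simp, by simpa using h1⟩
    by_cases hp : IsPrimitive F
    · exact ⟨[F], by simpa, by simpa using Same.refl F⟩
    rw [IsPrimitive] at hp
    push Not at hp
    obtain ⟨F₁, F₂, hF₁, hF₂, hsame, hne₁, hne₂⟩ := hp hF h1
    obtain ⟨δ₁, hδ₁⟩ := hasFunctionalEquation_iff.1 hF₁.2.1
    obtain ⟨δ₂, hδ₂⟩ := hasFunctionalEquation_iff.1 hF₂.2.1
    have hsum : δ = δ₁ + δ₂ := hδ.unique hF ((hδ₁.mul hδ₂).same hsame.symm)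
    -- Each factor takes more than `1 / 42` of the half degree, so `42 δ` drops by more than `1` for
    -- the other one and the induction descends.
    have hlt₁ : 1 / 42 < δ₁ := not_le.1 fun h ↦ hne₁ (hF₁.same_one_of_small hδ₁ h)
    have hlt₂ : 1 / 42 < δ₂ := not_le.1 fun h ↦ hne₂ (hF₂.same_one_of_small hδ₂ h)
    have hN1 : (1 : ℝ) < N := by linarith
    have hN1' : 1 < N := by exact_mod_cast hN1
    have hcast : ((N - 1 : ℕ) : ℝ) = N - 1 := by push_cast [Nat.cast_sub hN1'.le]; rfl
    obtain ⟨l₁, hl₁, hs₁⟩ := ih (N - 1) (by omega) hF₁ δ₁ hδ₁ (by rw [hcast]; linarith)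
    obtain ⟨l₂, hl₂, hs₂⟩ := ih (N - 1) (by omega) hF₂ δ₂ hδ₂ (by rw [hcast]; linarith)
    refine ⟨l₁ ++ l₂, fun P hP ↦ ?_, ?_⟩
    · rcases List.mem_append.1 hP with h | h
      · exact hl₁ P h
      · exact hl₂ P h
    · rw [List.prod_append]
      exact hsame.trans (hs₁.mul hs₂)

end Factorization

/-! ### Sums over primes and the order at `s = 1`. -/

section PrimeSums

open Complex Topology

/-- The restriction of an arithmetic function to the primes. -/
noncomputable def primePart (a : ℕ → ℂ) (n : ℕ) : ℂ := if n.Prime then a n else 0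

lemma norm_primePart_le (a : ℕ → ℂ) (n : ℕ) : ‖primePart a n‖ ≤ ‖a n‖ := by
  unfold primePart
  split_ifs <;> simp

lemma lSeriesSummable_primePart {a : ℕ → ℂ} {s : ℂ} (h : LSeriesSummable a s) :
    LSeriesSummable (primePart a) s :=
  Summable.of_norm_bounded h.norm fun n ↦ LSeries.norm_term_le s (norm_primePart_le a n)

lemma primePart_congr {a a' : ℕ → ℂ} (h : ∀ p : ℕ, p.Prime → a p = a' p) :
    primePart a = primePart a' := by
  funext n
  unfold primePart
  split_ifs with hn
  · exact h n hn
  · rfl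

/-- Abel summation: a weighted sum with antitone nonnegative weights is controlled by the partial
sums. -/
lemma norm_sum_smul_le_of_antitone {d : ℕ → ℂ} {g : ℕ → ℝ} {M : ℝ} (hg : Antitone g)
    (hg0 : ∀ n, 0 ≤ g n) (hd : ∀ N, ‖∑ n ∈ Finset.range N, d n‖ ≤ M) (N : ℕ) :
    ‖∑ n ∈ Finset.range N, g n • d n‖ ≤ M * g 0 := by
  have hM : 0 ≤ M := by simpa using hd 0
  rcases N with _ | N
  · simp only [Finset.range_zero, Finset.sum_empty, norm_zero]
    exact mul_nonneg hM (hg0 0)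
  rw [Finset.sum_range_by_parts, Nat.add_sub_cancel]
  have h1 : ‖g N • ∑ n ∈ Finset.range (N + 1), d n‖ ≤ g N * M := by
    rw [norm_smul, Real.norm_eq_abs, abs_of_nonneg (hg0 N)]
    exact mul_le_mul_of_nonneg_left (hd _) (hg0 N)
  have h2 : ‖∑ i ∈ Finset.range N, (g (i + 1) - g i) • ∑ n ∈ Finset.range (i + 1), d n‖ ≤
      ∑ i ∈ Finset.range N, (g i - g (i + 1)) * M := by
    refine norm_sum_le_of_le _ fun i _ ↦ ?_
    have := hg (Nat.le_succ i)
    rw [norm_smul, Real.norm_eq_abs, abs_of_nonpos (by linarith), neg_sub]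
    exact mul_le_mul_of_nonneg_left (hd _) (by linarith)
  rw [← Finset.sum_mul, Finset.sum_range_sub'] at h2
  refine (norm_sub_le _ _).trans ((add_le_add h1 h2).trans (le_of_eq (by ring)))

lemma primeSum_natCast (f : ℕ → ℂ) (N : ℕ) :
    primeSum f N = ∑ n ∈ Finset.range N, primePart f (n + 1) := by
  rw [primeSum, Nat.floor_natCast, Finset.sum_filter, Finset.range_eq_Ico,
    Finset.sum_Ico_add' (fun n ↦ primePart f n) 0 N 1, zero_add]
  rfl

/-- Bounded prime sums give Dirichlet series over primes bounded near `s = 1`. -/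
lemma isBigO_LSeries_primePart {c : ℕ → ℂ} (hc : ∀ s : ℂ, 1 < s.re → LSeriesSummable c s)
    (h : (fun x : ℝ ↦ primeSum (fun p ↦ c p / p) x) =O[atTop] fun _ ↦ (1 : ℝ)) :
    (fun x : ℝ ↦ LSeries (primePart c) x) =O[𝓝[>] 1] fun _ ↦ (1 : ℝ) := by
  have h1 : (fun N : ℕ ↦ primeSum (fun p ↦ c p / p) N) =O[atTop] fun _ ↦ (1 : ℝ) :=
    h.comp_tendsto tendsto_natCast_atTop_atTop
  obtain ⟨M, -, hM⟩ := bound_of_isBigO_nat_atTop h1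
  refine IsBigO.of_bound M ?_
  filter_upwards [self_mem_nhdsWithin] with x hx
  have hx : 1 < x := hx
  have hsum : LSeriesSummable (primePart c) x := lSeriesSummable_primePart (hc x (by simpa))
  set d : ℕ → ℂ := fun n ↦ primePart (fun p ↦ c p / p) (n + 1) with hd
  -- These weights decrease from `g 0 = 1` for every `x > 1`, so the Abel bound is uniform in `x`.
  set g : ℕ → ℝ := fun n ↦ ((n + 1 : ℕ) : ℝ) ^ (-(x - 1)) with hg
  have hgd (n : ℕ) : LSeries.term (primePart c) x (n + 1) = g n • d n := by
    have hn : ((n + 1 : ℕ) : ℂ) ≠ 0 := Nat.cast_ne_zero.2 (by omega)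
    rw [LSeries.term_of_ne_zero (by omega), hd, hg]
    simp only [primePart]
    split_ifs with hp
    · have hr : (((n + 1 : ℕ) : ℝ) ^ (-(x - 1)) : ℝ) = ((n + 1 : ℕ) : ℂ) ^ (-((x : ℂ) - 1)) := by
        rw [Complex.ofReal_cpow (by positivity)]
        push_cast
        rfl
      rw [Complex.real_smul, hr, show -((x : ℂ) - 1) = 1 - x by ring, cpow_sub _ _ hn, cpow_one]
      have hx0 : ((n + 1 : ℕ) : ℂ) ^ (x : ℂ) ≠ 0 := by
        rw [Ne, cpow_eq_zero_iff]; exact fun h ↦ hn h.1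
      field_simp
    · simp
  have hanti : Antitone g := fun m n hmn ↦
    Real.rpow_le_rpow_of_nonpos (by positivity) (by exact_mod_cast Nat.succ_le_succ hmn)
      (by linarith)
  have hlim : Tendsto (fun N ↦ ∑ n ∈ Finset.range N, g n • d n) atTop
      (𝓝 (LSeries (primePart c) x)) := by
    have h2 := hsum.LSeriesHasSum.tendsto_sum_nat.comp (tendsto_add_atTop_nat 1)
    refine h2.congr fun N ↦ ?_
    simp only [Function.comp]
    rw [Finset.sum_range_succ', LSeries.term_zero, add_zero]
    exact Finset.sum_congr rfl fun n _ ↦ hgd n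
  have hbd (N : ℕ) : ‖∑ n ∈ Finset.range N, g n • d n‖ ≤ M * ‖(1 : ℝ)‖ := by
    refine (norm_sum_smul_le_of_antitone hanti (fun n ↦ by positivity) (M := M) (fun N ↦ ?_) N).trans
      (le_of_eq (by simp [hg]))
    rw [hd, ← primeSum_natCast]
    simpa using hM (x := N) one_ne_zero
  exact le_of_tendsto hlim.norm (Eventually.of_forall hbd)

/-- `Re ∑ a p / p ^ x = r * log (1 / (x - 1)) + O(1)` as `x → 1⁺`; for the coefficients of a
function of the Selberg class, `r` is the order of its pole at `1`. -/
def HasPoleExponent (a : ℕ → ℂ) (r : ℤ) : Prop :=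
  (fun x : ℝ ↦ (LSeries (primePart a) x).re + r * Real.log (x - 1)) =O[𝓝[>] 1] fun _ ↦ (1 : ℝ)

lemma tendsto_log_sub_one : Tendsto (fun x : ℝ ↦ Real.log (x - 1)) (𝓝[>] 1) atBot := by
  refine Real.tendsto_log_nhdsGT_zero.comp (tendsto_nhdsWithin_iff.2 ⟨?_, ?_⟩)
  · have : Tendsto (fun x : ℝ ↦ x - 1) (𝓝 1) (𝓝 (1 - 1)) := tendsto_id.sub_const 1
    rw [sub_self] at this
    exact this.mono_left nhdsWithin_le_nhds
  · filter_upwards [self_mem_nhdsWithin] with x hx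
    have hx : (1 : ℝ) < x := hx
    exact sub_pos.2 hx

lemma eq_zero_of_isBigO_mul_log {r : ℝ}
    (h : (fun x : ℝ ↦ r * Real.log (x - 1)) =O[𝓝[>] 1] fun _ ↦ (1 : ℝ)) : r = 0 := by
  by_contra hr
  have h1 : (fun x : ℝ ↦ Real.log (x - 1)) =O[𝓝[>] 1] fun _ ↦ (1 : ℝ) := by
    have := h.const_mul_left r⁻¹
    simpa [inv_mul_cancel_left₀ hr] using this
  obtain ⟨C, hC⟩ := h1.bound
  obtain ⟨x, hx1, hx2⟩ := (hC.and (tendsto_log_sub_one.eventually_lt_atBot (-|C|))).exists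
  rw [Real.norm_eq_abs, norm_one, mul_one] at hx1
  have := neg_abs_le (Real.log (x - 1))
  have := le_abs_self C
  linarith

/-- The contribution of the higher prime powers to `log F` is bounded near `s = 1`. -/
lemma LSeriesSummable_sub_primePart {b : ℕ → ℂ} {θ : ℝ} (hθ : θ < 1 / 2)
    (hpp : ∀ n, ¬ IsPrimePow n → b n = 0) (hO : b =O[atTop] fun n : ℕ ↦ (n : ℝ) ^ θ) :
    LSeriesSummable (b - primePart b) (1 : ℝ) := by
  set θ' := max θ 0 with hθ'
  have hθ'1 : θ' < 1 / 2 := max_lt hθ (by norm_num)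
  -- After division by `p ^ k` the coefficient at `p ^ k` is `O(p ^ (-ν k))`; for `k ≥ 2` this is
  -- summable over primes exactly because `2 ν > 1`, i.e. `θ' < 1 / 2`.
  set ν := 1 - θ' with hν
  obtain ⟨B, hB, hbB⟩ := exists_norm_le_of_isBigO_rpow (isBigO_rpow_of_le hO (le_max_left θ 0))
  set r : ℝ := 2 ^ (-ν) with hr
  have hr0 : 0 < r := by positivity
  have hr1 : r < 1 := Real.rpow_lt_one_of_one_lt_of_neg one_lt_two (by linarith)
  have hz (n : ℕ) (hn : ¬ IsPrimePow n) : (b - primePart b) n = 0 := by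
    have h1 : ¬ n.Prime := fun h ↦ hn h.isPrimePow
    simp [primePart, hpp n hn]
  refine summable_of_prime_pow_bound (term_eq_zero_of_not_isPrimePow hz _) (x := 2 * ν)
    (by linarith) hr0.le hr1 (M := B / r) fun p hp k ↦ ?_
  have hp0 : (0 : ℝ) < p := by exact_mod_cast hp.pos
  have hp2 : (2 : ℝ) ≤ p := by exact_mod_cast hp.two_le
  have hpk : p ^ (k + 1) ≠ 0 := pow_ne_zero _ hp.ne_zero
  have hpk0 : (0 : ℝ) < ((p ^ (k + 1) : ℕ) : ℝ) := by positivity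
  rw [LSeries.norm_term_eq, if_neg hpk, ofReal_re]
  rcases k with _ | k
  · have : (b - primePart b) (p ^ (0 + 1)) = 0 := by simp [primePart, hp]
    rw [this, norm_zero, zero_div]
    positivity
  · have h0 : ¬ (p ^ (k + 1 + 1)).Prime := Nat.Prime.not_prime_pow (by omega)
    have h1 : ‖(b - primePart b) (p ^ (k + 1 + 1))‖ ≤ B * ((p ^ (k + 1 + 1) : ℕ) : ℝ) ^ θ' := by
      simpa [primePart, h0] using hbB _ hpk
    have h2 : ((p ^ (k + 1 + 1) : ℕ) : ℝ) ^ θ' / ((p ^ (k + 1 + 1) : ℕ) : ℝ) ^ (1 : ℝ) =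
        (p : ℝ) ^ (-(2 * ν)) * ((p : ℝ) ^ (-ν)) ^ k := by
      rw [← Real.rpow_sub hpk0]
      push_cast
      rw [← Real.rpow_natCast, ← Real.rpow_natCast, ← Real.rpow_mul hp0.le,
        ← Real.rpow_mul hp0.le, ← Real.rpow_add hp0]
      congr 1
      push_cast
      ring
    have h3 : (p : ℝ) ^ (-ν) ≤ r := Real.rpow_le_rpow_of_nonpos two_pos hp2 (by linarith)
    calc _ ≤ B * ((p ^ (k + 1 + 1) : ℕ) : ℝ) ^ θ' / ((p ^ (k + 1 + 1) : ℕ) : ℝ) ^ (1 : ℝ) := by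
          gcongr
      _ = B * ((p : ℝ) ^ (-(2 * ν)) * ((p : ℝ) ^ (-ν)) ^ k) := by rw [mul_div_assoc, h2]
      _ ≤ B * ((p : ℝ) ^ (-(2 * ν)) * r ^ k) := by gcongr
      _ = _ := by field_simp; ring

lemma SelbergClass.meromorphicAt {F : ℂ → ℂ} (hF : SelbergClass F) : MeromorphicAt F 1 := by
  obtain ⟨⟨m, E, hE, -, hEF⟩, -⟩ := hF
  have h1 : MeromorphicAt (fun z ↦ E z / (z - 1) ^ m) 1 :=
    (hE.analyticAt 1).meromorphicAt.div (by fun_prop)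
  refine h1.congr ?_
  filter_upwards [self_mem_nhdsWithin] with z hz
  rw [hEF z hz, mul_div_cancel_left₀ _ (pow_ne_zero _ (sub_ne_zero.2 hz))]

lemma tendsto_ofReal_nhdsGT : Tendsto (fun x : ℝ ↦ (x : ℂ)) (𝓝[>] 1) (𝓝[≠] 1) := by
  refine tendsto_nhdsWithin_iff.2 ⟨?_, ?_⟩
  · exact (continuous_ofReal.tendsto' 1 1 (by simp)).mono_left nhdsWithin_le_nhds
  · filter_upwards [self_mem_nhdsWithin] with x hx
    have hx : (1 : ℝ) < x := hx
    simp only [Set.mem_compl_iff, Set.mem_singleton_iff]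
    exact_mod_cast hx.ne'

/-- `F` is an exponential on `Re s > 1`, so it has no zeros on the real axis to the right of `1`. -/
lemma SelbergClass.meromorphicOrderAt_ne_top {F : ℂ → ℂ} (hF : SelbergClass F) :
    meromorphicOrderAt F 1 ≠ ⊤ := by
  rw [Ne, meromorphicOrderAt_eq_top_iff]
  intro h
  obtain ⟨x, hx1, hx2⟩ := ((tendsto_ofReal_nhdsGT.eventually h).and self_mem_nhdsWithin).exists
  exact hF.2.2.1.ne_zero (by simpa using hx2) hx1

/-- The pole order at `1` is read off from the coefficients at the primes. -/
lemma SelbergClass.hasPoleExponent {F : ℂ → ℂ} (hF : SelbergClass F) {a : ℕ → ℂ}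
    (ha : HasDirichletSeries F a) (ha1 : a 1 = 1) {r : ℤ}
    (hr : meromorphicOrderAt F 1 = ((-r : ℤ) : WithTop ℤ)) : HasPoleExponent a r := by
  obtain ⟨g, hg, hg1, hFg⟩ := (meromorphicOrderAt_eq_int_iff hF.meromorphicAt).1 hr
  obtain ⟨b, θ, hθ, hpp, hO, hb⟩ := hF.2.2.1
  have hrest := LSeriesSummable_sub_primePart hθ hpp hO
  have hab : primePart b = primePart a := primePart_congr fun p hp ↦ euler_coeff_prime ha ha1 hb hp
  have hlogg : ContinuousAt (fun x : ℝ ↦ Real.log ‖g x‖) 1 := by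
    have h1 : ContinuousAt (fun x : ℝ ↦ g x) 1 :=
      ContinuousAt.comp (f := fun x : ℝ ↦ (x : ℂ)) (by simpa using hg.continuousAt)
        continuous_ofReal.continuousAt
    exact h1.norm.log (by simpa using hg1)
  have hO1 : (fun x : ℝ ↦ Real.log ‖g x‖) =O[𝓝[>] 1] fun _ ↦ (1 : ℝ) :=
    (hlogg.tendsto.mono_left nhdsWithin_le_nhds).isBigO_one ℝ
  have hO2 : (fun x : ℝ ↦ (LSeries (b - primePart b) x).re) =O[𝓝[>] 1] fun _ ↦ (1 : ℝ) := by
    refine IsBigO.of_bound (∑' n, ‖LSeries.term (b - primePart b) (1 : ℝ) n‖) ?_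
    filter_upwards [self_mem_nhdsWithin] with x hx
    have hx : (1 : ℝ) < x := hx
    rw [norm_one, mul_one]
    exact (abs_re_le_norm _).trans (norm_LSeries_le_of_re hrest (by simpa using hx.le))
  refine (hO1.sub hO2).congr' ?_ EventuallyEq.rfl
  filter_upwards [self_mem_nhdsWithin, tendsto_ofReal_nhdsGT.eventually hFg,
    tendsto_ofReal_nhdsGT.eventually ((hg.continuousAt.eventually_ne hg1).filter_mono
      nhdsWithin_le_nhds)] with x hx hFx hgx
  have hx : (1 : ℝ) < x := hx
  have hxc : 1 < (x : ℂ).re := by simpa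
  have h1 : Real.log ‖F x‖ = (LSeries b x).re := by
    rw [← (hb x hxc).2, norm_exp, Real.log_exp]
  have h2 : LSeries b x = LSeries (primePart a) x + LSeries (b - primePart b) x := by
    rw [LSeries_sub (hb x hxc).1 (lSeriesSummable_primePart (hb x hxc).1), hab]
    ring
  -- `log |F x|` is computed twice: from the local form at `1`, and as the real part of the
  -- logarithm series, whose part over proper prime powers stays bounded.
  have h3 : Real.log ‖F x‖ = -r * Real.log (x - 1) + Real.log ‖g x‖ := by
    have h4 : ‖(x : ℂ) - 1‖ = x - 1 := by
      rw [show (x : ℂ) - 1 = ((x - 1 : ℝ) : ℂ) by push_cast; rfl, norm_real, Real.norm_eq_abs,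
        abs_of_pos (by linarith)]
    have h5 : 0 < x - 1 := by linarith
    rw [hFx, norm_smul, norm_zpow, h4, Real.log_mul (zpow_ne_zero _ h5.ne') (norm_ne_zero_iff.2 hgx),
      Real.log_zpow]
    push_cast
    ring
  rw [h1, h2, add_re] at h3
  linarith

lemma meromorphicOrderAt_riemannZeta :
    meromorphicOrderAt riemannZeta 1 = ((-1 : ℤ) : WithTop ℤ) := by
  rw [meromorphicOrderAt_eq_int_iff selbergClass_riemannZeta.meromorphicAt]
  refine ⟨riemannZeta₁, differentiable_riemannZeta₁.analyticAt 1, by simp, ?_⟩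
  filter_upwards [self_mem_nhdsWithin] with z hz
  rw [riemannZeta_eq_inv_sub_mul hz, zpow_neg_one, smul_eq_mul]

lemma hasPoleExponent_riemannZeta : HasPoleExponent 1 1 :=
  selbergClass_riemannZeta.hasPoleExponent hasDirichletSeries_riemannZeta rfl
    meromorphicOrderAt_riemannZeta

lemma HasDirichletSeries.coeff_unique {F : ℂ → ℂ} {a a' : ℕ → ℂ} (h : HasDirichletSeries F a)
    (h' : HasDirichletSeries F a') {n : ℕ} (hn : n ≠ 0) : a n = a' n := by
  have h1 : (1 : EReal) < ⊤ := EReal.coe_lt_top 1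
  refine LSeries.eq_of_LSeries_eventually_eq
    ((abscissaOfAbsConv_le_one fun s hs ↦ (h s hs).LSeriesSummable).trans_lt h1)
    ((abscissaOfAbsConv_le_one fun s hs ↦ (h' s hs).LSeriesSummable).trans_lt h1) ?_ hn
  filter_upwards [eventually_gt_atTop 1] with x hx
  rw [← h.eq_LSeries (by simpa), ← h'.eq_LSeries (by simpa)]

end PrimeSums

/-! ### Canonical coefficients and pole orders of products. -/

section Coefficients

open Complex Topology

open Classical in
/-- The Dirichlet coefficients of `F`, normalised to have first coefficient `1`. -/
noncomputable def coeff (F : ℂ → ℂ) : ℕ → ℂ :=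
  if h : ∃ a : ℕ → ℂ, HasDirichletSeries F a ∧ a 1 = 1 then h.choose else 0

lemma SelbergClass.coeff_spec {F : ℂ → ℂ} (hF : SelbergClass F) :
    HasDirichletSeries F (coeff F) ∧ coeff F 1 = 1 := by
  obtain ⟨a, ha, ha1, -⟩ := hF.2.2.2
  have h : ∃ a : ℕ → ℂ, HasDirichletSeries F a ∧ a 1 = 1 := ⟨a, ha, ha1⟩
  rw [coeff, dif_pos h]
  exact h.choose_spec

lemma SelbergClass.hasDirichletSeries_coeff {F : ℂ → ℂ} (hF : SelbergClass F) :
    HasDirichletSeries F (coeff F) := hF.coeff_spec.1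

lemma SelbergClass.coeff_one {F : ℂ → ℂ} (hF : SelbergClass F) : coeff F 1 = 1 := hF.coeff_spec.2

lemma SelbergClass.coeff_same {F G : ℂ → ℂ} (hF : SelbergClass F) (h : Same F G) {n : ℕ}
    (hn : n ≠ 0) : coeff F n = coeff G n :=
  (hF.hasDirichletSeries_coeff.same h).coeff_unique (hF.same h).hasDirichletSeries_coeff hn

lemma coeff_riemannZeta {n : ℕ} (hn : n ≠ 0) : coeff riemannZeta n = 1 :=
  selbergClass_riemannZeta.hasDirichletSeries_coeff.coeff_unique hasDirichletSeries_riemannZeta hn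

lemma SelbergClass.coeff_mul_prime {F G : ℂ → ℂ} (hF : SelbergClass F) (hG : SelbergClass G)
    {p : ℕ} (hp : p.Prime) : coeff (F * G) p = coeff F p + coeff G p := by
  rw [(hF.mul hG).hasDirichletSeries_coeff.coeff_unique
    (hF.hasDirichletSeries_coeff.mul hG.hasDirichletSeries_coeff) hp.ne_zero,
    convolution_prime hp, hF.coeff_one, hG.coeff_one]
  ring

lemma coeff_list_prod_prime {l : List (ℂ → ℂ)} (hl : ∀ P ∈ l, SelbergClass P) {p : ℕ}
    (hp : p.Prime) : coeff l.prod p = (l.map fun P ↦ coeff P p).sum := by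
  induction l with
  | nil =>
    have h := selbergClass_one.coeff_mul_prime selbergClass_one hp
    rw [mul_one] at h
    simpa using h
  | cons P l ih =>
    have hl' : ∀ Q ∈ l, SelbergClass Q := fun Q hQ ↦ hl Q (by simp [hQ])
    rw [List.prod_cons, (hl P (by simp)).coeff_mul_prime (selbergClass_list_prod hl') hp, ih hl',
      List.map_cons, List.sum_cons]

/-- The order of the pole at `s = 1`. -/
noncomputable def poleOrder (F : ℂ → ℂ) : ℤ := -(meromorphicOrderAt F 1).untop₀

lemma SelbergClass.meromorphicOrderAt_eq {F : ℂ → ℂ} (hF : SelbergClass F) :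
    meromorphicOrderAt F 1 = ((-poleOrder F : ℤ) : WithTop ℤ) := by
  rw [poleOrder, neg_neg, WithTop.coe_untop₀_of_ne_top hF.meromorphicOrderAt_ne_top]

lemma Same.poleOrder_eq {F G : ℂ → ℂ} (h : Same F G) : poleOrder F = poleOrder G := by
  rw [poleOrder, poleOrder, meromorphicOrderAt_congr]
  filter_upwards [self_mem_nhdsWithin] with z hz using h z hz

lemma poleOrder_riemannZeta : poleOrder riemannZeta = 1 := by
  rw [poleOrder, meromorphicOrderAt_riemannZeta]
  rfl

lemma SelbergClass.poleOrder_mul {F G : ℂ → ℂ} (hF : SelbergClass F) (hG : SelbergClass G) :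
    poleOrder (F * G) = poleOrder F + poleOrder G := by
  rw [poleOrder, meromorphicOrderAt_mul hF.meromorphicAt hG.meromorphicAt,
    hF.meromorphicOrderAt_eq, hG.meromorphicOrderAt_eq, ← WithTop.coe_add, WithTop.untop₀_coe]
  ring

lemma poleOrder_list_prod {l : List (ℂ → ℂ)} (hl : ∀ P ∈ l, SelbergClass P) :
    poleOrder l.prod = (l.map poleOrder).sum := by
  induction l with
  | nil =>
    have h := selbergClass_one.poleOrder_mul selbergClass_one
    rw [mul_one] at h
    simpa using h
  | cons P l ih =>
    have hl' : ∀ Q ∈ l, SelbergClass Q := fun Q hQ ↦ hl Q (by simp [hQ])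
    rw [List.prod_cons, (hl P (by simp)).poleOrder_mul (selbergClass_list_prod hl'), ih hl',
      List.map_cons, List.sum_cons]

end Coefficients

/-! ### Correlations of coefficients over primes. -/

section Correlation

open Complex Topology

lemma primeSum_congr {f g : ℕ → ℂ} (h : ∀ p : ℕ, p.Prime → f p = g p) (x : ℝ) :
    primeSum f x = primeSum g x :=
  Finset.sum_congr rfl fun p hp ↦ h p (Finset.mem_filter.1 hp).2

/-- `∑_{p ≤ x} a p * conj (a' p) / p = n * log log x + O(1)` as `x → ∞`. -/
def HasCorrelation (a a' : ℕ → ℂ) (n : ℤ) : Prop :=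
  (fun x : ℝ ↦ primeSum (fun p ↦ a p * conj (a' p) / p) x
    - ((n * Real.log (Real.log x) : ℝ) : ℂ)) =O[atTop] fun _ ↦ (1 : ℝ)

lemma HasCorrelation.congr {a a' b b' : ℕ → ℂ} {n : ℤ} (h : HasCorrelation a a' n)
    (hb : ∀ p : ℕ, p.Prime → a p = b p) (hb' : ∀ p : ℕ, p.Prime → a' p = b' p) :
    HasCorrelation b b' n := by
  refine IsBigO.congr_left h fun x ↦ ?_
  rw [primeSum_congr fun p hp ↦ ?_]
  rw [hb p hp, hb' p hp]

lemma HasCorrelation.symm {a a' : ℕ → ℂ} {n : ℤ} (h : HasCorrelation a a' n) :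
    HasCorrelation a' a n := by
  refine IsBigO.congr_left (IsBigO.norm_left h) (fun x ↦ ?_) |>.of_norm_left
  rw [← RCLike.norm_conj, map_sub, conj_ofReal, primeSum, map_sum, primeSum]
  simp only [map_div₀, map_mul, conj_conj, map_natCast, mul_comm]

lemma hasCorrelation_zero_right (a : ℕ → ℂ) : HasCorrelation a 0 0 := by
  unfold HasCorrelation primeSum
  simp only [Pi.zero_apply, map_zero, mul_zero, zero_div, Finset.sum_const_zero, Int.cast_zero,
    zero_mul, ofReal_zero, sub_zero]
  exact isBigO_zero _ _

lemma HasCorrelation.add_right {a b c : ℕ → ℂ} {m n : ℤ} (h : HasCorrelation a b m)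
    (h' : HasCorrelation a c n) : HasCorrelation a (b + c) (m + n) := by
  refine IsBigO.congr_left (IsBigO.add h h') fun x ↦ ?_
  simp only [primeSum, Pi.add_apply, map_add, mul_add, add_div, Finset.sum_add_distrib]
  push_cast
  ring

/-- Correlation is additive in the coefficients at primes, and these add up over a product. -/
lemma HasCorrelation.list_prod_right {a : ℕ → ℂ} {e : (ℂ → ℂ) → ℤ} {l : List (ℂ → ℂ)}
    (hl : ∀ P ∈ l, SelbergClass P) (h : ∀ P ∈ l, HasCorrelation a (coeff P) (e P)) :
    HasCorrelation a (coeff l.prod) (l.map e).sum := by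
  suffices HasCorrelation a (fun p ↦ (l.map fun P ↦ coeff P p).sum) (l.map e).sum from
    this.congr (fun _ _ ↦ rfl) fun p hp ↦ (coeff_list_prod_prime hl hp).symm
  clear hl
  induction l with
  | nil => exact hasCorrelation_zero_right a
  | cons P l ih =>
    simp only [List.map_cons, List.sum_cons]
    exact (h P (by simp)).add_right (ih fun Q hQ ↦ h Q (by simp [hQ]))

/-- The correlations with `ζ` determine the order of the pole. -/
lemma SelbergClass.mul_poleOrder_eq {F : ℂ → ℂ} (hF : SelbergClass F) {e n : ℤ}
    (he : HasCorrelation (coeff F) 1 e) (hn : HasCorrelation 1 1 n) : n * poleOrder F = e := by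
  -- The combination in which the `log log x` terms cancel. Its prime series is then bounded near
  -- `1`, so the coefficient `n * poleOrder F - e` of `log (x - 1)` vanishes.
  set c : ℕ → ℂ := (n : ℂ) • coeff F - (e : ℂ) • 1 with hc
  have hsF (s : ℂ) (hs : 1 < s.re) : LSeriesSummable ((n : ℂ) • coeff F) s :=
    (hF.hasDirichletSeries_coeff s hs).LSeriesSummable.smul n
  have hsζ (s : ℂ) (hs : 1 < s.re) : LSeriesSummable ((e : ℂ) • (1 : ℕ → ℂ)) s :=
    (hasDirichletSeries_riemannZeta s hs).LSeriesSummable.smul e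
  have hbdd : (fun x : ℝ ↦ primeSum (fun p ↦ c p / p) x) =O[atTop] fun _ ↦ (1 : ℝ) := by
    refine ((IsBigO.const_mul_left he (n : ℂ)).sub (IsBigO.const_mul_left hn (e : ℂ))).congr_left
      fun x ↦ ?_
    simp only [primeSum, hc, Pi.sub_apply, Pi.smul_apply, Pi.one_apply, smul_eq_mul, map_one,
      div_eq_mul_inv, sub_mul, Finset.sum_sub_distrib, mul_one, mul_assoc, mul_sub, ← Finset.mul_sum]
    push_cast
    ring
  have hL := isBigO_LSeries_primePart (fun s hs ↦ (hsF s hs).sub (hsζ s hs)) hbdd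
  have hre : (fun x : ℝ ↦ (LSeries (primePart c) x).re) =O[𝓝[>] 1] fun _ ↦ (1 : ℝ) :=
    (IsBigO.of_bound 1 (Eventually.of_forall fun x ↦ by
      rw [one_mul]; exact abs_re_le_norm _)).trans hL
  have hpF := hF.hasPoleExponent hF.hasDirichletSeries_coeff hF.coeff_one hF.meromorphicOrderAt_eq
  have hpζ := hasPoleExponent_riemannZeta
  have key : ((n * poleOrder F - e : ℤ) : ℝ) = 0 := by
    refine eq_zero_of_isBigO_mul_log ?_
    refine (((IsBigO.const_mul_left hpF (n : ℝ)).sub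
      (IsBigO.const_mul_left hpζ (e : ℝ))).sub hre).congr' ?_ EventuallyEq.rfl
    filter_upwards [self_mem_nhdsWithin] with x hx
    have hx : 1 < (x : ℂ).re := by simpa using hx
    have hp : primePart c = (n : ℂ) • primePart (coeff F) - (e : ℂ) • primePart 1 := by
      funext k
      simp only [primePart, hc, Pi.sub_apply, Pi.smul_apply]
      split_ifs <;> simp
    have hs1 := lSeriesSummable_primePart (hF.hasDirichletSeries_coeff x hx).LSeriesSummable
    have hs2 := lSeriesSummable_primePart (hasDirichletSeries_riemannZeta x hx).LSeriesSummable
    rw [hp, LSeries_sub (hs1.smul _) (hs2.smul _), LSeries_smul, LSeries_smul]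
    simp only [sub_re, mul_re, intCast_re, intCast_im, zero_mul, sub_zero]
    push_cast
    ring
  have : n * poleOrder F - e = 0 := by exact_mod_cast key
  linarith

end Correlation

/-! ### Primitivity of `ζ` and splitting it off. -/

section Zeta

/-- Equal primitive functions are correlated. -/
lemma Conjectures.hasCorrelation_one (hS : Conjectures) {P Q : ℂ → ℂ} (hP : IsPrimitive P)
    (h : Same P Q) : HasCorrelation (coeff P) (coeff Q) 1 := by
  have h1 := hS.normality P (coeff P) hP hP.1.hasDirichletSeries_coeff
  refine IsBigO.congr_left h1 fun x ↦ ?_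
  rw [primeSum_congr fun p hp ↦ ?_]
  rw [← hP.1.coeff_same h hp.ne_zero, Complex.mul_conj']

/-- Distinct primitive functions are uncorrelated. -/
lemma Conjectures.hasCorrelation_zero (hS : Conjectures) {P Q : ℂ → ℂ} (hP : IsPrimitive P)
    (hQ : IsPrimitive Q) (h : ¬ Same P Q) : HasCorrelation (coeff P) (coeff Q) 0 := by
  have h1 := hS.orthogonality P Q _ _ hP hQ h hP.1.hasDirichletSeries_coeff
    hQ.1.hasDirichletSeries_coeff
  refine IsBigO.congr_left h1 fun x ↦ ?_
  simp

/-- Under Selberg's conjectures, `ζ` is primitive. -/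
theorem Conjectures.isPrimitive_riemannZeta (hS : Conjectures) : IsPrimitive riemannZeta := by
  classical
  obtain ⟨l, hl, hζ⟩ := selbergClass_riemannZeta.exists_factorization
  have hlS : ∀ P ∈ l, SelbergClass P := fun P hP ↦ (hl P hP).1
  have hone {p : ℕ} (hp : p.Prime) : coeff l.prod p = (1 : ℕ → ℂ) p := by
    rw [← selbergClass_riemannZeta.coeff_same hζ hp.ne_zero, coeff_riemannZeta hp.ne_zero]
    rfl
  set e : (ℂ → ℂ) → (ℂ → ℂ) → ℤ := fun P Q ↦ if Same P Q then 1 else 0 with he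
  have he0 (P Q : ℂ → ℂ) : 0 ≤ e P Q := by
    simp only [he]
    split_ifs <;> simp
  have hcorr {P Q : ℂ → ℂ} (hP : IsPrimitive P) (hQ : IsPrimitive Q) :
      HasCorrelation (coeff P) (coeff Q) (e P Q) := by
    simp only [he]
    split_ifs with h
    · exact hS.hasCorrelation_one hP h
    · exact hS.hasCorrelation_zero hP hQ h
  have h1 {P : ℂ → ℂ} (hP : P ∈ l) : HasCorrelation (coeff P) 1 (l.map (e P)).sum :=
    (HasCorrelation.list_prod_right hlS fun Q hQ ↦ hcorr (hl P hP) (hl Q hQ)).congr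
      (fun _ _ ↦ rfl) fun p hp ↦ hone hp
  -- The self-correlation of `ζ` is expanded over pairs of factors; only `n ≥ 0` is needed, not its
  -- value.
  set n : ℤ := (l.map fun P ↦ (l.map (e P)).sum).sum with hn
  have h2 : HasCorrelation 1 1 n :=
    (HasCorrelation.list_prod_right hlS fun P hP ↦ (h1 hP).symm).congr
      (fun _ _ ↦ rfl) fun p hp ↦ hone hp
  have hrow0 (P : ℂ → ℂ) : 0 ≤ (l.map (e P)).sum :=
    List.sum_nonneg fun x hx ↦ by
      obtain ⟨Q, -, rfl⟩ := List.mem_map.1 hx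
      exact he0 P Q
  -- `P` occurs in the list and is correlated with itself; the remaining entries are nonnegative.
  have hrow {P : ℂ → ℂ} (hP : P ∈ l) : 1 ≤ (l.map (e P)).sum := by
    refine le_trans (by simp [he, Same.refl]) (List.single_le_sum (fun x hx ↦ ?_) (e P P)
      (List.mem_map_of_mem hP))
    obtain ⟨Q, -, rfl⟩ := List.mem_map.1 hx
    exact he0 P Q
  have hn0 : 0 ≤ n := List.sum_nonneg fun x hx ↦ by
    obtain ⟨Q, -, rfl⟩ := List.mem_map.1 hx
    exact hrow0 Q
  have hpole : (l.map poleOrder).sum = 1 := by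
    rw [← poleOrder_list_prod hlS, ← hζ.poleOrder_eq, poleOrder_riemannZeta]
  -- Every factor has a pole, while the orders add up to `1`; so there is only one factor.
  have hpos {P : ℂ → ℂ} (hP : P ∈ l) : 1 ≤ poleOrder P := by
    have h3 := (hlS P hP).mul_poleOrder_eq (h1 hP) h2
    have h4 : 0 < n * poleOrder P := by rw [h3]; exact hrow hP
    exact pos_of_mul_pos_right h4 hn0
  have hlen : l.length ≤ 1 := by
    have h3 := List.card_nsmul_le_sum (l.map poleOrder) 1 fun x hx ↦ by
      obtain ⟨P, hP, rfl⟩ := List.mem_map.1 hx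
      exact hpos hP
    rw [hpole, List.length_map, nsmul_one] at h3
    exact_mod_cast h3
  match l, hl, hζ, hpole, hlen with
  | [], _, _, hpole, _ => simp at hpole
  | [P], hl, hζ, _, _ =>
    rw [List.prod_singleton] at hζ
    exact (hl P (by simp)).same hζ.symm

/-- The factors `ζ` can be split off from a product. -/
lemma exists_same_pow_mul {l : List (ℂ → ℂ)} (hl : ∀ P ∈ l, SelbergClass P)
    (h : ∀ P ∈ l, Same P riemannZeta ∨ poleOrder P = 0) :
    ∃ (k : ℕ) (H : ℂ → ℂ), SelbergClass H ∧ Same l.prod (riemannZeta ^ k * H) ∧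
      (l.map poleOrder).sum = k := by
  induction l with
  | nil => exact ⟨0, 1, selbergClass_one, by simpa using Same.refl 1, by simp⟩
  | cons P l ih =>
    obtain ⟨k, H, hH, hs, hk⟩ := ih (fun Q hQ ↦ hl Q (by simp [hQ])) fun Q hQ ↦ h Q (by simp [hQ])
    rw [List.prod_cons, List.map_cons, List.sum_cons, hk]
    rcases h P (by simp) with hP | hP
    · refine ⟨k + 1, H, hH, ?_, ?_⟩
      · rw [pow_succ', mul_assoc]
        exact hP.mul hs
      · rw [hP.poleOrder_eq, poleOrder_riemannZeta]
        push_cast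
        ring
    · refine ⟨k, P * H, (hl P (by simp)).mul hH, ?_, by rw [hP, zero_add]⟩
      rw [mul_left_comm]
      exact (Same.refl P).mul hs

end Zeta

end Selberg

theorem proposition4p3 (hS : Selberg.Conjectures) (F : ℂ → ℂ) (hF : Selberg.SelbergClass F)
    (m : ℕ) (hm : meromorphicOrderAt F 1 = ((-(m : ℤ) : ℤ) : WithTop ℤ)) :
    Selberg.Divides (fun s ↦ riemannZeta s ^ m) F := by
  have hζ := hS.isPrimitive_riemannZeta
  obtain ⟨l, hl, hFl⟩ := hF.exists_factorization
  have hlS : ∀ P ∈ l, Selberg.SelbergClass P := fun P hP ↦ (hl P hP).1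
  have hone (p : ℕ) (hp : p.Prime) : Selberg.coeff riemannZeta p = (1 : ℕ → ℂ) p :=
    Selberg.coeff_riemannZeta hp.ne_zero
  -- Normality of the primitive function `ζ`, whose coefficients are all `1`.
  have h11 : Selberg.HasCorrelation 1 1 1 :=
    (hS.hasCorrelation_one hζ (Selberg.Same.refl _)).congr hone hone
  have hcases : ∀ P ∈ l, Selberg.Same P riemannZeta ∨ Selberg.poleOrder P = 0 := by
    intro P hP
    refine or_iff_not_imp_left.2 fun h ↦ ?_
    have h0 := (hS.hasCorrelation_zero (hl P hP) hζ h).congr (fun _ _ ↦ rfl) hone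
    -- With `n = 1` and `e = 0`, the factor has neither pole nor zero at `1`.
    simpa using (hlS P hP).mul_poleOrder_eq h0 h11
  obtain ⟨k, H, hH, hs, hk⟩ := Selberg.exists_same_pow_mul hlS hcases
  have hkm : k = m := by
    rw [← Selberg.poleOrder_list_prod hlS, ← hFl.poleOrder_eq, Selberg.poleOrder, hm,
      WithTop.untop₀_coe] at hk
    omega
  subst hkm
  exact ⟨Selberg.selbergClass_riemannZeta.pow k, hF, H, hH, hFl.trans hs⟩
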